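/- Let $n\ge 1$ and let $M^n$ be a $1$-connected (connected and simply connected) smooth $n$-manifold. *Frontal bundles.* A frontal bundle $(M^n,\mathcal E,\langle\,,\rangle,D,\xi,\zeta)$ consists of a smooth rank-$n$ vector bundle $\mathcal E\to M^n$ with a smooth (positive definite) metric $\langle\,,\rangle$, a smooth metric connection $D$, and two smooth bundle homomorphisms $\xi,\zeta:TM^n\to\mathcal E$ such that $$D_X\xi(Y)-D_Y\xi(X)-\xi([X,Y])=0,\qquad D_X\zeta(Y)-D_Y\zeta(X)-\zeta([X,Y])=0$$ for all smooth vector fields $X,Y$ on $M^n$, and $\langle \xi(X),\zeta(Y)\rangle=\langle\xi(Y),\zeta(X)\rangle$ for all $X,Y\in T_pM^n$, $p\in M^n$. Its first, second and third fundamental forms are $\langle\xi(X),\xi(Y)\rangle$, $-\langle\xi(X),\zeta(Y)\rangle$ and $\langle\zeta(X),\zeta(Y)\rangle$. Write $R^D(X,Y)v=D_XD_Yv-D_YD_Xv-D_{[X,Y]}v$. We consider the identity, for vector fields $X,Y$ and sections $v,w$ of $\mathcal E$, $$\langle R^D(X,Y)v,w\rangle=\det\begin{pmatrix}\langle\xi(Y),v\rangle&\langle\xi(Y),w\rangle\\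 \langle\zeta(X),v\rangle&\langle\zeta(X),w\rangle\end{pmatrix}+\det\begin{pmatrix}\langle\zeta(Y),v\rangle&\langle\zeta(Y),w\rangle\\ \langle\xi(X),v\rangle&\langle\xi(X),w\rangle\end{pmatrix}.\tag{G2}$$ *Spacelike frontals.* Let $L^{n+2}$ be Lorentz–Minkowski space of signature $(-,+,\dots,+)$ with coordinates $(z^0,\dots,z^{n+1})$, and let $Q^{n+1}_\pm=\{z\in L^{n+2}:\langle z,z\rangle=0,\ \pm z^0>0\}$. A smooth map $x:M^n\to Q^{n+1}_+$ is a spacelike frontal with dual $y$ if $y:M^n\to Q^{n+1}_-$ is a smooth map with $\langle x,y\rangle=1$ and $\langle dx,y\rangle=\langle dy,x\rangle=0$. Then the bundle $\{x,y\}^\perp\subset M^n\times L^{n+2}$, with the metric induced from $L^{n+2}$, the connection given by the $\{x,y\}^\perp$-component of the derivative in $L^{n+2}$, and the homomorphisms $dx$, $dy$, is called the bundle induced by $(x,y)$. We say that $(M^n,\mathcal E,\langle\,,\rangle,D,\xi,\zeta)$ is realized by $(x,y)$ if there is a smooth bundle isomorphism over the identity of $M^n$ from $\mathcal E$ to $\{x,y\}^\perp$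 that carries $\langle\,,\rangle$, $D$, $\xi$, $\zeta$ to the corresponding data of the induced bundle, and the first, second and third fundamental forms of the bundle are $\langle dx,dx\rangle$, $-\langle dx,dy\rangle$ and $\langle dy,dy\rangle$, respectively. **Theorem.** Every frontal bundle $(M^n,\mathcal E,\langle\,,\rangle,D,\xi,\zeta)$ over $M^n$ satisfying (G2) is realized by some spacelike frontal $x:M^n\to Q^{n+1}_+$ with a dual $y$; in particular, $\langle dx,dx\rangle$, $-\langle dx,dy\rangle$ and $\langle dy,dy\rangle$ are its first, second and third fundamental forms. Conversely, for every spacelike frontal $x:M^n\to Q^{n+1}_+$ and every dual $y$ of $x$ there is a frontal bundle over $M^n$ satisfying (G2) that is realized by $(x,y)$. -/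

import Mathlib

open Bundle VectorField
open scoped Manifold ContDiff

noncomputable section

/-! ### Coherent tangent bundles and frontal bundles

`M` is a manifold modelled on `ℝⁿ` and `E` a smooth vector bundle over `M` with typical fibre `F`.
The metric of `E` is given by (positive definite) inner products on the fibres that depend smoothly
on the base point. -/

section FrontalBundle

variable {n : ℕ} {M : Type*} [TopologicalSpace M] [ChartedSpace (EuclideanSpace ℝ (Fin n)) M]
  [IsManifold (𝓡 n) ∞ M]
  {F : Type*} [NormedAddCommGroup F] [NormedSpace ℝ F] [FiniteDimensional ℝ F]
  {E : M → Type*} [TopologicalSpace (TotalSpace F E)]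
  [∀ p, NormedAddCommGroup (E p)] [∀ p, InnerProductSpace ℝ (E p)]
  [FiberBundle F E] [VectorBundle ℝ F E] [ContMDiffVectorBundle ∞ F E (𝓡 n)]
  [IsContMDiffRiemannianBundle (𝓡 n) ∞ F E]

/-- `X` is a smooth (`C^∞`) vector field on `M`. -/
def IsSmoothVectorField (X : Π p : M, TangentSpace (𝓡 n) p) : Prop :=
  ContMDiff (𝓡 n) ((𝓡 n).prod 𝓘(ℝ, EuclideanSpace ℝ (Fin n))) ∞
    (fun p ↦ (⟨p, X p⟩ : TangentBundle (𝓡 n) M))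

variable (n F) in
/-- `v` is a smooth (`C^∞`) section of the bundle `E`. -/
def IsSmoothSection (v : Π p : M, E p) : Prop :=
  ContMDiff (𝓡 n) ((𝓡 n).prod 𝓘(ℝ, F)) ∞ (fun p ↦ (⟨p, v p⟩ : TotalSpace F E))

variable (n F) in
/-- `φ` is a smooth bundle homomorphism `TM → E`, that is, a smooth section of `Hom(TM, E)`. -/
def IsSmoothBundleHom (φ : Π p : M, TangentSpace (𝓡 n) p →L[ℝ] E p) : Prop :=
  ContMDiff (𝓡 n) ((𝓡 n).prod 𝓘(ℝ, EuclideanSpace ℝ (Fin n) →L[ℝ] F)) ∞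
    (fun p ↦ TotalSpace.mk' (EuclideanSpace ℝ (Fin n) →L[ℝ] F)
      (E := fun p : M ↦ TangentSpace (𝓡 n) p →L[ℝ] E p) p (φ p))

/-- `(M, E, ⟨,⟩, D, φ)` is a coherent tangent bundle. Here `D v p X` is `(D_X v)(p)`. -/
structure IsCoherentTangentBundle (D : CovariantDerivative (𝓡 n) F E)
    (φ : Π p : M, TangentSpace (𝓡 n) p →L[ℝ] E p) : Prop where
  rank_eq : Module.finrank ℝ F = n
  smooth_connection : CovariantDerivative.ContMDiffCovariantDerivative D ∞
  metric_connection : D.IsMetricCompatible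
  smooth_hom : IsSmoothBundleHom n F φ
  /-- `D_X φ(Y) - D_Y φ(X) - φ([X, Y]) = 0` -/
  torsion_free : ∀ X Y : Π p : M, TangentSpace (𝓡 n) p,
    IsSmoothVectorField X → IsSmoothVectorField Y → ∀ p : M,
      D (fun q ↦ φ q (Y q)) p (X p) - D (fun q ↦ φ q (X q)) p (Y p)
        - φ p (mlieBracket (𝓡 n) X Y p) = 0

/-- `(M, E, ⟨,⟩, D, ξ, ζ)` is a frontal bundle. -/
structure IsFrontalBundle (D : CovariantDerivative (𝓡 n) F E)
    (ξ ζ : Π p : M, TangentSpace (𝓡 n) p →L[ℝ] E p) : Prop where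
  coherent_first : IsCoherentTangentBundle D ξ
  coherent_second : IsCoherentTangentBundle D ζ
  compatible : ∀ (p : M) (X Y : TangentSpace (𝓡 n) p),
    inner ℝ (ξ p X) (ζ p Y) = inner ℝ (ξ p Y) (ζ p X)

/-- The first fundamental form `⟨ξ(X), ξ(Y)⟩`. -/
def firstForm (ξ : Π p : M, TangentSpace (𝓡 n) p →L[ℝ] E p)
    (p : M) (X Y : TangentSpace (𝓡 n) p) : ℝ :=
  inner ℝ (ξ p X) (ξ p Y)

/-- The second fundamental form `-⟨ξ(X), ζ(Y)⟩`. -/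
def secondForm (ξ ζ : Π p : M, TangentSpace (𝓡 n) p →L[ℝ] E p)
    (p : M) (X Y : TangentSpace (𝓡 n) p) : ℝ :=
  -inner ℝ (ξ p X) (ζ p Y)

/-- The third fundamental form `⟨ζ(X), ζ(Y)⟩`. -/
def thirdForm (ζ : Π p : M, TangentSpace (𝓡 n) p →L[ℝ] E p)
    (p : M) (X Y : TangentSpace (𝓡 n) p) : ℝ :=
  inner ℝ (ζ p X) (ζ p Y)

/-- The curvature `R^D(X, Y)v = D_X D_Y v - D_Y D_X v - D_{[X, Y]} v`. -/
def curvature (D : CovariantDerivative (𝓡 n) F E) (X Y : Π p : M, TangentSpace (𝓡 n) p)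
    (v : Π p : M, E p) (p : M) : E p :=
  D (fun q ↦ D v q (Y q)) p (X p) - D (fun q ↦ D v q (X q)) p (Y p)
    - D v p (mlieBracket (𝓡 n) X Y p)

/-- The curvature identity expressing `⟨R^D(X, Y)v, w⟩` through `ξ` and `ζ`. -/
def SatisfiesCurvatureIdentity (D : CovariantDerivative (𝓡 n) F E)
    (ξ ζ : Π p : M, TangentSpace (𝓡 n) p →L[ℝ] E p) : Prop :=
  ∀ (X Y : Π p : M, TangentSpace (𝓡 n) p) (v w : Π p : M, E p),
    IsSmoothVectorField X → IsSmoothVectorField Y → IsSmoothSection n F v → IsSmoothSection n F w →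
    ∀ p : M, inner ℝ (curvature D X Y v p) (w p) =
      Matrix.det !![inner ℝ (ξ p (Y p)) (v p), inner ℝ (ξ p (Y p)) (w p);
                    inner ℝ (ζ p (X p)) (v p), inner ℝ (ζ p (X p)) (w p)]
      + Matrix.det !![inner ℝ (ζ p (Y p)) (v p), inner ℝ (ζ p (Y p)) (w p);
                      inner ℝ (ξ p (X p)) (v p), inner ℝ (ξ p (X p)) (w p)]

end FrontalBundle

/-! ### Spacelike frontals in the lightcone -/

/-- Lorentz-Minkowski space `L^{n+2}` with coordinates `(z⁰, …, z^{n+1})`. -/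
abbrev LorentzSpace (n : ℕ) : Type := Fin (n + 2) → ℝ

/-- The Lorentzian inner product of signature `(-, +, …, +)`. -/
def lorentz {n : ℕ} (z w : LorentzSpace n) : ℝ :=
  -(z 0 * w 0) + ∑ i : Fin (n + 1), z i.succ * w i.succ

/-- The upper lightcone `Q^{n+1}_+`. -/
def upperLightcone (n : ℕ) : Set (LorentzSpace n) := {z | lorentz z z = 0 ∧ 0 < z 0}

/-- The lower lightcone `Q^{n+1}_-`. -/
def lowerLightcone (n : ℕ) : Set (LorentzSpace n) := {z | lorentz z z = 0 ∧ z 0 < 0}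

/-- The component of `z` in `{x, y}^⊥`, where `x`, `y` are null vectors with `⟨x, y⟩ = 1`. -/
def tangentialPart {n : ℕ} (x y z : LorentzSpace n) : LorentzSpace n :=
  z - lorentz z y • x - lorentz z x • y

section Frontal

variable {n : ℕ} {M : Type*} [TopologicalSpace M] [ChartedSpace (EuclideanSpace ℝ (Fin n)) M]

/-- The differential at `p` of a map `x : M → L^{n+2}`. -/
def differential (x : M → LorentzSpace n) (p : M) :
    TangentSpace (𝓡 n) p →L[ℝ] LorentzSpace n :=
  mvfderiv (𝓡 n) x p

/-- `x : M → Q^{n+1}_+` is a spacelike frontal with dual `y : M → Q^{n+1}_-`. -/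
structure IsSpacelikeFrontalWithDual (x y : M → LorentzSpace n) : Prop where
  smooth_fst : ContMDiff (𝓡 n) 𝓘(ℝ, LorentzSpace n) ∞ x
  smooth_snd : ContMDiff (𝓡 n) 𝓘(ℝ, LorentzSpace n) ∞ y
  fst_mem : ∀ p, x p ∈ upperLightcone n
  snd_mem : ∀ p, y p ∈ lowerLightcone n
  pairing : ∀ p, lorentz (x p) (y p) = 1
  differential_fst : ∀ (p : M) (X : TangentSpace (𝓡 n) p), lorentz (differential x p X) (y p) = 0
  differential_snd : ∀ (p : M) (X : TangentSpace (𝓡 n) p), lorentz (differential y p X) (x p) = 0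

variable [IsManifold (𝓡 n) ∞ M]
  {F : Type*} [NormedAddCommGroup F] [NormedSpace ℝ F]
  {E : M → Type*} [TopologicalSpace (TotalSpace F E)]
  [∀ p, NormedAddCommGroup (E p)] [∀ p, InnerProductSpace ℝ (E p)]
  [FiberBundle F E]

/-- `ι` identifies `(E, ⟨,⟩, D, ξ, ζ)` with the bundle `{x, y}^⊥ ⊂ M × L^{n+2}` equipped with the
Lorentzian inner product, the tangential part of the flat connection, and the homomorphisms
`dx` and `dy`. -/
structure IsRealization (D : CovariantDerivative (𝓡 n) F E)
    (ξ ζ : Π p : M, TangentSpace (𝓡 n) p →L[ℝ] E p) (x y : M → LorentzSpace n)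
    (ι : Π p : M, E p →ₗ[ℝ] LorentzSpace n) : Prop where
  smooth : ∀ v : Π p : M, E p, IsSmoothSection n F v →
    ContMDiff (𝓡 n) 𝓘(ℝ, LorentzSpace n) ∞ (fun p ↦ ι p (v p))
  isometric : ∀ (p : M) (v w : E p), lorentz (ι p v) (ι p w) = inner ℝ v w
  range_eq : ∀ p : M, Set.range (ι p) = {z | lorentz z (x p) = 0 ∧ lorentz z (y p) = 0}
  map_first : ∀ (p : M) (X : TangentSpace (𝓡 n) p), ι p (ξ p X) = differential x p X
  map_second : ∀ (p : M) (X : TangentSpace (𝓡 n) p), ι p (ζ p X) = differential y p X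
  map_connection : ∀ v : Π p : M, E p, IsSmoothSection n F v →
    ∀ (p : M) (X : TangentSpace (𝓡 n) p), ι p (D v p X) =
      tangentialPart (x p) (y p) (differential (fun q ↦ ι q (v q)) p X)

/-- The frontal bundle `(E, ⟨,⟩, D, ξ, ζ)` is realized by the spacelike frontal `x` with dual `y`:
it is isomorphic to the frontal bundle induced by `(x, y)`, and its first, second and third
fundamental forms are `⟨dx, dx⟩`, `-⟨dx, dy⟩` and `⟨dy, dy⟩`. -/
structure IsRealizedBy (D : CovariantDerivative (𝓡 n) F E)
    (ξ ζ : Π p : M, TangentSpace (𝓡 n) p →L[ℝ] E p) (x y : M → LorentzSpace n) : Prop where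
  exists_realization : ∃ ι : Π p : M, E p →ₗ[ℝ] LorentzSpace n, IsRealization D ξ ζ x y ι
  firstForm_eq : ∀ (p : M) (X Y : TangentSpace (𝓡 n) p),
    firstForm ξ p X Y = lorentz (differential x p X) (differential x p Y)
  secondForm_eq : ∀ (p : M) (X Y : TangentSpace (𝓡 n) p),
    secondForm ξ ζ p X Y = -lorentz (differential x p X) (differential y p Y)
  thirdForm_eq : ∀ (p : M) (X Y : TangentSpace (𝓡 n) p),
    thirdForm ζ p X Y = lorentz (differential y p X) (differential y p Y)

end Frontal

end

/-! Suppose `x`, `y` were already given. Differentiating `v + a x + b y` in L^{n+2}, with `v` a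
section of {x, y}^⊥, gives `D v + a ξ + b ζ` in {x, y}^⊥ and the coefficients `da - ⟨v, ζ⟩` of `x`
and `db - ⟨v, ξ⟩` of `y`. These formulas use only the data of the frontal bundle, so they define a
connection `tripleDeriv` on E ⊕ ℝ ⊕ ℝ. It preserves the Lorentzian form `tripleForm` because D is
metric (`IsFrontalBundle.mvfderiv_tripleForm`). It is flat because (G2), the two torsion equations
and the symmetry of ⟨ξ(X), ζ(Y)⟩ are exactly the components of flatness
(`IsFrontalBundle.tripleDeriv_comm`).

A flat connection is locally trivial. In a frame this is the system `dU = U 𝒜`, solved along rays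
from a point; Grönwall's inequality compares neighbouring rays and flatness makes the first-order
error vanish (`exists_flat_solution`). Since M is simply connected, the local trivializations glue
to a global parallel isometry Φ from E ⊕ ℝ ⊕ ℝ to L^{n+2}: local solutions form a covering space,
which has a section (`exists_global_solution`, `IsFrontalBundle.exists_isometric_intertwiner`). Then
`x = Φ(0, 1, 0)` and `y = Φ(0, 0, 1)` are null with product 1, and their differentials are Φ applied
to ξ and ζ. The initial value of Φ puts `x` in the upper cone at one point; connectedness keeps it
there, and ⟨x, y⟩ = 1 forces `y` into the lower cone.

Conversely, {x, y}^⊥ is glued from two explicit isometric frames, one for each of two light-like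
poles, at least one of which is usable at every point. Torsion-freeness is the tangential part of
X(Yf) - Y(Xf) = [X, Y]f for f = x, y. (G2) is the Gauss equation of {x, y}^⊥ in the flat bundle M ×
L^{n+2} (`IsSpacelikeFrontalWithDual.inclusion_screenConnection_screenConnection`). -/

noncomputable section

/-! ### Flat linear systems: existence by integration along rays -/

section FlatSystem

open Set Filter Topology Metric NNReal

variable {V : Type*} [NormedAddCommGroup V] [NormedSpace ℝ V]
  {R : Type*} [NormedRing R] [NormedAlgebra ℝ R]

/-- The linear equation `u' = u * A(tx)x` along a ray has a solution on `[0, 1]`. -/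
theorem exists_radial_solution [NormOneClass R] [CompleteSpace R] {A : V → V →L[ℝ] R} {x : V}
    (hc : ContinuousOn (fun t : ℝ ↦ A (t • x) x) (Icc 0 1))
    (hb : ∀ t ∈ Icc (0 : ℝ) 1, ‖A (t • x) x‖ ≤ 1 / 2) :
    ∃ u : ℝ → R, u 0 = 1 ∧
      ∀ t ∈ Icc (0 : ℝ) 1, HasDerivWithinAt u (u t * A (t • x) x) (Icc 0 1) t := by
  -- In the ball of radius 1 about 1 one has ‖u‖ ≤ 2, so the bound 1/2 gives speed at most 1, and a
  -- solution cannot leave the ball during [0, 1].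
  have hp : IsPicardLindelof (fun (t : ℝ) (u : R) ↦ u * A (t • x) x)
      (⟨0, by simp⟩ : Icc (0 : ℝ) 1) (1 : R) 1 0 1 1 := by
    refine ⟨fun t ht ↦ ?_, fun u _ ↦ continuousOn_const.mul hc, fun t ht u hu ↦ ?_, by simp⟩
    · refine LipschitzOnWith.of_dist_le_mul fun u _ w _ ↦ ?_
      rw [dist_eq_norm, dist_eq_norm, ← sub_mul]
      refine (norm_mul_le _ _).trans ?_
      have := hb t ht
      simp only [NNReal.coe_one, one_mul]
      nlinarith [norm_nonneg (u - w)]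
    · have h1 : ‖u‖ ≤ 2 := by
        have := norm_le_norm_add_norm_sub' u 1
        rw [mem_closedBall, dist_eq_norm] at hu
        rw [norm_one] at this
        simp only [NNReal.coe_one] at hu
        linarith
      refine (norm_mul_le _ _).trans ?_
      have := hb t ht
      have := norm_nonneg (A (t • x) x)
      simp only [NNReal.coe_one]
      nlinarith
  obtain ⟨u, hu0, hu⟩ := hp.exists_eq_forall_mem_Icc_hasDerivWithinAt₀
  exact ⟨u, hu0, hu⟩

/-- First order Taylor estimate with Lipschitz derivative. -/
theorem norm_sub_sub_fderiv_le {G : Type*} [NormedAddCommGroup G] [NormedSpace ℝ G]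
    {f : V → G} {f' : V → V →L[ℝ] G} {s : Set V} {C : ℝ} (hs : Convex ℝ s)
    (hf : ∀ y ∈ s, HasFDerivAt f (f' y) y)
    (hlip : ∀ y ∈ s, ∀ z ∈ s, ‖f' y - f' z‖ ≤ C * ‖y - z‖) (hC : 0 ≤ C) {y k : V}
    (hy : y ∈ s) (hk : y + k ∈ s) : ‖f (y + k) - f y - f' y k‖ ≤ C * ‖k‖ ^ 2 := by
  -- Mean value inequality on the part of `s` within ‖k‖ of `y`, where the derivative varies by at
  -- most C‖k‖.
  have := Convex.norm_image_sub_le_of_norm_hasFDerivWithin_le' (f := f) (f' := f')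
    (s := s ∩ closedBall y ‖k‖) (C := C * ‖k‖) (φ := f' y) (x := y) (y := y + k)
    (fun z hz ↦ (hf z hz.1).hasFDerivWithinAt)
    (fun z hz ↦ (hlip z hz.1 y hy).trans (mul_le_mul_of_nonneg_left
      (by simpa [dist_eq_norm] using hz.2) hC))
    (hs.inter (convex_closedBall _ _)) ⟨hy, by simp⟩ ⟨hk, by simp⟩
  simpa [pow_two, mul_assoc] using this

/-- The algebraic identity behind the comparison of neighbouring radial solutions. -/
theorem flat_comparison_identity (u a b da A0 Ak dh s s' R' X k h : R)
    (flat : dh + X * k = da + k * X) (hs : s = X + h + da + b + R') (hs' : s = s' + X)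
    (ha : A0 = X) (hAk : Ak = k) (hab : a = u + u * k) :
    (u * A0 + (u * A0) * Ak + u * (dh + h)) - a * s = -(u * b) - u * R' - u * k * s' := by
  subst ha hAk hab
  have e1 : dh = da + Ak * A0 - A0 * Ak := by rw [← flat]; abel
  -- `s` is expanded to second order where it multiplies `u`, but only to zeroth order where it
  -- multiplies the already small `u * Ak`. What survives is quadratic in the increment.
  have e2 : (u + u * Ak) * s = u * (A0 + h + da + b + R') + u * Ak * (s' + A0) := by
    rw [← hs', ← hs, add_mul]
  rw [e2, e1]
  noncomm_ring

/-- The error estimate showing that `u + u 𝒜(tx)(th)` nearly solves the equation along the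
ray through `x + h`. -/
theorem flat_comparison_bound {A : V → V →L[ℝ] R} {A' : V → V →L[ℝ] V →L[ℝ] R} {r C K : ℝ}
    (hC : 0 ≤ C) (hA : ∀ y ∈ ball (0 : V) r, HasFDerivAt A (A' y) y)
    (hb : ∀ y ∈ ball (0 : V) r, ‖A y‖ ≤ C) (hb' : ∀ y ∈ ball (0 : V) r, ‖A' y‖ ≤ C)
    (hlip : ∀ y ∈ ball (0 : V) r, ∀ z ∈ ball (0 : V) r, ‖A' y - A' z‖ ≤ C * ‖y - z‖)
    (flat : ∀ y ∈ ball (0 : V) r, ∀ v w, A' y v w + A y v * A y w = A' y w v + A y w * A y v)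
    {x h : V} (hx : x ∈ ball (0 : V) r) (hxh : x + h ∈ ball (0 : V) r)
    (hxh1 : ‖x + h‖ ≤ 1) {t : ℝ} (ht : t ∈ Icc (0 : ℝ) 1) {u : R} (hu : ‖u‖ ≤ K) :
    ‖(u * A (t • x) x + (u * A (t • x) x) * A (t • x) (t • h)
        + u * (A' (t • x) x (t • h) + A (t • x) h))
      - (u + u * A (t • x) (t • h)) * A (t • (x + h)) (x + h)‖
      ≤ K * (2 * C + 2 * C ^ 2) * ‖h‖ ^ 2 := by
  have hK : 0 ≤ K := (norm_nonneg _).trans hu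
  have hsm : ∀ z ∈ ball (0 : V) r, t • z ∈ ball (0 : V) r := by
    intro z hz
    rw [mem_ball_zero_iff, norm_smul, Real.norm_of_nonneg ht.1] at *
    exact lt_of_le_of_lt (mul_le_of_le_one_left (norm_nonneg _) ht.2) hz
  have hy := hsm x hx
  have hyk : t • x + t • h ∈ ball (0 : V) r := by rw [← smul_add]; exact hsm _ hxh
  have hk : ‖t • h‖ ≤ ‖h‖ := by
    rw [norm_smul, Real.norm_of_nonneg ht.1]
    exact mul_le_of_le_one_left (norm_nonneg _) ht.2
  rw [smul_add]
  set y := t • x with hydef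
  set k := t • h with hkdef
  have taylor := norm_sub_sub_fderiv_le (convex_ball (0 : V) r) hA hlip hC hy hyk
  have taylor0 : ‖A (y + k) - A y‖ ≤ C * ‖k‖ := by
    have := Convex.norm_image_sub_le_of_norm_hasFDerivWithin_le (f := A) (f' := A')
      (fun z hz ↦ (hA z hz).hasFDerivWithinAt) hb' (convex_ball (0 : V) r) hy hyk
    simpa using this
  set T := A (y + k) - A y - A' y k with hT
  have hid := flat_comparison_identity u (u + u * A y k) (A' y k h) (A' y k x) (A y x) (A y k)
    (A' y x k) (A (y + k) (x + h)) ((A (y + k) - A y) (x + h) + A y h) (T (x + h)) (A y x)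
    (A y k) (A y h) (flat y hy x k)
    (by simp only [hT, sub_apply, map_add]; abel)
    (by simp only [sub_apply, map_add]; abel) rfl rfl rfl
  rw [hid]
  have hC2 : C * ‖k‖ ^ 2 ≤ C * ‖h‖ ^ 2 := by gcongr
  have b1 : ‖u * A' y k h‖ ≤ K * (C * ‖h‖ ^ 2) := by
    refine (norm_mul_le _ _).trans (mul_le_mul hu ?_ (norm_nonneg _) hK)
    calc ‖A' y k h‖ ≤ ‖A' y‖ * ‖k‖ * ‖h‖ := (A' y).le_opNorm₂ k h
      _ ≤ C * ‖h‖ * ‖h‖ := by gcongr; exact hb' y hy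
      _ = C * ‖h‖ ^ 2 := by ring
  have b2 : ‖u * T (x + h)‖ ≤ K * (C * ‖h‖ ^ 2) := by
    refine (norm_mul_le _ _).trans (mul_le_mul hu ?_ (norm_nonneg _) hK)
    calc ‖T (x + h)‖ ≤ ‖T‖ * ‖x + h‖ := T.le_opNorm _
      _ ≤ ‖T‖ * 1 := by gcongr
      _ ≤ C * ‖h‖ ^ 2 := by rw [mul_one]; exact taylor.trans hC2
  have b3 : ‖u * A y k * ((A (y + k) - A y) (x + h) + A y h)‖ ≤ K * (2 * C ^ 2 * ‖h‖ ^ 2) := by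
    rw [mul_assoc]
    refine (norm_mul_le _ _).trans (mul_le_mul hu ?_ (norm_nonneg _) hK)
    have c1 : ‖A y k‖ ≤ C * ‖h‖ := ((A y).le_opNorm _).trans (by gcongr; exact hb y hy)
    have c2 : ‖A y h‖ ≤ C * ‖h‖ := ((A y).le_opNorm _).trans (by gcongr; exact hb y hy)
    have c3 : ‖(A (y + k) - A y) (x + h)‖ ≤ C * ‖h‖ := by
      calc _ ≤ ‖A (y + k) - A y‖ * ‖x + h‖ := ContinuousLinearMap.le_opNorm _ _
        _ ≤ (C * ‖k‖) * 1 := by gcongr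
        _ ≤ C * ‖h‖ := by rw [mul_one]; gcongr
    calc _ ≤ ‖A y k‖ * ‖(A (y + k) - A y) (x + h) + A y h‖ := norm_mul_le _ _
      _ ≤ (C * ‖h‖) * (C * ‖h‖ + C * ‖h‖) := by
          gcongr; exact (norm_add_le _ _).trans (by gcongr)
      _ = _ := by ring
  calc _ ≤ ‖u * A' y k h‖ + ‖u * T (x + h)‖
        + ‖u * A y k * ((A (y + k) - A y) (x + h) + A y h)‖ := by
        refine (norm_sub_le _ _).trans (add_le_add ((norm_sub_le _ _).trans ?_) le_rfl)
        rw [norm_neg]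
    _ ≤ _ := by linarith

/-- A flat linear system `dU = U 𝒜` on a ball has a solution near the centre. -/
theorem exists_flat_solution_of_bounds [NormOneClass R] [CompleteSpace R]
    {A : V → V →L[ℝ] R} {A' : V → V →L[ℝ] V →L[ℝ] R} {r C : ℝ} (hr : 0 < r)
    (hC : 0 ≤ C) (hA : ∀ y ∈ ball (0 : V) r, HasFDerivAt A (A' y) y)
    (hb : ∀ y ∈ ball (0 : V) r, ‖A y‖ ≤ C) (hb' : ∀ y ∈ ball (0 : V) r, ‖A' y‖ ≤ C)
    (hlip : ∀ y ∈ ball (0 : V) r, ∀ z ∈ ball (0 : V) r, ‖A' y - A' z‖ ≤ C * ‖y - z‖)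
    (flat : ∀ y ∈ ball (0 : V) r, ∀ v w, A' y v w + A y v * A y w = A' y w v + A y w * A y v) :
    ∃ ρ > 0, ∃ U : V → R, U 0 = 1 ∧
      ∀ x ∈ ball (0 : V) ρ, HasFDerivAt U ((ContinuousLinearMap.mul ℝ R (U x)).comp (A x)) x := by
  -- This radius gives both Cρ ≤ 1/2, needed by the radial equation, and ρ ≤ 1, needed by the
  -- comparison estimate.
  set ρ := min r (1 / (2 * C + 2)) with hρ
  have hρ0 : 0 < ρ := lt_min hr (by positivity)
  have hρr : ρ ≤ r := min_le_left _ _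
  have hρC : C * ρ ≤ 1 / 2 := by
    have : C * ρ ≤ C * (1 / (2 * C + 2)) := by gcongr; exact min_le_right _ _
    refine this.trans ?_
    rw [mul_one_div, div_le_div_iff₀ (by positivity) (by norm_num)]
    linarith
  have hρ1 : ρ ≤ 1 := (min_le_right _ _).trans (by
    rw [div_le_one (by positivity)]; linarith)
  have hsm : ∀ x ∈ ball (0 : V) ρ, ∀ t ∈ Icc (0 : ℝ) 1, t • x ∈ ball (0 : V) r := by
    intro z hz t ht
    rw [mem_ball_zero_iff, norm_smul, Real.norm_of_nonneg ht.1] at *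
    exact lt_of_le_of_lt (mul_le_of_le_one_left (norm_nonneg _) ht.2) (hz.trans_le hρr)
  have hbx : ∀ x ∈ ball (0 : V) ρ, ∀ t ∈ Icc (0 : ℝ) 1, ‖A (t • x) x‖ ≤ 1 / 2 := by
    intro x hx t ht
    calc ‖A (t • x) x‖ ≤ ‖A (t • x)‖ * ‖x‖ := (A _).le_opNorm _
      _ ≤ C * ρ := by
        gcongr
        · exact hb _ (hsm x hx t ht)
        · exact (mem_ball_zero_iff.1 hx).le
      _ ≤ 1 / 2 := hρC
  have hcx : ∀ x ∈ ball (0 : V) ρ, ContinuousOn (fun t : ℝ ↦ A (t • x) x) (Icc 0 1) := by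
    intro x hx t ht
    have h1 : ContinuousAt (fun t : ℝ ↦ t • x) t := by fun_prop
    have h2 : ContinuousAt (fun t : ℝ ↦ A (t • x)) t :=
      ContinuousAt.comp (g := A) (hA _ (hsm x hx t ht)).continuousAt h1
    exact (h2.clm_apply continuousAt_const).continuousWithinAt
  have hex : ∀ x, ∃ u : ℝ → R, x ∈ ball (0 : V) ρ → u 0 = 1 ∧
      ∀ t ∈ Icc (0 : ℝ) 1, HasDerivWithinAt u (u t * A (t • x) x) (Icc 0 1) t := by
    intro x
    by_cases hx : x ∈ ball (0 : V) ρ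
    · obtain ⟨u, hu⟩ := exists_radial_solution (hcx x hx) (hbx x hx)
      exact ⟨u, fun _ ↦ hu⟩
    · exact ⟨0, fun h ↦ (hx h).elim⟩
  choose u hu using hex
  have hucont : ∀ x ∈ ball (0 : V) ρ, ContinuousOn (u x) (Icc 0 1) :=
    fun x hx t ht ↦ ((hu x hx).2 t ht).continuousWithinAt
  have hright : ∀ x ∈ ball (0 : V) ρ, ∀ t ∈ Ico (0 : ℝ) 1,
      HasDerivWithinAt (u x) (u x t * A (t • x) x) (Ici t) t := fun x hx t ht ↦
    ((hu x hx).2 t ⟨ht.1, ht.2.le⟩).mono_of_mem_nhdsWithin (Icc_mem_nhdsGE_of_mem ht)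
  have hlipf : ∀ x ∈ ball (0 : V) ρ, ∀ t ∈ Ico (0 : ℝ) 1,
      LipschitzOnWith 1 (fun w : R ↦ w * A (t • x) x) univ := by
    intro x hx t ht
    refine LipschitzOnWith.of_dist_le_mul fun w _ z _ ↦ ?_
    rw [dist_eq_norm, dist_eq_norm, ← sub_mul]
    refine (norm_mul_le _ _).trans ?_
    have := hbx x hx t ⟨ht.1, ht.2.le⟩
    simp only [NNReal.coe_one, one_mul]
    nlinarith [norm_nonneg (w - z)]
  refine ⟨ρ, hρ0, fun x ↦ u x 1, ?_, fun x hx ↦ ?_⟩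
  -- At the origin the coefficient `A 0 0` vanishes, so the constant 1 solves the same equation.
  · have h0 : (0 : V) ∈ ball (0 : V) ρ := mem_ball_self hρ0
    have := dist_le_of_approx_trajectories_ODE_of_mem (K := 1) (δ := 0) (εf := 0) (εg := 0)
      (v := fun (t : ℝ) (w : R) ↦ w * A (t • (0 : V)) 0) (s := fun _ ↦ univ) (a := 0) (b := 1)
      (f := u 0) (f' := fun t ↦ u 0 t * A (t • (0 : V)) 0) (g := fun _ ↦ 1) (g' := fun _ ↦ 0)
      (hlipf 0 h0) (hucont 0 h0) (hright 0 h0) (by simp) (fun _ _ ↦ mem_univ _)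
      continuousOn_const (fun t _ ↦ (hasDerivAt_const t (1 : R)).hasDerivWithinAt) (by simp)
      (fun _ _ ↦ mem_univ _) (by simp [(hu 0 h0).1]) 1 (by simp)
    simp only [add_zero, gronwallBound_ε0, zero_mul, dist_le_zero] at this
    exact this
  · obtain ⟨K, hK⟩ := isCompact_Icc.exists_bound_of_continuousOn (hucont x hx)
    have hK0 : 0 ≤ K := (norm_nonneg _).trans (hK 0 (by simp))
    set B := K * (2 * C + 2 * C ^ 2) * (Real.exp 1 - 1) with hB
    have key : ∀ h, x + h ∈ ball (0 : V) ρ →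
        ‖u (x + h) 1 - u x 1 - u x 1 * A x h‖ ≤ B * ‖h‖ ^ 2 := by
      intro h hh
      -- First-order prediction of the solution along the ray through `x + h`. It has the right
      -- initial value and solves the equation up to O(‖h‖²); at t = 1 it is U(x) + U(x) A(x) h, so
      -- Grönwall's inequality identifies the derivative of U.
      set v : ℝ → R := fun t ↦ u x t + u x t * A (t • x) (t • h) with hv
      have hv' : ∀ t ∈ Icc (0 : ℝ) 1, HasDerivWithinAt v
          (u x t * A (t • x) x + ((u x t * A (t • x) x) * A (t • x) (t • h)
            + u x t * (A' (t • x) x (t • h) + A (t • x) h))) (Icc 0 1) t := by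
        intro t ht
        have d1 : HasDerivAt (fun s : ℝ ↦ A (s • x)) (A' (t • x) x) t := by
          have e1 : HasDerivAt (fun s : ℝ ↦ s • x) x t := by
            simpa using (hasDerivAt_id t).smul_const x
          exact (hA _ (hsm x hx t ht)).comp_hasDerivAt t e1
        have d2 : HasDerivAt (fun s : ℝ ↦ s • h) h t := by
          simpa using (hasDerivAt_id t).smul_const h
        have d3 := (d1.clm_apply d2).hasDerivWithinAt (s := Icc 0 1)
        have d4 := (hu x hx).2 t ht
        exact d4.add (d4.mul d3)
      have hε := dist_le_of_approx_trajectories_ODE_of_mem (K := 1) (δ := 0)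
        (εf := 0) (εg := K * (2 * C + 2 * C ^ 2) * ‖h‖ ^ 2)
        (v := fun (t : ℝ) (w : R) ↦ w * A (t • (x + h)) (x + h)) (s := fun _ ↦ univ)
        (a := 0) (b := 1)
        (f := u (x + h)) (f' := fun t ↦ u (x + h) t * A (t • (x + h)) (x + h)) (g := v)
        (hlipf _ hh) (hucont _ hh) (hright _ hh) (by simp) (fun _ _ ↦ mem_univ _)
        (fun t ht ↦ (hv' t ht).continuousWithinAt)
        (fun t ht ↦ (hv' t ⟨ht.1, ht.2.le⟩).mono_of_mem_nhdsWithin (Icc_mem_nhdsGE_of_mem ht))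
        (fun t ht ↦ by
          rw [dist_eq_norm, ← add_assoc]
          exact flat_comparison_bound hC hA hb hb' hlip flat (ball_subset_ball hρr hx)
            (ball_subset_ball hρr hh) ((mem_ball_zero_iff.1 hh).le.trans hρ1)
            ⟨ht.1, ht.2.le⟩ (hK t ⟨ht.1, ht.2.le⟩))
        (fun _ _ ↦ mem_univ _) (by simp [hv, (hu x hx).1, (hu _ hh).1]) 1 (by simp)
      rw [gronwallBound_of_K_ne_0 (by simp)] at hε
      simp only [hv, dist_eq_norm, NNReal.coe_one, one_smul] at hε
      rw [← sub_sub] at hε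
      refine hε.trans (le_of_eq ?_)
      rw [hB]; simp; ring
    rw [hasFDerivAt_iff_isLittleO_nhds_zero]
    have hO : (fun h : V ↦ u (x + h) 1 - u x 1 -
        ((ContinuousLinearMap.mul ℝ R (u x 1)).comp (A x)) h) =O[𝓝 0] fun h ↦ ‖h‖ ^ 2 := by
      refine Asymptotics.IsBigO.of_bound B ?_
      have hmem : ∀ᶠ h in 𝓝 (0 : V), x + h ∈ ball (0 : V) ρ := by
        have : Tendsto (fun h : V ↦ x + h) (𝓝 0) (𝓝 (x + 0)) := by
          exact (continuous_const.add continuous_id).tendsto 0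
        rw [add_zero] at this
        exact this.eventually (isOpen_ball.mem_nhds hx)
      filter_upwards [hmem] with h hh
      simpa using key h hh
    exact hO.trans_isLittleO (by
      simpa using Asymptotics.isLittleO_norm_pow_id (E' := V) one_lt_two)

end FlatSystem

/-! ### Smoothness and invertibility of solutions of flat systems -/

section FlatSystem

open Set Filter Topology Metric NNReal

variable {V : Type*} [NormedAddCommGroup V] [NormedSpace ℝ V]
  {R : Type*} [NormedRing R] [NormedAlgebra ℝ R]

/-- `C¹` solutions of `dU = U 𝒜` with smooth `𝒜` are smooth. -/
theorem contDiffOn_of_flat_solution {A : V → V →L[ℝ] R} {U : V → R} {s : Set V} (hs : IsOpen s)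
    (hA : ContDiffOn ℝ ∞ A s)
    (hU : ∀ x ∈ s, HasFDerivAt U ((ContinuousLinearMap.mul ℝ R (U x)).comp (A x)) x) :
    ContDiffOn ℝ ∞ U s := by
  rw [contDiffOn_infty]
  intro n
  induction n with
  | zero =>
    exact contDiffOn_zero.2 fun x hx ↦ (hU x hx).continuousAt.continuousWithinAt
  | succ n ih =>
    have : ((n + 1 : ℕ) : WithTop ℕ∞) = (n : WithTop ℕ∞) + 1 := by norm_cast
    rw [this, contDiffOn_succ_iff_fderiv_of_isOpen hs]
    refine ⟨fun x hx ↦ (hU x hx).differentiableAt.differentiableWithinAt, by simp, ?_⟩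
    -- Bootstrapping: the equation makes dU as regular as U itself.
    refine ContDiffOn.congr (f := fun x ↦ (ContinuousLinearMap.mul ℝ R (U x)).comp (A x)) ?_
      fun x hx ↦ (hU x hx).fderiv
    exact (((ContinuousLinearMap.mul ℝ R).contDiff.comp_contDiffOn ih)).clm_comp
      (hA.of_le (by exact_mod_cast le_top))

/-- A `C¹` map is bounded and Lipschitz near every point. -/
theorem exists_bound_and_lipschitz {G : Type*} [NormedAddCommGroup G] [NormedSpace ℝ G]
    {f : V → G} {c : V} (hf : ContDiffAt ℝ 1 f c) : ∃ C : ℝ, ∃ r > 0, 0 ≤ C ∧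
      (∀ y ∈ ball c r, ‖f y‖ ≤ C) ∧
      ∀ y ∈ ball c r, ∀ z ∈ ball c r, ‖f y - f z‖ ≤ C * ‖y - z‖ := by
  obtain ⟨K, t, ht, hlip⟩ := hf.exists_lipschitzOnWith
  have e1 : ∀ᶠ y in 𝓝 c, ‖f y‖ < ‖f c‖ + 1 :=
    hf.continuousAt.norm.eventually_lt continuousAt_const (lt_add_one _)
  obtain ⟨r, hr, hball⟩ := Metric.mem_nhds_iff.1 (inter_mem ht e1)
  refine ⟨max (‖f c‖ + 1) K, r, hr, K.2.trans (le_max_right _ _),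
    fun y hy ↦ (hball hy).2.le.trans (le_max_left _ _), fun y hy z hz ↦ ?_⟩
  exact (hlip.norm_sub_le (hball hy).1 (hball hz).1).trans
    (mul_le_mul_of_nonneg_right (le_max_right _ _) (norm_nonneg _))

set_option synthInstance.maxHeartbeats 200000 in
/-- Frobenius theorem for flat linear systems `dU = U 𝒜`. -/
theorem exists_flat_solution [NormOneClass R] [CompleteSpace R]
    {A : V → V →L[ℝ] R} {s : Set V} (hs : IsOpen s) {c : V} (hc : c ∈ s)
    (hA : ContDiffOn ℝ ∞ A s)
    (flat : ∀ y ∈ s, ∀ v w,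
      fderiv ℝ A y v w + A y v * A y w = fderiv ℝ A y w v + A y w * A y v) :
    ∃ ρ > 0, ball c ρ ⊆ s ∧ ∃ U : V → R, ContDiffOn ℝ ∞ U (ball c ρ) ∧
      (∀ x ∈ ball c ρ, IsUnit (U x)) ∧
      ∀ x ∈ ball c ρ, HasFDerivAt U ((ContinuousLinearMap.mul ℝ R (U x)).comp (A x)) x := by
  have hAc : ContDiffAt ℝ ∞ A c := hA.contDiffAt (hs.mem_nhds hc)
  have hA'c : ContDiffAt ℝ 1 (fderiv ℝ A) c :=
    hAc.fderiv_right (m := 1) (by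
      rw [one_add_one_eq_two]; exact WithTop.coe_le_coe.2 (le_top : (2 : ℕ∞) ≤ ⊤))
  obtain ⟨C₁, r₁, hr₁, hC₁, hb₁, -⟩ :=
    exists_bound_and_lipschitz (hAc.of_le (by exact_mod_cast le_top))
  obtain ⟨C₂, r₂, hr₂, hC₂, hb₂, hlip⟩ := exists_bound_and_lipschitz hA'c
  obtain ⟨r₃, hr₃, hball₃⟩ := Metric.isOpen_iff.1 hs c hc
  set r := min r₃ (min r₁ r₂) with hrdef
  have hr : 0 < r := by positivity
  have hball : ball c r ⊆ s := (ball_subset_ball (min_le_left _ _)).trans hball₃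
  have hball₁ : ball c r ⊆ ball c r₁ :=
    ball_subset_ball ((min_le_right _ _).trans (min_le_left _ _))
  have hball₂ : ball c r ⊆ ball c r₂ :=
    ball_subset_ball ((min_le_right _ _).trans (min_le_right _ _))
  set C := max C₁ C₂ with hCdef
  have hC : 0 ≤ C := hC₁.trans (le_max_left _ _)
  have hmem : ∀ y ∈ ball (0 : V) r, c + y ∈ ball c r := by simp
  have hdiff : ∀ y ∈ ball (0 : V) r,
      HasFDerivAt (fun z ↦ A (c + z)) (fderiv ℝ A (c + y)) y := by
    intro y hy
    have h1 : HasFDerivAt A (fderiv ℝ A (c + y)) (c + y) :=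
      (((hA.contDiffAt (hs.mem_nhds (hball (hmem y hy))))).differentiableAt
        (by simp)).hasFDerivAt
    exact h1.comp y ((hasFDerivAt_id y).const_add c)
  obtain ⟨ρ, hρ, U, hU0, hU⟩ := exists_flat_solution_of_bounds (A := fun y ↦ A (c + y))
    (A' := fun y ↦ fderiv ℝ A (c + y)) hr hC hdiff
    (fun y hy ↦ (hb₁ _ (hball₁ (hmem y hy))).trans (le_max_left _ _))
    (fun y hy ↦ (hb₂ _ (hball₂ (hmem y hy))).trans (le_max_right _ _))
    (fun y hy z hz ↦ by
      have := hlip _ (hball₂ (hmem y hy)) _ (hball₂ (hmem z hz))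
      rw [add_sub_add_left_eq_sub] at this
      exact this.trans (mul_le_mul_of_nonneg_right (le_max_right _ _) (norm_nonneg _)))
    (fun y hy ↦ flat _ (hball (hmem y hy)))
  have hUc : ContinuousAt U 0 := (hU 0 (mem_ball_self hρ)).continuousAt
  -- Units form an open set and U = 1 at the centre.
  have hunit : ∀ᶠ y in 𝓝 (0 : V), IsUnit (U y) :=
    hUc.eventually (Units.isOpen.mem_nhds (by simp [hU0]))
  obtain ⟨ρ', hρ', hball'⟩ := Metric.mem_nhds_iff.1 hunit
  refine ⟨min r (min ρ ρ'), by positivity, ?_, fun x ↦ U (x - c), ?_, ?_, ?_⟩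
  · exact fun x hx ↦ hball (ball_subset_ball (min_le_left _ _) hx)
  · refine contDiffOn_of_flat_solution (A := A) isOpen_ball (hA.mono ?_) ?_
    · exact fun x hx ↦ hball (ball_subset_ball (min_le_left _ _) hx)
    · intro x hx
      have := (hU (x - c) (by
        simp only [mem_ball_zero_iff]; rw [mem_ball, dist_eq_norm] at hx
        exact hx.trans_le ((min_le_right _ _).trans (min_le_left _ _)))).comp x ((hasFDerivAt_id x).sub_const c)
      simpa [Function.comp_def, ContinuousLinearMap.comp_id] using this
  · intro x hx
    refine hball' ?_
    simp only [mem_ball_zero_iff]; rw [mem_ball, dist_eq_norm] at hx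
    exact hx.trans_le ((min_le_right _ _).trans (min_le_right _ _))
  · intro x hx
    have := (hU (x - c) (by
      simp only [mem_ball_zero_iff]; rw [mem_ball, dist_eq_norm] at hx
      exact hx.trans_le ((min_le_right _ _).trans (min_le_left _ _)))).comp x ((hasFDerivAt_id x).sub_const c)
    simpa [Function.comp_def, ContinuousLinearMap.comp_id] using this

end FlatSystem

/-! ### Gluing local solutions on a simply connected space -/

section Monodromy

open Filter Topology

/-- Monodromy principle: local solutions of a problem with unique continuation, existing through
every initial value, extend to global solutions on a simply connected space. -/
theorem exists_global_solution {M : Type*} [TopologicalSpace M] [SimplyConnectedSpace M]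
    [LocallyPathConnectedSpace M] {Y : M → Type*} {G : Type*} (Sol : (Π p, Y p) → M → Prop)
    (h_ex : ∀ p₀, ∃ U : Set M, IsOpen U ∧ p₀ ∈ U ∧ ∃ Ψ : G → Π p, Y p,
      (∀ q ∈ U, Function.Bijective fun g ↦ Ψ g q) ∧ ∀ g, ∀ q ∈ U, Sol (Ψ g) q)
    (h_uniq : ∀ s s' p, Sol s p → Sol s' p → s p = s' p → ∀ᶠ q in 𝓝 p, s q = s' q)
    (h_congr : ∀ s s' p, (∀ᶠ q in 𝓝 p, s q = s' q) → Sol s p → Sol s' p)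
    (p₀ : M) (y₀ : Y p₀) : ∃ s : Π p, Y p, s p₀ = y₀ ∧ ∀ p, Sol s p := by
  classical
  choose U hUo hU Ψ hΨ hsol using h_ex
  -- With a discrete parameter space, local solutions become the local sheets of a covering of M.
  let _ : TopologicalSpace G := ⊥
  have _ : DiscreteTopology G := ⟨rfl⟩
  let inv : ∀ j q, q ∈ U j → Y q → G := fun j q hq y ↦ ((hΨ j q hq).2 y).choose
  have inv_spec : ∀ j q (hq : q ∈ U j) y, Ψ j (inv j q hq y) q = y :=
    fun j q hq y ↦ ((hΨ j q hq).2 y).choose_spec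
  -- The parameter in patch `j` whose solution agrees at `q` with the given one of patch `i`; off `U
  -- j` the value is a mere default.
  let cc : M → M → M → G → G := fun i j q g ↦
    if hq : q ∈ U j then inv j q hq (Ψ i g q) else g
  have cc_spec : ∀ i j q g, q ∈ U j → Ψ j (cc i j q g) q = Ψ i g q := by
    intro i j q g hq
    simp only [cc, hq, dif_pos, inv_spec]
  let Z : FiberBundleCore M M G :=
    { baseSet := U
      isOpen_baseSet := hUo
      indexAt := id
      mem_baseSet_at := hU
      coordChange := cc
      coordChange_self := fun i q hq g ↦ (hΨ i q hq).1 (cc_spec i i q g hq)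
      continuousOn_coordChange := by
        rintro i j ⟨q, g⟩ ⟨⟨hqi, hqj⟩, -⟩
        refine ContinuousAt.continuousWithinAt ?_
        -- Unique continuation: two local solutions that agree at `q` agree nearby, so the
        -- transition is locally constant, which is continuity for a discrete fibre.
        have hev : ∀ᶠ q' in 𝓝 q, cc i j q' g = cc i j q g := by
          have h1 := h_uniq _ _ q (hsol i g q hqi) (hsol j (cc i j q g) q hqj)
            (cc_spec i j q g hqj).symm
          filter_upwards [h1, (hUo j).mem_nhds hqj] with q' h2 h3
          exact (hΨ j q' h3).1 ((cc_spec i j q' g h3).trans h2)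
        have hev2 : ∀ᶠ z in 𝓝 (q, g), cc i j z.1 z.2 = cc i j q g := by
          rw [nhds_prod_eq, nhds_discrete G]
          refine (hev.prod_mk (show ∀ᶠ g' in pure g, g' = g by simp)).mono ?_
          rintro ⟨q', g'⟩ ⟨h, rfl⟩
          exact h
        exact (continuousAt_const (y := cc i j q g)).congr (hev2.mono fun _ h ↦ h.symm)
      coordChange_comp := by
        rintro i j k q ⟨⟨-, hj⟩, hk⟩ g
        refine (hΨ k q hk).1 ?_
        simp only [cc_spec _ _ _ _ hk, cc_spec _ _ _ _ hj] }
  have cov : IsCoveringMap (π G Z.Fiber) := FiberBundle.isCoveringMap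
  -- Lifting the identity of the simply connected M gives a section of the covering through the
  -- prescribed value.
  obtain ⟨σ, ⟨hσ0, hσ⟩, -⟩ := cov.existsUnique_continuousMap_lifts (ContinuousMap.id M) p₀
    (⟨p₀, inv p₀ p₀ (hU p₀) y₀⟩ : TotalSpace G Z.Fiber) rfl
  have hσp : ∀ p, (σ p).proj = p := fun p ↦ congrFun hσ p
  let s : Π p, Y p := fun p ↦ Ψ p (Z.localTriv p (σ p)).2 p
  have hloc0 : ∀ (z : TotalSpace G Z.Fiber) (j q : M), z.proj = q → q ∈ U j →
      Ψ j (Z.localTriv j z).2 q = Ψ q z.2 q := by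
    rintro ⟨p, g⟩ j q rfl hq
    exact cc_spec _ j _ g hq
  have hloc : ∀ j q, q ∈ U j → s q = Ψ j (Z.localTriv j (σ q)).2 q := fun j q hq ↦
    (hloc0 _ q q (hσp q) (hU q)).trans (hloc0 _ j q (hσp q) hq).symm
  refine ⟨s, ?_, fun p ↦ ?_⟩
  · refine (hloc0 _ p₀ p₀ (hσp p₀) (hU p₀)).trans ?_
    rw [hσ0]
    exact inv_spec p₀ p₀ (hU p₀) y₀
  · have hcont : ContinuousAt (fun q ↦ (Z.localTriv p (σ q)).2) p := by
      have h1 : ContinuousAt (Z.localTriv p) (σ p) :=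
        (Z.localTriv p).continuousAt (by
          rw [FiberBundleCore.mem_localTriv_source, hσp]; exact hU p)
      exact (continuous_snd.continuousAt.comp h1).comp σ.continuous.continuousAt
    -- A continuous map to a discrete space is locally constant, so near `p` the section follows one
    -- single local solution.
    have hev : ∀ᶠ q in 𝓝 p, (Z.localTriv p (σ q)).2 = (Z.localTriv p (σ p)).2 :=
      hcont.eventually (show ∀ᶠ g in 𝓝 _, g = (Z.localTriv p (σ p)).2 by
        rw [nhds_discrete G]; simp)
    refine h_congr _ _ p ?_ (hsol p (Z.localTriv p (σ p)).2 p (hU p))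
    filter_upwards [hev, (hUo p).mem_nhds (hU p)] with q h1 h2
    rw [hloc p q h2, h1]

end Monodromy

/-! ### Algebra of the Lorentzian inner product -/

section LorentzAlgebra

variable {n : ℕ}

/-- The Lorentzian inner product as a bilinear form. -/
def lorentzBilin (n : ℕ) : LorentzSpace n →ₗ[ℝ] LorentzSpace n →ₗ[ℝ] ℝ :=
  LinearMap.mk₂ ℝ lorentz
    (fun z z' w ↦ by simp only [lorentz, Pi.add_apply, add_mul, Finset.sum_add_distrib]; ring)
    (fun c z w ↦ by
      simp only [lorentz, Pi.smul_apply, smul_eq_mul, mul_assoc, ← Finset.mul_sum]; ring)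
    (fun z w w' ↦ by simp only [lorentz, Pi.add_apply, mul_add, Finset.sum_add_distrib]; ring)
    (fun c z w ↦ by
      simp only [lorentz, Pi.smul_apply, smul_eq_mul, mul_left_comm _ c, ← Finset.mul_sum]; ring)

@[simp]
theorem lorentzBilin_apply (z w : LorentzSpace n) : lorentzBilin n z w = lorentz z w := rfl

theorem lorentz_add_left (z z' w : LorentzSpace n) :
    lorentz (z + z') w = lorentz z w + lorentz z' w := (lorentzBilin n).map_add₂ z z' w

theorem lorentz_sub_left (z z' w : LorentzSpace n) :
    lorentz (z - z') w = lorentz z w - lorentz z' w := (lorentzBilin n).map_sub₂ z z' w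

theorem lorentz_sub_right (w z z' : LorentzSpace n) :
    lorentz w (z - z') = lorentz w z - lorentz w z' := (lorentzBilin n w).map_sub z z'

theorem lorentz_smul_left (c : ℝ) (z w : LorentzSpace n) :
    lorentz (c • z) w = c * lorentz z w := (lorentzBilin n).map_smul₂ c z w

theorem lorentz_smul_right (c : ℝ) (z w : LorentzSpace n) :
    lorentz z (c • w) = c * lorentz z w := (lorentzBilin n z).map_smul c w

theorem lorentz_comm (z w : LorentzSpace n) : lorentz z w = lorentz w z := by
  simp only [lorentz, mul_comm]

theorem eq_zero_of_lorentz_self_eq_zero {z : LorentzSpace n} (h : lorentz z z = 0)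
    (h0 : z 0 = 0) : z = 0 := by
  have h1 : ∑ i : Fin (n + 1), z i.succ * z i.succ = 0 := by simpa [lorentz, h0] using h
  have h2 := (Finset.sum_eq_zero_iff_of_nonneg fun i _ ↦ mul_self_nonneg (z i.succ)).1 h1
  ext i
  refine Fin.cases h0 (fun j ↦ ?_) i
  exact mul_self_eq_zero.1 (h2 j (Finset.mem_univ j))

/-- The spatial part of a null vector has length |z⁰|, so the spatial product is at most z⁰w⁰ by
Cauchy–Schwarz. This is what separates `x` and `y` into opposite cones. -/
theorem lorentz_nonpos_of_null {z w : LorentzSpace n} (hz : lorentz z z = 0)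
    (hw : lorentz w w = 0) (h : 0 ≤ z 0 * w 0) : lorentz z w ≤ 0 := by
  have h1 := Finset.sum_mul_sq_le_sq_mul_sq Finset.univ (fun i : Fin (n + 1) ↦ z i.succ)
    fun i ↦ w i.succ
  have hz' : ∑ i : Fin (n + 1), z i.succ ^ 2 = z 0 ^ 2 := by
    simp only [lorentz, ← sq] at hz; linarith
  have hw' : ∑ i : Fin (n + 1), w i.succ ^ 2 = w 0 ^ 2 := by
    simp only [lorentz, ← sq] at hw; linarith
  rw [hz', hw', ← mul_pow] at h1
  have := abs_le_of_sq_le_sq' h1 h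
  simp only [lorentz]
  linarith [this.2]

end LorentzAlgebra

/-! ### Derivatives of vector-valued functions read in charts -/

section ChartCalculus

open Filter Topology

variable {n : ℕ} {M : Type*} [TopologicalSpace M] [ChartedSpace (EuclideanSpace ℝ (Fin n)) M]
  {G : Type*} [NormedAddCommGroup G] [NormedSpace ℝ G]

theorem Filter.EventuallyEq.mvfderiv_eq {f g : M → G} {q : M} (h : f =ᶠ[𝓝 q] g) :
    mvfderiv (𝓡 n) f q = mvfderiv (𝓡 n) g q := by
  ext X
  have h1 := h.mfderiv_eq (I := 𝓡 n) (I' := 𝓘(ℝ, G))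
  simp only [mvfderiv, h1, ContinuousLinearMap.comp_apply]
  rfl

variable [IsManifold (𝓡 n) ∞ M]

theorem mdifferentiableAt_extChartAt_of_mem {p₀ q : M} (hq : q ∈ (extChartAt (𝓡 n) p₀).source) :
    MDifferentiableAt (𝓡 n) 𝓘(ℝ, EuclideanSpace ℝ (Fin n)) (extChartAt (𝓡 n) p₀) q :=
  mdifferentiableAt_extChartAt (by simpa using hq)

theorem mvfderiv_comp_extChartAt {p₀ q : M} {g : EuclideanSpace ℝ (Fin n) → G}
    (hg : DifferentiableAt ℝ g (extChartAt (𝓡 n) p₀ q))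
    (hq : q ∈ (extChartAt (𝓡 n) p₀).source) (X : TangentSpace (𝓡 n) q) :
    mvfderiv (𝓡 n) (fun q ↦ g (extChartAt (𝓡 n) p₀ q)) q X =
      fderiv ℝ g (extChartAt (𝓡 n) p₀ q) (mvfderiv (𝓡 n) (extChartAt (𝓡 n) p₀) q X) := by
  have h := mfderiv_comp_apply (I := 𝓡 n) (I' := 𝓘(ℝ, EuclideanSpace ℝ (Fin n)))
    (I'' := 𝓘(ℝ, G)) (f := extChartAt (𝓡 n) p₀) (g := g) q
    hg.mdifferentiableAt (mdifferentiableAt_extChartAt_of_mem hq) X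
  rw [mfderiv_eq_fderiv] at h
  exact h

theorem mdifferentiableAt_comp_symm {p₀ q : M} {f : M → G}
    (hf : MDifferentiableAt (𝓡 n) 𝓘(ℝ, G) f q)
    (hq : q ∈ (extChartAt (𝓡 n) p₀).source) :
    DifferentiableAt ℝ (f ∘ (extChartAt (𝓡 n) p₀).symm) (extChartAt (𝓡 n) p₀ q) := by
  have h1 : MDifferentiableAt 𝓘(ℝ, EuclideanSpace ℝ (Fin n)) (𝓡 n)
      (extChartAt (𝓡 n) p₀).symm (extChartAt (𝓡 n) p₀ q) := by
    have := contMDiffOn_extChartAt_symm (I := 𝓡 n) (n := ∞) p₀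
    exact (this.contMDiffAt ((isOpen_extChartAt_target p₀).mem_nhds
      ((extChartAt (𝓡 n) p₀).map_source hq))).mdifferentiableAt (by simp)
  have h2 : MDifferentiableAt (𝓡 n) 𝓘(ℝ, G) f
      ((extChartAt (𝓡 n) p₀).symm (extChartAt (𝓡 n) p₀ q)) := by
    rwa [(extChartAt (𝓡 n) p₀).left_inv hq]
  exact (h2.comp _ h1).differentiableAt

theorem eventually_mem_extChartAt_source {p₀ q : M} (hq : q ∈ (extChartAt (𝓡 n) p₀).source) :
    ∀ᶠ q' in 𝓝 q, q' ∈ (extChartAt (𝓡 n) p₀).source :=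
  (isOpen_extChartAt_source p₀).mem_nhds hq

theorem mvfderiv_eq_fderiv_comp_symm {p₀ q : M} {f : M → G}
    (hf : MDifferentiableAt (𝓡 n) 𝓘(ℝ, G) f q)
    (hq : q ∈ (extChartAt (𝓡 n) p₀).source) (X : TangentSpace (𝓡 n) q) :
    mvfderiv (𝓡 n) f q X = fderiv ℝ (f ∘ (extChartAt (𝓡 n) p₀).symm) (extChartAt (𝓡 n) p₀ q)
      (mvfderiv (𝓡 n) (extChartAt (𝓡 n) p₀) q X) := by
  rw [← mvfderiv_comp_extChartAt (mdifferentiableAt_comp_symm hf hq) hq]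
  have : f =ᶠ[𝓝 q] fun q ↦ (f ∘ (extChartAt (𝓡 n) p₀).symm) (extChartAt (𝓡 n) p₀ q) := by
    filter_upwards [eventually_mem_extChartAt_source hq] with q' hq'
    rw [Function.comp_apply, (extChartAt (𝓡 n) p₀).left_inv hq']
  rw [this.mvfderiv_eq]

theorem mvfderiv_extChartAt_bijective {p₀ q : M} (hq : q ∈ (extChartAt (𝓡 n) p₀).source) :
    Function.Bijective (mvfderiv (𝓡 n) (extChartAt (𝓡 n) p₀) q) := by
  have : (mfderiv (𝓡 n) 𝓘(ℝ, EuclideanSpace ℝ (Fin n)) (extChartAt (𝓡 n) p₀) q).IsInvertible :=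
    isInvertible_mfderiv_extChartAt (I := 𝓡 n) hq
  exact this.bijective

theorem contDiffOn_comp_extChartAt_symm {p₀ : M} {f : M → G} {s : Set M}
    (hf : ContMDiffOn (𝓡 n) 𝓘(ℝ, G) ∞ f s) :
    ContDiffOn ℝ ∞ (f ∘ (extChartAt (𝓡 n) p₀).symm)
      ((extChartAt (𝓡 n) p₀).target ∩ (extChartAt (𝓡 n) p₀).symm ⁻¹' s) := by
  have h1 := contMDiffOn_extChartAt_symm (I := 𝓡 n) (n := ∞) p₀
  exact (hf.comp (h1.mono Set.inter_subset_left) Set.inter_subset_right).contDiffOn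

/-- `X(Yf) - Y(Xf) = [X, Y]f`. -/
theorem mvfderiv_mvfderiv_sub {f : M → G} {p : M} (hf : ContMDiffAt (𝓡 n) 𝓘(ℝ, G) ∞ f p)
    {X Y : Π q : M, TangentSpace (𝓡 n) q}
    (hX : MDifferentiableAt (𝓡 n) ((𝓡 n).prod 𝓘(ℝ, EuclideanSpace ℝ (Fin n)))
      (fun q ↦ (⟨q, X q⟩ : TangentBundle (𝓡 n) M)) p)
    (hY : MDifferentiableAt (𝓡 n) ((𝓡 n).prod 𝓘(ℝ, EuclideanSpace ℝ (Fin n)))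
      (fun q ↦ (⟨q, Y q⟩ : TangentBundle (𝓡 n) M)) p) :
    mvfderiv (𝓡 n) (fun q ↦ mvfderiv (𝓡 n) f q (Y q)) p (X p)
      - mvfderiv (𝓡 n) (fun q ↦ mvfderiv (𝓡 n) f q (X q)) p (Y p)
      = mvfderiv (𝓡 n) f p (mlieBracket (𝓡 n) X Y p) := by
  set φ := extChartAt (𝓡 n) p with hφ
  have hp : p ∈ φ.source := mem_extChartAt_source p
  -- The representative of a vector field in the chart, as the pullback by the inverse chart, which
  -- is the form in which the Lie bracket is defined.
  let hat : (Π q : M, TangentSpace (𝓡 n) q) → EuclideanSpace ℝ (Fin n) → EuclideanSpace ℝ (Fin n) :=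
    fun Z ↦ mpullbackWithin 𝓘(ℝ, EuclideanSpace ℝ (Fin n)) (𝓡 n) φ.symm Z (Set.range (𝓡 n))
  have hat_eq : ∀ Z q, q ∈ φ.source → hat Z (φ q) = mvfderiv (𝓡 n) φ q (Z q) := by
    intro Z q hq
    have h1 := mfderiv_extChartAt_comp_mfderivWithin_extChartAt_symm (I := 𝓡 n) (x := p)
      (φ.map_source hq)
    have h2 := mfderivWithin_extChartAt_symm_comp_mfderiv_extChartAt (I := 𝓡 n) (x := p)
      (φ.map_source hq)
    have h3 := ContinuousLinearMap.inverse_eq h2 h1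
    change (mfderivWithin _ _ φ.symm _ (φ q)).inverse (Z (φ.symm (φ q))) = _
    rw [h3, φ.left_inv hq]
    rfl
  have hat_diff : ∀ Z : Π q : M, TangentSpace (𝓡 n) q,
      MDifferentiableAt (𝓡 n) ((𝓡 n).prod 𝓘(ℝ, EuclideanSpace ℝ (Fin n)))
        (fun q ↦ (⟨q, Z q⟩ : TangentBundle (𝓡 n) M)) p →
      DifferentiableAt ℝ (hat Z) (φ p) := by
    intro Z hZ
    have := MDifferentiableWithinAt.differentiableWithinAt_mpullbackWithin_vectorField
      (I := 𝓡 n) (V := Z) (s := Set.univ) hZ.mdifferentiableWithinAt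
    have h2 : φ.symm ⁻¹' Set.univ ∩ Set.range (𝓡 n) = Set.univ := by simp
    rw [h2] at this
    exact differentiableWithinAt_univ.1 this
  set fh := f ∘ φ.symm with hfh
  have hfh_smooth : ContDiffAt ℝ ∞ fh (φ p) := by
    have h1 : ContMDiffAt 𝓘(ℝ, EuclideanSpace ℝ (Fin n)) (𝓡 n) ∞ φ.symm (φ p) :=
      (contMDiffOn_extChartAt_symm (I := 𝓡 n) (n := ∞) p).contMDiffAt
        ((isOpen_extChartAt_target p).mem_nhds (φ.map_source hp))
    have h2 : ContMDiffAt (𝓡 n) 𝓘(ℝ, G) ∞ f (φ.symm (φ p)) := by rwa [φ.left_inv hp]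
    exact (h2.comp (φ p) h1).contDiffAt
  have hev : ∀ Z, (fun q ↦ mvfderiv (𝓡 n) f q (Z q)) =ᶠ[𝓝 p]
      fun q ↦ (fun a ↦ fderiv ℝ fh a (hat Z a)) (φ q) := by
    intro Z
    have h0 : ContMDiffAt (𝓡 n) 𝓘(ℝ, G) 1 f p := hf.of_le (by exact_mod_cast le_top)
    have h1 : ∀ᶠ q in 𝓝 p, ContMDiffAt (𝓡 n) 𝓘(ℝ, G) 1 f q :=
      (contMDiffAt_iff_contMDiffAt_nhds (by simp)).1 h0
    filter_upwards [h1, eventually_mem_extChartAt_source hp] with q hq1 hq2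
    rw [mvfderiv_eq_fderiv_comp_symm (hq1.mdifferentiableAt (by simp)) hq2]
    simp only [hat_eq Z q hq2]
    rfl
  have hfh' : HasFDerivAt (fderiv ℝ fh) (fderiv ℝ (fderiv ℝ fh) (φ p)) (φ p) := by
    have : ContDiffAt ℝ 1 (fderiv ℝ fh) (φ p) := hfh_smooth.fderiv_right (m := 1) (by
      rw [one_add_one_eq_two]; exact WithTop.coe_le_coe.2 (le_top : (2 : ℕ∞) ≤ ⊤))
    exact (this.differentiableAt (by simp)).hasFDerivAt
  have hderiv : ∀ Z Z' : Π q : M, TangentSpace (𝓡 n) q,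
      MDifferentiableAt (𝓡 n) ((𝓡 n).prod 𝓘(ℝ, EuclideanSpace ℝ (Fin n)))
        (fun q ↦ (⟨q, Z q⟩ : TangentBundle (𝓡 n) M)) p →
      mvfderiv (𝓡 n) (fun q ↦ mvfderiv (𝓡 n) f q (Z q)) p (Z' p) =
        fderiv ℝ (fderiv ℝ fh) (φ p) (hat Z' (φ p)) (hat Z (φ p))
          + fderiv ℝ fh (φ p) (fderiv ℝ (hat Z) (φ p) (hat Z' (φ p))) := by
    intro Z Z' hZ
    have h1 := hfh'.clm_apply (hat_diff Z hZ).hasFDerivAt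
    rw [(hev Z).mvfderiv_eq, mvfderiv_comp_extChartAt h1.differentiableAt hp, h1.fderiv,
      ← hφ, ← hat_eq Z' p hp]
    simp [add_comm]
  rw [hderiv Y X hY, hderiv X Y hX]
  -- The second derivatives of `fh` cancel by symmetry; the remaining terms are dfh of the bracket
  -- in the chart.
  have hsymm := hfh_smooth.isSymmSndFDerivAt (by
    simp only [minSmoothness_of_isRCLikeNormedField]
    exact WithTop.coe_le_coe.2 (le_top : (2 : ℕ∞) ≤ ⊤)) (hat X (φ p))
    (hat Y (φ p))
  have hbr : mvfderiv (𝓡 n) φ p (mlieBracket (𝓡 n) X Y p) =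
      lieBracket ℝ (hat X) (hat Y) (φ p) := by
    have h2 : φ.symm ⁻¹' Set.univ ∩ Set.range (𝓡 n) = Set.univ := by simp
    have h4 : lieBracketWithin ℝ (hat X) (hat Y) (φ.symm ⁻¹' Set.univ ∩ Set.range (𝓡 n)) (φ p) =
        lieBracket ℝ (hat X) (hat Y) (φ p) := by rw [h2, lieBracketWithin_univ]
    have h3 : (mfderiv (𝓡 n) 𝓘(ℝ, EuclideanSpace ℝ (Fin n)) φ p).IsInvertible :=
      isInvertible_mfderiv_extChartAt (I := 𝓡 n) hp
    exact (h3.self_apply_inverse _).trans h4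
  rw [mvfderiv_eq_fderiv_comp_symm (hf.mdifferentiableAt (by simp)) hp, ← hφ, hbr, hsymm,
    lieBracket_eq, map_sub]
  abel

end ChartCalculus

/-! ### Global sections that form local frames -/

section Frames

open Filter Topology

variable {n : ℕ} {M : Type*} [TopologicalSpace M] [ChartedSpace (EuclideanSpace ℝ (Fin n)) M]

section

variable (n) (F : Type*) [NormedAddCommGroup F] [NormedSpace ℝ F]
  {E : M → Type*} [TopologicalSpace (TotalSpace F E)]
  [∀ p, AddCommGroup (E p)] [∀ p, Module ℝ (E p)] [∀ p, TopologicalSpace (E p)]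
  [FiberBundle F E]

/-- A linear family `S v`, `v ∈ F`, of global smooth sections which trivializes the bundle over
the open set `N`, with coordinate functionals `c`. -/
structure IsSmoothFrame (N : Set M) (S : F →ₗ[ℝ] Π q, E q) (c : Π q, E q →ₗ[ℝ] F) :
    Prop where
  isOpen : IsOpen N
  smooth : ∀ v, ContMDiff (𝓡 n) ((𝓡 n).prod 𝓘(ℝ, F)) ∞ (fun p ↦ (⟨p, S v p⟩ : TotalSpace F E))
  coord_frame : ∀ q ∈ N, ∀ v, c q (S v q) = v
  frame_coord : ∀ q ∈ N, ∀ w, S (c q w) q = w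
  contMDiffAt_coord : ∀ q ∈ N, ∀ σ : Π q, E q,
    ContMDiffAt (𝓡 n) ((𝓡 n).prod 𝓘(ℝ, F)) ∞ (fun p ↦ (⟨p, σ p⟩ : TotalSpace F E)) q →
    ContMDiffAt (𝓡 n) 𝓘(ℝ, F) ∞ (fun p ↦ c p (σ p)) q
  contMDiffAt_of_coord : ∀ q ∈ N, ∀ σ : Π q, E q,
    ContMDiffAt (𝓡 n) 𝓘(ℝ, F) ∞ (fun p ↦ c p (σ p)) q →
    ContMDiffAt (𝓡 n) ((𝓡 n).prod 𝓘(ℝ, F)) ∞ (fun p ↦ (⟨p, σ p⟩ : TotalSpace F E)) q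

end

variable [IsManifold (𝓡 n) ∞ M] [T2Space M]

/-- A local frame times a bump function equal to 1 near the point. The sections must be global
because the torsion and curvature hypotheses speak only of global fields and sections. -/
theorem exists_smoothFrame (F : Type*) [NormedAddCommGroup F] [NormedSpace ℝ F]
    {E : M → Type*} [TopologicalSpace (TotalSpace F E)]
    [∀ p, AddCommGroup (E p)] [∀ p, Module ℝ (E p)] [∀ p, TopologicalSpace (E p)]
    [FiberBundle F E] [VectorBundle ℝ F E] [ContMDiffVectorBundle ∞ F E (𝓡 n)] (p₀ : M) :
    ∃ (N : Set M) (S : F →ₗ[ℝ] Π q, E q), p₀ ∈ N ∧ N ⊆ (trivializationAt F E p₀).baseSet ∧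
      IsSmoothFrame n F N S fun q ↦ (trivializationAt F E p₀).linearMapAt ℝ q := by
  set e := trivializationAt F E p₀ with he
  have hp₀ : p₀ ∈ e.baseSet := mem_baseSet_trivializationAt F E p₀
  obtain ⟨χ, -, hχ⟩ := (SmoothBumpFunction.nhds_basis_tsupport (I := 𝓡 n) p₀).mem_iff.1
    (e.open_baseSet.mem_nhds hp₀)
  obtain ⟨N, hN1, hNo, hp₀N⟩ := mem_nhds_iff.1 (χ.eventuallyEq_one.and
    (e.open_baseSet.mem_nhds hp₀))
  let S : F →ₗ[ℝ] Π q, E q :=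
    { toFun := fun v q ↦ χ q • e.symmₗ ℝ q v
      map_add' := fun v w ↦ by ext q; simp
      map_smul' := fun a v ↦ by
        ext q
        simp only [map_smul, RingHom.id_apply, Pi.smul_apply]
        exact smul_comm _ _ _ }
  have hS : ∀ q ∈ N, ∀ v, S v q = e.symmₗ ℝ q v := by
    intro q hq v
    have : χ q = 1 := (hN1 hq).1
    change χ q • e.symmₗ ℝ q v = _
    rw [this, one_smul]
  refine ⟨N, S, hp₀N, fun q hq ↦ (hN1 hq).2, hNo, fun v ↦ ?_, fun q hq v ↦ ?_, fun q hq w ↦ ?_,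
    fun q hq σ hσ ↦ ?_, fun q hq σ hσ ↦ ?_⟩
  · have h1 : ContMDiffOn (𝓡 n) ((𝓡 n).prod 𝓘(ℝ, F)) ∞
        (fun p ↦ (⟨p, e.symmₗ ℝ p v⟩ : TotalSpace F E)) e.baseSet := by
      refine (e.contMDiffOn_section_baseSet_iff (s := fun p ↦ e.symmₗ ℝ p v)).2 ?_
      refine contMDiffOn_const (c := v) |>.congr fun q hq ↦ ?_
      have := e.apply_mk_symm hq v
      rw [Bundle.Trivialization.symmₗ_apply _ hq, this]
    exact ContMDiffOn.smul_section_of_tsupport χ.contMDiff.contMDiffOn e.open_baseSet hχ h1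
  · rw [hS q hq]
    exact e.linearMapAt_symmₗ (hN1 hq).2 v
  · rw [hS q hq]
    exact e.symmₗ_linearMapAt (hN1 hq).2 w
  · have h1 := (e.contMDiffAt_section_iff (hN1 hq).2).1 hσ
    refine h1.congr_of_eventuallyEq ?_
    filter_upwards [e.open_baseSet.mem_nhds (hN1 hq).2] with q' hq'
    exact congrFun (e.coe_linearMapAt_of_mem hq') _
  · refine (e.contMDiffAt_section_iff (hN1 hq).2).2 (hσ.congr_of_eventuallyEq ?_)
    filter_upwards [e.open_baseSet.mem_nhds (hN1 hq).2] with q' hq'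
    exact (congrFun (e.coe_linearMapAt_of_mem hq') _).symm

/-- Global smooth vector fields extending the coordinate vector fields near a point. -/
theorem exists_coordinateFields (p₀ : M) :
    ∃ (N : Set M) (X : EuclideanSpace ℝ (Fin n) →ₗ[ℝ] Π q : M, TangentSpace (𝓡 n) q),
      IsOpen N ∧ p₀ ∈ N ∧ N ⊆ (extChartAt (𝓡 n) p₀).source ∧ (∀ u, IsSmoothVectorField (X u)) ∧
      (∀ q ∈ N, ∀ u, mvfderiv (𝓡 n) (extChartAt (𝓡 n) p₀) q (X u q) = u) ∧
      ∀ q ∈ N, ∀ u w, mlieBracket (𝓡 n) (X u) (X w) q = 0 := by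
  obtain ⟨N, X, hp, hN, hX⟩ := exists_smoothFrame (n := n) (EuclideanSpace ℝ (Fin n))
    (E := (TangentSpace (𝓡 n) : M → Type _)) p₀
  have hsrc : N ⊆ (extChartAt (𝓡 n) p₀).source := by
    intro q hq
    simpa using hN hq
  have key : ∀ q ∈ N, ∀ u, mvfderiv (𝓡 n) (extChartAt (𝓡 n) p₀) q (X u q) = u := by
    intro q hq u
    have h1 := hX.coord_frame q hq u
    have h2 := TangentBundle.continuousLinearMapAt_trivializationAt (I := 𝓡 n) (x₀ := p₀) (x := q)
      (by simpa using hsrc hq)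
    have h3 : (trivializationAt (EuclideanSpace ℝ (Fin n)) (TangentSpace (𝓡 n)) p₀).linearMapAt ℝ q
        (X u q) = mfderiv (𝓡 n) 𝓘(ℝ, EuclideanSpace ℝ (Fin n)) (extChartAt (𝓡 n) p₀) q (X u q) := by
      rw [← h2]; rfl
    exact h3.symm.trans h1
  refine ⟨N, X, hX.isOpen, hp, hsrc, hX.smooth, key, fun q hq u w ↦ ?_⟩
  -- In coordinates the bracket is a commutator of derivatives of the chart, and the first
  -- derivatives of the chart along these fields are locally constant.
  refine (mvfderiv_extChartAt_bijective (hsrc hq)).1 ?_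
  have hφ : ContMDiffAt (𝓡 n) 𝓘(ℝ, EuclideanSpace ℝ (Fin n)) ∞ (extChartAt (𝓡 n) p₀) q :=
    contMDiffAt_extChartAt' (by simpa using hsrc hq)
  have hconst : ∀ u, (fun q' ↦ mvfderiv (𝓡 n) (extChartAt (𝓡 n) p₀) q' (X u q'))
      =ᶠ[𝓝 q] fun _ ↦ u := fun u ↦ by
    filter_upwards [hX.isOpen.mem_nhds hq] with q' hq' using key q' hq' u
  rw [← mvfderiv_mvfderiv_sub hφ ((hX.smooth u).mdifferentiable (by simp) q)
    ((hX.smooth w).mdifferentiable (by simp) q), (hconst u).mvfderiv_eq, (hconst w).mvfderiv_eq]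
  simp [mvfderiv_const]

end Frames

/-! ### Covariant derivatives in a frame -/

section CovariantDerivativeInFrame

open Filter Topology

variable {n : ℕ} {M : Type*} [TopologicalSpace M] [ChartedSpace (EuclideanSpace ℝ (Fin n)) M]
  [IsManifold (𝓡 n) ∞ M]
  {F : Type*} [NormedAddCommGroup F] [NormedSpace ℝ F] [FiniteDimensional ℝ F]
  {E : M → Type*} [TopologicalSpace (TotalSpace F E)]
  [∀ p, AddCommGroup (E p)] [∀ p, Module ℝ (E p)] [∀ p, TopologicalSpace (E p)]
  [∀ p, IsTopologicalAddGroup (E p)] [∀ p, ContinuousSMul ℝ (E p)]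
  [FiberBundle F E] [VectorBundle ℝ F E]

/-- Differentiability is carried along in the induction because additivity of `D` requires it of
both summands. -/
theorem CovariantDerivative.apply_sum_smul (D : CovariantDerivative (𝓡 n) F E) {κ : Type*}
    (s : Finset κ) {f : κ → M → ℝ} {σ : κ → Π q, E q} {q : M}
    (hf : ∀ k, MDifferentiableAt (𝓡 n) 𝓘(ℝ, ℝ) (f k) q)
    (hσ : ∀ k, MDifferentiableAt (𝓡 n) ((𝓡 n).prod 𝓘(ℝ, F))
      (fun p ↦ (⟨p, σ k p⟩ : TotalSpace F E)) q) (X : TangentSpace (𝓡 n) q) :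
    MDifferentiableAt (𝓡 n) ((𝓡 n).prod 𝓘(ℝ, F))
      (fun p ↦ (⟨p, (∑ k ∈ s, f k • σ k) p⟩ : TotalSpace F E)) q ∧
    D (∑ k ∈ s, f k • σ k) q X =
      ∑ k ∈ s, (f k q • D (σ k) q X + mvfderiv (𝓡 n) (f k) q X • σ k q) := by
  classical
  induction s using Finset.induction_on with
  | empty =>
    refine ⟨mdifferentiableAt_zeroSection ℝ E, ?_⟩
    simp [D.isCovariantDerivativeOnUniv.zero]
  | insert k s hk ih =>
    have h1 : MDifferentiableAt (𝓡 n) ((𝓡 n).prod 𝓘(ℝ, F))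
      (fun p ↦ (⟨p, (f k • σ k) p⟩ : TotalSpace F E)) q := (hf k).smul_section (hσ k)
    rw [Finset.sum_insert hk, Finset.sum_insert hk]
    refine ⟨mdifferentiableAt_add_section h1 ih.1, ?_⟩
    rw [D.isCovariantDerivativeOnUniv.add h1 ih.1,
      D.isCovariantDerivativeOnUniv.leibniz (hσ k) (hf k)]
    simp [ih.2]

/-- Leibniz rule in the frame: differentiate the coordinates, then differentiate the frame with the
coordinates frozen at `q`. This is the decomposition D = d + Γ. -/
theorem IsSmoothFrame.covariantDerivative_eq {N : Set M} {S : F →ₗ[ℝ] Π q, E q}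
    {c : Π q, E q →ₗ[ℝ] F} (hS : IsSmoothFrame n F N S c) (D : CovariantDerivative (𝓡 n) F E)
    {q : M} (hq : q ∈ N) {σ : Π q, E q}
    (hσ : ContMDiffAt (𝓡 n) ((𝓡 n).prod 𝓘(ℝ, F)) ∞ (fun p ↦ (⟨p, σ p⟩ : TotalSpace F E)) q)
    (X : TangentSpace (𝓡 n) q) :
    D σ q X = S (mvfderiv (𝓡 n) (fun p ↦ c p (σ p)) q X) q + D (S (c q (σ q))) q X := by
  set b := Module.finBasis ℝ F
  have hcσ : MDifferentiableAt (𝓡 n) 𝓘(ℝ, F) (fun p ↦ c p (σ p)) q :=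
    (hS.contMDiffAt_coord q hq σ hσ).mdifferentiableAt (by simp)
  let l (k) : F →L[ℝ] ℝ := LinearMap.toContinuousLinearMap (b.coord k)
  have hl : ∀ k, HasMFDerivAt (𝓡 n) 𝓘(ℝ, ℝ) (fun p ↦ l k (c p (σ p))) q
      ((l k).comp (mvfderiv (𝓡 n) (fun p ↦ c p (σ p)) q)) := fun k ↦
    (l k).hasMFDerivAt.comp q hcσ.hasMFDerivAt
  have hSb : ∀ v, MDifferentiableAt (𝓡 n) ((𝓡 n).prod 𝓘(ℝ, F))
      (fun p ↦ (⟨p, S v p⟩ : TotalSpace F E)) q := fun v ↦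
    (hS.smooth v).mdifferentiable (by simp) q
  have hsum : ∀ v q', ∑ k, b.coord k v • S (b k) q' = S v q' := by
    intro v q'
    have h := congrFun (congrArg S (b.sum_repr v)) q'
    rw [map_sum, Finset.sum_apply] at h
    simpa using h
  obtain ⟨h1, h2⟩ := D.apply_sum_smul Finset.univ (f := fun k p ↦ l k (c p (σ p)))
    (σ := fun k ↦ S (b k)) (fun k ↦ (hl k).mdifferentiableAt) (fun k ↦ hSb (b k)) X
  obtain ⟨-, h3⟩ := D.apply_sum_smul Finset.univ (f := fun k _ ↦ b.coord k (c q (σ q)))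
    (σ := fun k ↦ S (b k)) (q := q) (fun k ↦ mdifferentiableAt_const) (fun k ↦ hSb (b k)) X
  have h4 : S (c q (σ q)) = ∑ k, (fun _ : M ↦ b.coord k (c q (σ q))) • S (b k) := by
    ext q'
    rw [← hsum, Finset.sum_apply]
    rfl
  have h5 : D σ q = D (∑ k, (fun p ↦ l k (c p (σ p))) • S (b k)) q := by
    refine D.isCovariantDerivativeOnUniv.congr_of_eventuallyEq (hσ.mdifferentiableAt (by simp)) h1
      univ_mem ?_
    filter_upwards [hS.isOpen.mem_nhds hq] with q' hq'
    rw [Finset.sum_apply, ← hS.frame_coord q' hq' (σ q'), ← hsum]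
    rfl
  rw [h5, h2, h4, h3, ← hsum, Finset.sum_add_distrib, Finset.sum_add_distrib, add_comm]
  have h6 : ∀ k, mvfderiv (𝓡 n) (fun p ↦ l k (c p (σ p))) q X =
      b.coord k (mvfderiv (𝓡 n) (fun p ↦ c p (σ p)) q X) := fun k ↦
    congrArg (fun T : TangentSpace (𝓡 n) q →L[ℝ] ℝ ↦ T X) (hl k).mfderiv
  simp only [h6]
  simp [mvfderiv_const, l]

end CovariantDerivativeInFrame

/-! ### The flat Lorentzian connection on E ⊕ ℝ ⊕ ℝ -/

section TripleConnection

open Filter Topology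

variable {n : ℕ} {M : Type*} [TopologicalSpace M] [ChartedSpace (EuclideanSpace ℝ (Fin n)) M]
  [IsManifold (𝓡 n) ∞ M]
  {F : Type*} [NormedAddCommGroup F] [NormedSpace ℝ F]
  {E : M → Type*} [TopologicalSpace (TotalSpace F E)]
  [∀ p, NormedAddCommGroup (E p)] [∀ p, InnerProductSpace ℝ (E p)]
  [FiberBundle F E]

variable (n F) in
/-- Smoothness at a point of a section of `E ⊕ ℝ ⊕ ℝ`. -/
structure IsSmoothTripleAt (τ : Π p, E p × ℝ × ℝ) (q : M) : Prop where
  fst : ContMDiffAt (𝓡 n) ((𝓡 n).prod 𝓘(ℝ, F)) ∞ (fun p ↦ (⟨p, (τ p).1⟩ : TotalSpace F E)) q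
  snd : ContMDiffAt (𝓡 n) 𝓘(ℝ, ℝ) ∞ (fun p ↦ (τ p).2.1) q
  trd : ContMDiffAt (𝓡 n) 𝓘(ℝ, ℝ) ∞ (fun p ↦ (τ p).2.2) q

/-- The derivative of a section `(v, a, b)` of `E ⊕ ℝ ⊕ ℝ` for which `v + a x + b y` would be
differentiated in `L^{n+2}`. -/
def tripleDeriv (D : CovariantDerivative (𝓡 n) F E)
    (ξ ζ : Π p : M, TangentSpace (𝓡 n) p →L[ℝ] E p) (τ : Π p, E p × ℝ × ℝ) (q : M)
    (X : TangentSpace (𝓡 n) q) : E q × ℝ × ℝ :=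
  (D (fun p ↦ (τ p).1) q X + (τ q).2.1 • ξ q X + (τ q).2.2 • ζ q X,
    mvfderiv (𝓡 n) (fun p ↦ (τ p).2.1) q X - inner ℝ (τ q).1 (ζ q X),
    mvfderiv (𝓡 n) (fun p ↦ (τ p).2.2) q X - inner ℝ (τ q).1 (ξ q X))

/-- The Lorentzian inner product of `v + a x + b y` and `v' + a' x + b' y`, if `x`, `y` are null
vectors orthogonal to `v`, `v'` with `⟨x, y⟩ = 1`. -/
def tripleForm {p : M} (τ τ' : E p × ℝ × ℝ) : ℝ :=
  inner ℝ τ.1 τ'.1 + τ.2.1 * τ'.2.2 + τ.2.2 * τ'.2.1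

variable [FiniteDimensional ℝ F] [VectorBundle ℝ F E] [ContMDiffVectorBundle ∞ F E (𝓡 n)]
  [IsContMDiffRiemannianBundle (𝓡 n) ∞ F E]
  {D : CovariantDerivative (𝓡 n) F E} {ξ ζ : Π p : M, TangentSpace (𝓡 n) p →L[ℝ] E p}

theorem IsSmoothBundleHom.apply {φ : Π p : M, TangentSpace (𝓡 n) p →L[ℝ] E p}
    (h : IsSmoothBundleHom n F φ) {X : Π p : M, TangentSpace (𝓡 n) p}
    (hX : IsSmoothVectorField X) : IsSmoothSection n F fun p ↦ φ p (X p) :=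
  ContMDiff.clm_bundle_apply (F₁ := EuclideanSpace ℝ (Fin n)) (E₁ := (TangentSpace (𝓡 n) : M → Type _)) h hX

theorem IsCoherentTangentBundle.isSmoothSection_deriv
    (h : IsCoherentTangentBundle D ξ) {σ : Π p, E p} (hσ : IsSmoothSection n F σ)
    {X : Π p : M, TangentSpace (𝓡 n) p} (hX : IsSmoothVectorField X) :
    IsSmoothSection n F fun p ↦ D σ p (X p) := by
  have h1 := h.smooth_connection.contMDiff.contMDiff (σ := σ) hσ.contMDiffOn
  exact IsSmoothBundleHom.apply (φ := D σ) (contMDiffOn_univ.1 h1) hX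

theorem CovariantDerivative.IsMetricCompatible.mvfderiv_inner_apply (h : D.IsMetricCompatible)
    {σ σ' : Π p, E p} {q : M}
    (hσ : MDifferentiableAt (𝓡 n) ((𝓡 n).prod 𝓘(ℝ, F)) (fun p ↦ (⟨p, σ p⟩ : TotalSpace F E)) q)
    (hσ' : MDifferentiableAt (𝓡 n) ((𝓡 n).prod 𝓘(ℝ, F)) (fun p ↦ (⟨p, σ' p⟩ : TotalSpace F E)) q)
    (X : TangentSpace (𝓡 n) q) :
    mvfderiv (𝓡 n) (fun p ↦ inner ℝ (σ p) (σ' p)) q X =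
      inner ℝ (D σ q X) (σ' q) + inner ℝ (σ q) (D σ' q X) := by
  classical
  -- The identity for fields depends only on the value at `q`, so the extension of X by zero, smooth
  -- or not, serves.
  simpa using h.mvfderiv_inner_eq (Function.update 0 q X) hσ hσ'

/-- D is metric, and the terms of `tripleDeriv` that involve ξ and ζ are skew for `tripleForm`, so
they cancel in pairs. Hence products of parallel triples are constant. -/
theorem IsFrontalBundle.mvfderiv_tripleForm (h : IsFrontalBundle D ξ ζ)
    {τ τ' : Π p, E p × ℝ × ℝ} {q : M} (hτ : IsSmoothTripleAt n F τ q)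
    (hτ' : IsSmoothTripleAt n F τ' q) (X : TangentSpace (𝓡 n) q) :
    MDifferentiableAt (𝓡 n) 𝓘(ℝ, ℝ) (fun p ↦ tripleForm (τ p) (τ' p)) q ∧
    mvfderiv (𝓡 n) (fun p ↦ tripleForm (τ p) (τ' p)) q X =
      tripleForm (tripleDeriv D ξ ζ τ q X) (τ' q) + tripleForm (τ q) (tripleDeriv D ξ ζ τ' q X) := by
  have h1 := hτ.fst.mdifferentiableAt (by simp : (∞ : ℕ∞ω) ≠ 0)
  have h2 := hτ.snd.mdifferentiableAt (by simp : (∞ : ℕ∞ω) ≠ 0)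
  have h3 := hτ.trd.mdifferentiableAt (by simp : (∞ : ℕ∞ω) ≠ 0)
  have h1' := hτ'.fst.mdifferentiableAt (by simp : (∞ : ℕ∞ω) ≠ 0)
  have h2' := hτ'.snd.mdifferentiableAt (by simp : (∞ : ℕ∞ω) ≠ 0)
  have h3' := hτ'.trd.mdifferentiableAt (by simp : (∞ : ℕ∞ω) ≠ 0)
  have hi : MDifferentiableAt (𝓡 n) 𝓘(ℝ, ℝ) (fun p ↦ inner ℝ (τ p).1 (τ' p).1) q :=
    (hτ.fst.inner_bundle hτ'.fst).mdifferentiableAt (by simp)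
  refine ⟨(hi.add (h2.mul h3')).add (h3.mul h2'), ?_⟩
  have hm := h.coherent_first.metric_connection.mvfderiv_inner_apply h1 h1' X
  have hsum := mvfderiv_add (hi.add (h2.mul h3')) (h3.mul h2')
  have hsum' := mvfderiv_add hi (h2.mul h3')
  have e := congrArg (fun T : TangentSpace (𝓡 n) q →L[ℝ] ℝ ↦ T X) (hsum.trans
    (congrArg₂ (· + ·) (hsum'.trans (congrArg₂ (· + ·) rfl (mvfderiv_mul h2 h3')))
      (mvfderiv_mul h3 h2')))
  refine Eq.trans e ?_
  simp only [add_apply, smul_apply, hm, tripleForm, tripleDeriv, inner_add_left, inner_add_right,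
    real_inner_smul_left, real_inner_smul_right, smul_eq_mul]
  linear_combination (τ q).2.1 * real_inner_comm (ξ q X) (τ' q).1 +
    (τ q).2.2 * real_inner_comm (ζ q X) (τ' q).1

theorem IsFrontalBundle.isSmoothTripleAt_tripleDeriv (h : IsFrontalBundle D ξ ζ) {σ : Π p, E p}
    (hσ : IsSmoothSection n F σ) (a b : ℝ) {X : Π p : M, TangentSpace (𝓡 n) p}
    (hX : IsSmoothVectorField X) (q : M) :
    IsSmoothTripleAt n F (fun p ↦ tripleDeriv D ξ ζ (fun p ↦ (σ p, a, b)) p (X p)) q := by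
  have hξ := h.coherent_first.smooth_hom.apply hX
  have hζ := h.coherent_second.smooth_hom.apply hX
  have hD := h.coherent_first.isSmoothSection_deriv hσ hX
  refine ⟨?_, ?_, ?_⟩
  · exact ((hD.add_section (contMDiff_const.smul_section hξ)).add_section
      (contMDiff_const.smul_section hζ)) q
  · simp only [tripleDeriv, mvfderiv_const]
    exact contMDiffAt_const.sub (ContMDiff.inner_bundle hσ hζ q)
  · simp only [tripleDeriv, mvfderiv_const]
    exact contMDiffAt_const.sub (ContMDiff.inner_bundle hσ hξ q)

/-- The global frame sections take every value at `q`, so testing (G2) against them determines the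
curvature vector. -/
theorem SatisfiesCurvatureIdentity.curvature_eq [T2Space M]
    (hG : SatisfiesCurvatureIdentity D ξ ζ)
    {σ : Π p, E p} (hσ : IsSmoothSection n F σ) {X Y : Π p : M, TangentSpace (𝓡 n) p}
    (hX : IsSmoothVectorField X) (hY : IsSmoothVectorField Y) (q : M) :
    curvature D X Y σ q = (inner ℝ (σ q) (ζ q (Y q)) • ξ q (X q) +
        inner ℝ (σ q) (ξ q (Y q)) • ζ q (X q)) - (inner ℝ (σ q) (ζ q (X q)) • ξ q (Y q) +
        inner ℝ (σ q) (ξ q (X q)) • ζ q (Y q)) := by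
  obtain ⟨N, S, hq, -, hS⟩ := exists_smoothFrame (n := n) F (E := E) q
  refine ext_inner_right ℝ fun w ↦ ?_
  have h1 := hG X Y σ (S _) hX hY hσ (hS.smooth ((trivializationAt F E q).linearMapAt ℝ q w)) q
  rw [hS.frame_coord q hq w] at h1
  rw [h1]
  simp only [Matrix.det_fin_two_of, inner_sub_left, inner_add_left, inner_smul_left,
    real_inner_comm (σ q)]
  simp
  ring

/-- The connection `tripleDeriv` is flat. -/
theorem IsFrontalBundle.tripleDeriv_comm [T2Space M] (h : IsFrontalBundle D ξ ζ)
    (hG : SatisfiesCurvatureIdentity D ξ ζ)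
    {σ : Π p, E p} (hσ : IsSmoothSection n F σ) (a b : ℝ) {X Y : Π p : M, TangentSpace (𝓡 n) p}
    (hX : IsSmoothVectorField X) (hY : IsSmoothVectorField Y) {q : M}
    (hXY : mlieBracket (𝓡 n) X Y q = 0) :
    tripleDeriv D ξ ζ (fun p ↦ tripleDeriv D ξ ζ (fun p ↦ (σ p, a, b)) p (X p)) q (Y q) =
    tripleDeriv D ξ ζ (fun p ↦ tripleDeriv D ξ ζ (fun p ↦ (σ p, a, b)) p (Y p)) q (X q) := by
  have hc := hG.curvature_eq hσ hX hY q
  have ht₁ := h.coherent_first.torsion_free X Y hX hY q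
  have ht₂ := h.coherent_second.torsion_free X Y hX hY q
  have hcomp := h.compatible q (X q) (Y q)
  rw [hXY, map_zero, sub_zero, sub_eq_zero] at ht₁ ht₂
  rw [curvature, hXY, map_zero, sub_zero] at hc
  have hm : ∀ {σ' : Π p, E p}, IsSmoothSection n F σ' → ∀ Z : TangentSpace (𝓡 n) q,
      mvfderiv (𝓡 n) (fun p ↦ inner ℝ (σ p) (σ' p)) q Z =
        inner ℝ (D σ q Z) (σ' q) + inner ℝ (σ q) (D σ' q Z) := by
    intro σ' hσ' Z
    exact h.coherent_first.metric_connection.mvfderiv_inner_apply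
      (hσ.mdifferentiable (by simp) q) (hσ'.mdifferentiable (by simp) q) Z
  have hsec : ∀ {X : Π p : M, TangentSpace (𝓡 n) p}, IsSmoothVectorField X →
      ∀ Z : TangentSpace (𝓡 n) q,
      D (fun p ↦ D σ p (X p) + a • ξ p (X p) + b • ζ p (X p)) q Z =
        D (fun p ↦ D σ p (X p)) q Z + a • D (fun p ↦ ξ p (X p)) q Z
          + b • D (fun p ↦ ζ p (X p)) q Z := by
    intro X hX Z
    have e₀ := (h.coherent_first.isSmoothSection_deriv hσ hX).mdifferentiable (by simp) q
    have e₁ := (h.coherent_first.smooth_hom.apply hX).mdifferentiable (by simp) q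
    have e₂ := (h.coherent_second.smooth_hom.apply hX).mdifferentiable (by simp) q
    have e₁' := (mdifferentiableAt_const (c := a)).smul_section e₁
    have e₂' := (mdifferentiableAt_const (c := b)).smul_section e₂
    have hD := D.isCovariantDerivativeOnUniv
    have e := hD.add (mdifferentiableAt_add_section e₀ e₁') e₂'
    have e' := hD.add e₀ e₁'
    have ea := hD.smul_const a e₁
    have eb := hD.smul_const b e₂
    have e'' := congrArg (fun T : TangentSpace (𝓡 n) q →L[ℝ] E q ↦ T Z) (e.trans
      (congrArg₂ (· + ·) (e'.trans (congrArg₂ (· + ·) rfl ea)) eb))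
    exact e''
  have hneg : ∀ {σ' : Π p, E p}, IsSmoothSection n F σ' → ∀ Z : TangentSpace (𝓡 n) q,
      mvfderiv (𝓡 n) (fun p ↦ (0 : ℝ) - inner ℝ (σ p) (σ' p)) q Z =
        -(inner ℝ (D σ q Z) (σ' q) + inner ℝ (σ q) (D σ' q Z)) := by
    intro σ' hσ' Z
    have hi : MDifferentiableAt (𝓡 n) 𝓘(ℝ, ℝ) (fun p ↦ inner ℝ (σ p) (σ' p)) q :=
      (ContMDiff.inner_bundle hσ hσ' q).mdifferentiableAt (by simp)
    have e := mvfderiv_sub (mdifferentiableAt_const (c := (0 : ℝ))) hi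
    refine (congrArg (fun T : TangentSpace (𝓡 n) q →L[ℝ] ℝ ↦ T Z) e).trans ?_
    simp [mvfderiv_const, hm hσ']
  have hξ := fun {X} ↦ h.coherent_first.smooth_hom.apply (X := X)
  have hζ := fun {X} ↦ h.coherent_second.smooth_hom.apply (X := X)
  simp only [tripleDeriv, mvfderiv_const, zero_apply]
  rw [hsec hX, hsec hY, hneg (hξ hX), hneg (hξ hY), hneg (hζ hX), hneg (hζ hY), ht₁, ht₂]
  simp only [inner_add_left, inner_smul_left]
  -- Torsion-freeness has just identified the derivatives of ξ(X), ξ(Y) and of ζ(X), ζ(Y). What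
  -- remains is the curvature identity in the E-component and the symmetry of ⟨ξ(X), ζ(Y)⟩ in the
  -- two scalar ones.
  refine Prod.ext ?_ (Prod.ext ?_ ?_)
  · dsimp only
    rw [sub_eq_iff_eq_add] at hc
    rw [hc]
    module
  · dsimp only
    simp
    linear_combination (-a) * (hcomp) + b * real_inner_comm (ζ q (X q)) (ζ q (Y q))
  · dsimp only
    simp
    linear_combination a * real_inner_comm (ξ q (X q)) (ξ q (Y q)) -
      b * real_inner_comm (ξ q (Y q)) (ζ q (X q)) + b * real_inner_comm (ξ q (X q)) (ζ q (Y q)) +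
      b * hcomp

end TripleConnection

/-! ### The triple connection in coordinates -/

section LocalParallelTrivialization

open Filter Topology

-- Coordinate form of local triviality: if d + Γ is flat, a solution of dU = UΓ satisfies d(Uz) =
-- U(dz + Γz), so U turns the connection into the ordinary derivative. A nontrivial `W` makes the
-- norm of the identity operator equal to 1, as the abstract system requires.
set_option synthInstance.maxHeartbeats 200000 in
theorem exists_parallel_frame {V W : Type*} [NormedAddCommGroup V] [NormedSpace ℝ V]
    [FiniteDimensional ℝ V] [NormedAddCommGroup W] [NormedSpace ℝ W] [FiniteDimensional ℝ W]
    [Nontrivial W] {Γ : V → V →ₗ[ℝ] W →ₗ[ℝ] W} {s : Set V} (hs : IsOpen s) {c : V} (hc : c ∈ s)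
    (smooth : ∀ u z, ContDiffOn ℝ ∞ (fun a ↦ Γ a u z) s)
    (flat : ∀ a ∈ s, ∀ u w z, fderiv ℝ (fun a ↦ Γ a w z) a u + Γ a u (Γ a w z) =
      fderiv ℝ (fun a ↦ Γ a u z) a w + Γ a w (Γ a u z)) :
    ∃ ρ > 0, Metric.ball c ρ ⊆ s ∧ ∃ U : V → W →L[ℝ] W, ContDiffOn ℝ ∞ U (Metric.ball c ρ) ∧
      (∀ a ∈ Metric.ball c ρ, IsUnit (U a)) ∧
      ∀ a ∈ Metric.ball c ρ, ∀ u z, fderiv ℝ U a u z = U a (Γ a u z) := by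
  let T : (W →ₗ[ℝ] W) ≃ₗ[ℝ] (W →L[ℝ] W) := LinearMap.toContinuousLinearMap
  let A : V → V →L[ℝ] W →L[ℝ] W := fun a ↦
    LinearMap.toContinuousLinearMap (T.toLinearMap ∘ₗ Γ a)
  have hA : ∀ a u z, A a u z = Γ a u z := fun a u z ↦ rfl
  have hAs : ContDiffOn ℝ ∞ A s :=
    contDiffOn_clm_apply.2 fun u ↦ contDiffOn_clm_apply.2 fun z ↦ smooth u z
  have hd : ∀ a ∈ s, ∀ u w z, fderiv ℝ A a u w z = fderiv ℝ (fun a ↦ Γ a w z) a u := by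
    intro a ha u w z
    have h1 : HasFDerivAt A (fderiv ℝ A a) a :=
      ((hAs.contDiffAt (hs.mem_nhds ha)).differentiableAt (by simp)).hasFDerivAt
    have h2 := (h1.clm_apply (hasFDerivAt_const w a)).clm_apply (hasFDerivAt_const z a)
    have h3 := h2.fderiv
    simp only [hA] at h3
    rw [h3]
    simp
  obtain ⟨ρ, hρ, hsub, U, hU, hunit, hder⟩ := exists_flat_solution hs hc hAs (by
    intro a ha u w
    ext z
    simp only [add_apply, mul_apply_eq_comp, hd a ha, hA]
    exact flat a ha u w z)
  refine ⟨ρ, hρ, hsub, U, hU, hunit, fun a ha u z ↦ ?_⟩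
  rw [(hder a ha).fderiv]
  rfl

variable {n : ℕ} {M : Type*} [TopologicalSpace M] [ChartedSpace (EuclideanSpace ℝ (Fin n)) M]
  [IsManifold (𝓡 n) ∞ M]
  {F : Type*} [NormedAddCommGroup F] [NormedSpace ℝ F]
  {E : M → Type*} [TopologicalSpace (TotalSpace F E)]
  [∀ p, NormedAddCommGroup (E p)] [∀ p, InnerProductSpace ℝ (E p)]
  [FiberBundle F E]
  [FiniteDimensional ℝ F] [VectorBundle ℝ F E]
  {D : CovariantDerivative (𝓡 n) F E} {ξ ζ : Π p : M, TangentSpace (𝓡 n) p →L[ℝ] E p}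
  {N : Set M} {S : F →ₗ[ℝ] Π q, E q} {c : Π q, E q →ₗ[ℝ] F}

/-- The section of `E ⊕ ℝ ⊕ ℝ` with constant coordinates in a frame of `E`. -/
def frameTriple (S : F →ₗ[ℝ] Π q, E q) (z : F × ℝ × ℝ) (p : M) : E p × ℝ × ℝ := (S z.1 p, z.2)

/-- The coordinates of a triple in a frame of `E`. -/
def coordTriple (c : Π q, E q →ₗ[ℝ] F) (q : M) : E q × ℝ × ℝ →ₗ[ℝ] F × ℝ × ℝ :=
  (c q).prodMap LinearMap.id

theorem IsSmoothFrame.coordTriple_bijective (hS : IsSmoothFrame n F N S c) {q : M} (hq : q ∈ N) :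
    Function.Bijective (coordTriple c q) :=
  Function.bijective_iff_has_inverse.2 ⟨fun z ↦ frameTriple S z q,
    fun w ↦ Prod.ext (hS.frame_coord q hq w.1) rfl, fun z ↦ Prod.ext (hS.coord_frame q hq z.1) rfl⟩

theorem IsSmoothFrame.contMDiffAt_coordTriple (hS : IsSmoothFrame n F N S c) {q : M} (hq : q ∈ N)
    {τ : Π p, E p × ℝ × ℝ} (hτ : IsSmoothTripleAt n F τ q) :
    ContMDiffAt (𝓡 n) 𝓘(ℝ, F × ℝ × ℝ) ∞ (fun p ↦ coordTriple c p (τ p)) q :=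
  (hS.contMDiffAt_coord q hq _ hτ.fst).prodMk_space (hτ.snd.prodMk_space hτ.trd)

theorem IsSmoothFrame.isSmoothTripleAt_of_coordTriple (hS : IsSmoothFrame n F N S c) {q : M}
    (hq : q ∈ N) {τ : Π p, E p × ℝ × ℝ}
    (hτ : ContMDiffAt (𝓡 n) 𝓘(ℝ, F × ℝ × ℝ) ∞ (fun p ↦ coordTriple c p (τ p)) q) :
    IsSmoothTripleAt n F τ q where
  fst := hS.contMDiffAt_of_coord q hq _
    ((contDiff_fst (𝕜 := ℝ) (E := F) (F := ℝ × ℝ)).contMDiff.contMDiffAt.comp q hτ)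
  snd := (contDiff_snd.fst (𝕜 := ℝ) (E := F × ℝ × ℝ)).contMDiff.contMDiffAt.comp q hτ
  trd := (contDiff_snd.snd (𝕜 := ℝ) (E := F × ℝ × ℝ)).contMDiff.contMDiffAt.comp q hτ

theorem hasMFDerivAt_prodMk_space {G G' : Type*} [NormedAddCommGroup G] [NormedSpace ℝ G]
    [NormedAddCommGroup G'] [NormedSpace ℝ G'] {f : M → G} {g : M → G'} {q : M}
    {f' : TangentSpace (𝓡 n) q →L[ℝ] G} {g' : TangentSpace (𝓡 n) q →L[ℝ] G'}
    (hf : HasMFDerivAt (𝓡 n) 𝓘(ℝ, G) f q f') (hg : HasMFDerivAt (𝓡 n) 𝓘(ℝ, G') g q g') :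
    HasMFDerivAt (𝓡 n) 𝓘(ℝ, G × G') (fun p ↦ (f p, g p)) q (f'.prod g') :=
  ⟨hf.1.prodMk hg.1, hf.2.prodMk hg.2⟩

/-- The decomposition d + Γ for the triple connection: the terms with ξ, ζ and the inner products
are of order zero and depend only on the value τ(q). -/
theorem IsSmoothFrame.coordTriple_tripleDeriv (hS : IsSmoothFrame n F N S c) {q : M} (hq : q ∈ N)
    {τ : Π p, E p × ℝ × ℝ} (hτ : IsSmoothTripleAt n F τ q) (X : TangentSpace (𝓡 n) q) :
    coordTriple c q (tripleDeriv D ξ ζ τ q X) =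
      mvfderiv (𝓡 n) (fun p ↦ coordTriple c p (τ p)) q X +
      coordTriple c q (tripleDeriv D ξ ζ (frameTriple S (coordTriple c q (τ q))) q X) := by
  have h1 := ((hS.contMDiffAt_coord q hq _ hτ.fst).mdifferentiableAt (by simp)).hasMFDerivAt
  have h2 := (hτ.snd.mdifferentiableAt (by simp)).hasMFDerivAt
  have h3 := (hτ.trd.mdifferentiableAt (by simp)).hasMFDerivAt
  have h4 : mvfderiv (𝓡 n) (fun p ↦ coordTriple c p (τ p)) q X =
      (mvfderiv (𝓡 n) (fun p ↦ c p (τ p).1) q X, mvfderiv (𝓡 n) (fun p ↦ (τ p).2.1) q X,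
        mvfderiv (𝓡 n) (fun p ↦ (τ p).2.2) q X) :=
    congrArg (fun T : TangentSpace (𝓡 n) q →L[ℝ] F × ℝ × ℝ ↦ T X)
      (hasMFDerivAt_prodMk_space h1 (hasMFDerivAt_prodMk_space h2 h3)).mfderiv
  rw [h4]
  have h5 := hS.covariantDerivative_eq D hq hτ.fst X
  simp only [coordTriple, tripleDeriv, frameTriple, LinearMap.prodMap_apply, LinearMap.id_apply,
    mvfderiv_const, zero_apply, h5, Prod.mk_add_mk, map_add, hS.coord_frame q hq,
    hS.frame_coord q hq]
  refine Prod.ext ?_ (Prod.ext ?_ ?_)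
  · dsimp only; abel
  · dsimp only; abel
  · dsimp only; abel

/-- The connection form of `tripleDeriv` with respect to a frame of `E`. -/
def connectionForm (D : CovariantDerivative (𝓡 n) F E)
    (ξ ζ : Π p : M, TangentSpace (𝓡 n) p →L[ℝ] E p) (hS : IsSmoothFrame n F N S c)
    (X : EuclideanSpace ℝ (Fin n) →ₗ[ℝ] Π q : M, TangentSpace (𝓡 n) q) (q : M) :
    EuclideanSpace ℝ (Fin n) →ₗ[ℝ] F × ℝ × ℝ →ₗ[ℝ] F × ℝ × ℝ :=
  LinearMap.mk₂ ℝ (fun u z ↦ coordTriple c q (tripleDeriv D ξ ζ (frameTriple S z) q (X u q)))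
    (fun u u' z ↦ by
      rw [← map_add]
      congr 1
      simp only [tripleDeriv, map_add, Pi.add_apply, inner_add_right]
      refine Prod.ext ?_ (Prod.ext ?_ ?_)
      · simp; module
      · simp; ring
      · simp; ring)
    (fun a u z ↦ by
      rw [← map_smul]
      congr 1
      simp only [tripleDeriv, map_smul, Pi.smul_apply, inner_smul_right]
      refine Prod.ext ?_ (Prod.ext ?_ ?_)
      · simp; module
      · simp; ring
      · simp; ring)
    (fun u z z' ↦ by
      rw [← map_add]
      congr 1
      have h := D.isCovariantDerivativeOnUniv.add
        ((hS.smooth z.1).mdifferentiable (by simp) q) ((hS.smooth z'.1).mdifferentiable (by simp) q)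
      simp only [tripleDeriv, frameTriple, mvfderiv_const, Prod.fst_add, Prod.snd_add, map_add]
      refine Prod.ext ?_ (Prod.ext ?_ ?_)
      · have h' : D (fun p ↦ S z.1 p + S z'.1 p) q = D (S z.1) q + D (S z'.1) q := h
        simp [h']; module
      · simp [inner_add_left]; ring
      · simp [inner_add_left]; ring)
    (fun a u z ↦ by
      rw [← map_smul]
      congr 1
      have h := D.isCovariantDerivativeOnUniv.smul_const a
        ((hS.smooth z.1).mdifferentiable (by simp) q)
      simp only [tripleDeriv, frameTriple, mvfderiv_const, Prod.smul_fst, Prod.smul_snd, map_smul]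
      refine Prod.ext ?_ (Prod.ext ?_ ?_)
      · have h' : D (fun p ↦ a • S z.1 p) q = a • D (S z.1) q := h
        simp [h']; module
      · simp [inner_smul_left]
      · simp [inner_smul_left])

end LocalParallelTrivialization

/-! ### Local parallel trivializations -/

section ParallelTrivialization

open Filter Topology

variable {n : ℕ} {M : Type*} [TopologicalSpace M] [ChartedSpace (EuclideanSpace ℝ (Fin n)) M]
  [IsManifold (𝓡 n) ∞ M] [T2Space M]

theorem mvfderiv_clm_apply_extChartAt {W : Type*} [NormedAddCommGroup W] [NormedSpace ℝ W]
    {p₀ q : M} (hq : q ∈ (extChartAt (𝓡 n) p₀).source)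
    {U : EuclideanSpace ℝ (Fin n) → W →L[ℝ] W} (hU : ContDiffAt ℝ ∞ U (extChartAt (𝓡 n) p₀ q))
    {w : M → W} (hw : ContMDiffAt (𝓡 n) 𝓘(ℝ, W) ∞ w q) :
    ContMDiffAt (𝓡 n) 𝓘(ℝ, W) ∞ (fun p ↦ U (extChartAt (𝓡 n) p₀ p) (w p)) q ∧
    ∀ X : TangentSpace (𝓡 n) q, mvfderiv (𝓡 n) (fun p ↦ U (extChartAt (𝓡 n) p₀ p) (w p)) q X =
      fderiv ℝ U (extChartAt (𝓡 n) p₀ q) (mvfderiv (𝓡 n) (extChartAt (𝓡 n) p₀) q X) (w q) +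
      U (extChartAt (𝓡 n) p₀ q) (mvfderiv (𝓡 n) w q X) := by
  set φ := extChartAt (𝓡 n) p₀ with hφ
  have hφq : ContMDiffAt (𝓡 n) 𝓘(ℝ, EuclideanSpace ℝ (Fin n)) ∞ φ q :=
    contMDiffAt_extChartAt' (by simpa [hφ] using hq)
  refine ⟨(hU.contMDiffAt.comp q hφq).clm_apply hw, fun X ↦ ?_⟩
  have hwd := hw.mdifferentiableAt (by simp : (∞ : ℕ∞ω) ≠ 0)
  have hUd := (hU.differentiableAt (by simp)).hasFDerivAt
  have hwf := (mdifferentiableAt_comp_symm hwd hq).hasFDerivAt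
  have h1 : (fun p ↦ U (φ p) (w p)) =ᶠ[𝓝 q] fun p ↦ (fun a ↦ U a ((w ∘ φ.symm) a)) (φ p) := by
    filter_upwards [eventually_mem_extChartAt_source hq] with q' hq'
    rw [Function.comp_apply, φ.left_inv hq']
  have h2 := hUd.clm_apply hwf
  rw [h1.mvfderiv_eq, mvfderiv_comp_extChartAt h2.differentiableAt hq, h2.fderiv,
    mvfderiv_eq_fderiv_comp_symm hwd hq X]
  have h3 : (w ∘ φ.symm) (φ q) = w q := congrArg w (φ.left_inv hq)
  rw [add_comm, ← h3]
  rfl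

variable {F : Type*} [NormedAddCommGroup F] [NormedSpace ℝ F]
  {E : M → Type*} [TopologicalSpace (TotalSpace F E)]
  [∀ p, NormedAddCommGroup (E p)] [∀ p, InnerProductSpace ℝ (E p)]
  [FiberBundle F E]
  [FiniteDimensional ℝ F] [VectorBundle ℝ F E] [ContMDiffVectorBundle ∞ F E (𝓡 n)]
  [IsContMDiffRiemannianBundle (𝓡 n) ∞ F E]
  {D : CovariantDerivative (𝓡 n) F E} {ξ ζ : Π p : M, TangentSpace (𝓡 n) p →L[ℝ] E p}

/-- `P` is frame coordinates followed by an invertible solution U of dU = UΓ. The last clause says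
that the inverse of `P` is smooth too, so that constant vectors pull back to smooth triples. -/
theorem IsFrontalBundle.exists_parallel_trivialization (h : IsFrontalBundle D ξ ζ)
    (hG : SatisfiesCurvatureIdentity D ξ ζ) (p₀ : M) :
    ∃ (N : Set M) (P : Π q, E q × ℝ × ℝ →ₗ[ℝ] F × ℝ × ℝ), IsOpen N ∧ p₀ ∈ N ∧
      (∀ q ∈ N, Function.Bijective (P q)) ∧
      (∀ q ∈ N, ∀ τ, IsSmoothTripleAt n F τ q →
        ContMDiffAt (𝓡 n) 𝓘(ℝ, F × ℝ × ℝ) ∞ (fun p ↦ P p (τ p)) q ∧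
        ∀ X, mvfderiv (𝓡 n) (fun p ↦ P p (τ p)) q X = P q (tripleDeriv D ξ ζ τ q X)) ∧
      ∀ q ∈ N, ∀ τ, ContMDiffAt (𝓡 n) 𝓘(ℝ, F × ℝ × ℝ) ∞ (fun p ↦ P p (τ p)) q →
        IsSmoothTripleAt n F τ q := by
  obtain ⟨N₁, S, hp₁, -, hS⟩ := exists_smoothFrame (n := n) F (E := E) p₀
  obtain ⟨N₂, X, hN₂, hp₂, hsrc, hX, hXφ, hbr⟩ := exists_coordinateFields (n := n) p₀
  set c : Π q, E q →ₗ[ℝ] F := fun q ↦ (trivializationAt F E p₀).linearMapAt ℝ q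
  set φ := extChartAt (𝓡 n) p₀ with hφ
  let Γ := connectionForm D ξ ζ hS X
  have hΓ : ∀ q u z, Γ q u z =
    coordTriple c q (tripleDeriv D ξ ζ (frameTriple S z) q (X u q)) := fun _ _ _ ↦ rfl
  have hΓs : ∀ q ∈ N₁, ∀ u z, ContMDiffAt (𝓡 n) 𝓘(ℝ, F × ℝ × ℝ) ∞ (fun p ↦ Γ p u z) q :=
    fun q hq u z ↦ hS.contMDiffAt_coordTriple hq
      (h.isSmoothTripleAt_tripleDeriv (hS.smooth z.1) z.2.1 z.2.2 (hX u) q)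
  set s := φ.target ∩ φ.symm ⁻¹' (N₁ ∩ N₂)
  have hs : IsOpen s := (continuousOn_extChartAt_symm p₀).isOpen_inter_preimage
    (isOpen_extChartAt_target p₀) (hS.isOpen.inter hN₂)
  have hps : φ p₀ ∈ s :=
    ⟨mem_extChartAt_target p₀, by rw [Set.mem_preimage, extChartAt_to_inv]; exact ⟨hp₁, hp₂⟩⟩
  obtain ⟨ρ, hρ, hsub, U, hU, hunit, hder⟩ := exists_parallel_frame (Γ := fun a ↦ Γ (φ.symm a))
    hs hps (fun u z ↦ contDiffOn_comp_extChartAt_symm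
      (f := fun p ↦ Γ p u z) fun q hq ↦ (hΓs q hq.1 u z).contMDiffWithinAt) (by
    intro a ha u w z
    obtain ⟨q, hq, rfl⟩ : ∃ q ∈ φ.source, φ q = a :=
      ⟨φ.symm a, φ.map_target ha.1, φ.right_inv ha.1⟩
    have hqN : q ∈ N₁ ∩ N₂ := by
      have := ha.2
      rwa [Set.mem_preimage, φ.left_inv hq] at this
    -- dΓ + ΓΓ is the coordinate expression of the second covariant derivative of a frame triple
    -- along coordinate fields. As these fields commute, the flatness of Γ is `tripleDeriv_comm`.
    have key : ∀ u w, fderiv ℝ (fun a ↦ Γ (φ.symm a) w z) (φ q) u + Γ q u (Γ q w z) =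
        coordTriple c q (tripleDeriv D ξ ζ (fun p ↦ tripleDeriv D ξ ζ (frameTriple S z) p (X w p))
          q (X u q)) := by
      intro u w
      have e₁ := hS.coordTriple_tripleDeriv (D := D) (ξ := ξ) (ζ := ζ) hqN.1
        (h.isSmoothTripleAt_tripleDeriv (hS.smooth z.1) z.2.1 z.2.2 (hX w) q) (X u q)
      have e := mvfderiv_eq_fderiv_comp_symm ((hΓs q hqN.1 w z).mdifferentiableAt (by simp)) hq
        (X u q)
      rw [hXφ q hqN.2] at e
      exact (congrArg₂ (· + ·) e.symm rfl).trans e₁.symm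
    rw [φ.left_inv hq, key, key]
    congr 1
    exact (h.tripleDeriv_comm hG (hS.smooth z.1) z.2.1 z.2.2 (hX u) (hX w)
      (hbr q hqN.2 u w)).symm)
  set N := φ.source ∩ φ ⁻¹' Metric.ball (φ p₀) ρ
  have hNo : IsOpen N := (continuousOn_extChartAt p₀).isOpen_inter_preimage
    (isOpen_extChartAt_source p₀) Metric.isOpen_ball
  have hN : ∀ q ∈ N, q ∈ N₁ ∩ N₂ := by
    intro q hq
    have := (hsub hq.2).2
    rwa [Set.mem_preimage, φ.left_inv hq.1] at this
  have hUq : ∀ q ∈ N, ContDiffAt ℝ ∞ U (φ q) := fun q hq ↦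
    hU.contDiffAt (Metric.isOpen_ball.mem_nhds hq.2)
  refine ⟨N, fun q ↦ (U (φ q)).toLinearMap ∘ₗ coordTriple c q, hNo,
    ⟨mem_extChartAt_source p₀, Metric.mem_ball_self hρ⟩, fun q hq ↦ ?_, fun q hq τ hτ ↦ ?_,
    fun q hq τ hτ ↦ ?_⟩
  · refine Function.Bijective.comp (g := U (φ q)) ?_ (hS.coordTriple_bijective (hN q hq).1)
    obtain ⟨u, hu⟩ := hunit _ hq.2
    rw [← hu]
    exact (ContinuousLinearEquiv.unitsEquiv ℝ (F × ℝ × ℝ) u).bijective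
  · obtain ⟨h1, h2⟩ := mvfderiv_clm_apply_extChartAt hq.1 (hUq q hq)
      (hS.contMDiffAt_coordTriple (hN q hq).1 hτ)
    refine ⟨h1, fun Y ↦ (h2 Y).trans ?_⟩
    -- Every tangent vector at `q` is the value of the coordinate field with the same components, so
    -- Γ may be evaluated on it.
    have hY : X (mvfderiv (𝓡 n) φ q Y) q = Y :=
      (mvfderiv_extChartAt_bijective hq.1).1 (hXφ q (hN q hq).2 _)
    rw [hder _ hq.2, φ.left_inv hq.1, ← map_add, hΓ, hY, add_comm,
      ← hS.coordTriple_tripleDeriv (hN q hq).1 hτ]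
    rfl
  · have hinv : ContDiffAt ℝ ∞ (fun a ↦ Ring.inverse (U a)) (φ q) := by
      obtain ⟨u, hu⟩ := hunit _ hq.2
      have := contDiffAt_ringInverse ℝ (n := ∞) u
      rw [hu] at this
      exact this.comp (φ q) (hUq q hq)
    have h1 := (mvfderiv_clm_apply_extChartAt hq.1 hinv hτ).1
    refine hS.isSmoothTripleAt_of_coordTriple (hN q hq).1 (h1.congr_of_eventuallyEq ?_)
    filter_upwards [hNo.mem_nhds hq] with q' hq'
    have := Ring.inverse_mul_cancel _ (hunit _ hq'.2)
    exact (congrArg (fun T : F × ℝ × ℝ →L[ℝ] F × ℝ × ℝ ↦ T (coordTriple c q' (τ q'))) this).symm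

end ParallelTrivialization

/-! ### Global parallel isometry onto Lorentz–Minkowski space -/

section ParallelSystem

open Filter Topology

theorem eventually_eq_of_mvfderiv_eq_zero {n : ℕ} {M : Type*} [TopologicalSpace M]
    [ChartedSpace (EuclideanSpace ℝ (Fin n)) M] [IsManifold (𝓡 n) ∞ M] {G : Type*}
    [NormedAddCommGroup G] [NormedSpace ℝ G] {f : M → G} {p : M}
    (hf : ∀ᶠ q in 𝓝 p, MDifferentiableAt (𝓡 n) 𝓘(ℝ, G) f q ∧
      ∀ X, mvfderiv (𝓡 n) f q X = 0) : ∀ᶠ q in 𝓝 p, f q = f p := by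
  obtain ⟨N, hN, hNo, hpN⟩ := mem_nhds_iff.1 hf
  set φ := extChartAt (𝓡 n) p with hφ
  have hso : IsOpen (φ.target ∩ φ.symm ⁻¹' N) :=
    (continuousOn_extChartAt_symm p).isOpen_inter_preimage (isOpen_extChartAt_target p) hNo
  have hps : φ p ∈ φ.target ∩ φ.symm ⁻¹' N :=
    ⟨mem_extChartAt_target p, by rw [Set.mem_preimage, extChartAt_to_inv]; exact hpN⟩
  obtain ⟨ρ, hρ, hsub⟩ := Metric.isOpen_iff.1 hso _ hps
  have key : ∀ a ∈ Metric.ball (φ p) ρ, DifferentiableAt ℝ (f ∘ φ.symm) a ∧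
      fderiv ℝ (f ∘ φ.symm) a = 0 := by
    intro a ha
    obtain ⟨q, hq, rfl⟩ : ∃ q ∈ φ.source, φ q = a :=
      ⟨φ.symm a, φ.map_target (hsub ha).1, φ.right_inv (hsub ha).1⟩
    have hqN := (hsub ha).2
    rw [Set.mem_preimage, φ.left_inv hq] at hqN
    obtain ⟨h1, h2⟩ := hN hqN
    refine ⟨mdifferentiableAt_comp_symm h1 hq, ?_⟩
    ext u
    obtain ⟨X, rfl⟩ := (mvfderiv_extChartAt_bijective hq).2 u
    exact (mvfderiv_eq_fderiv_comp_symm h1 hq X).symm.trans (h2 X)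
  have hU : IsOpen (φ.source ∩ φ ⁻¹' Metric.ball (φ p) ρ) :=
    (continuousOn_extChartAt p).isOpen_inter_preimage (isOpen_extChartAt_source p)
      Metric.isOpen_ball
  filter_upwards [hU.mem_nhds ⟨mem_extChartAt_source p, Metric.mem_ball_self hρ⟩] with q hq
  have h1 := Metric.isOpen_ball.is_const_of_fderiv_eq_zero (convex_ball (φ p) ρ).isPreconnected
    (fun a ha ↦ (key a ha).1.differentiableWithinAt) (fun a ha ↦ (key a ha).2) hq.2
    (Metric.mem_ball_self hρ)
  simpa only [Function.comp_apply, hφ, (extChartAt (𝓡 n) p).left_inv hq.1,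
    extChartAt_to_inv] using h1

variable {n : ℕ} {M : Type*} [TopologicalSpace M] [ChartedSpace (EuclideanSpace ℝ (Fin n)) M]
  [IsManifold (𝓡 n) ∞ M]
  {F : Type*} [NormedAddCommGroup F] [NormedSpace ℝ F]
  {E : M → Type*} [TopologicalSpace (TotalSpace F E)]
  [∀ p, NormedAddCommGroup (E p)] [∀ p, InnerProductSpace ℝ (E p)]
  [FiberBundle F E]

/-- `tripleForm` as a bilinear form. -/
def tripleBilin (E : M → Type*) [∀ p, NormedAddCommGroup (E p)] [∀ p, InnerProductSpace ℝ (E p)]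
    (p : M) : E p × ℝ × ℝ →ₗ[ℝ] E p × ℝ × ℝ →ₗ[ℝ] ℝ :=
  LinearMap.mk₂ ℝ tripleForm
    (fun a b c ↦ by simp [tripleForm, inner_add_left]; ring)
    (fun r a c ↦ by simp [tripleForm, inner_smul_left]; ring)
    (fun a b c ↦ by simp [tripleForm, inner_add_right]; ring)
    (fun r a c ↦ by simp [tripleForm, inner_smul_right]; ring)

variable (F) in
/-- `Φ` intertwines `tripleDeriv` with the flat derivative in `L^{n+2}` at `q`. -/
def IntertwinesAt (D : CovariantDerivative (𝓡 n) F E)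
    (ξ ζ : Π p : M, TangentSpace (𝓡 n) p →L[ℝ] E p)
    (Φ : Π p, E p × ℝ × ℝ →ₗ[ℝ] LorentzSpace n) (q : M) : Prop :=
  ∀ τ, IsSmoothTripleAt n F τ q →
    ContMDiffAt (𝓡 n) 𝓘(ℝ, LorentzSpace n) ∞ (fun p ↦ Φ p (τ p)) q ∧
    ∀ X, mvfderiv (𝓡 n) (fun p ↦ Φ p (τ p)) q X = Φ q (tripleDeriv D ξ ζ τ q X)

variable [T2Space M] [FiniteDimensional ℝ F] [VectorBundle ℝ F E]
  [ContMDiffVectorBundle ∞ F E (𝓡 n)] [IsContMDiffRiemannianBundle (𝓡 n) ∞ F E]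
  {D : CovariantDerivative (𝓡 n) F E} {ξ ζ : Π p : M, TangentSpace (𝓡 n) p →L[ℝ] E p}

/-- Constant vectors pulled back through `P` are parallel. They span every nearby fibre and serve as
test sections for intertwiners. -/
theorem IsFrontalBundle.exists_parallel_triples (h : IsFrontalBundle D ξ ζ)
    (hG : SatisfiesCurvatureIdentity D ξ ζ) (p₀ : M) :
    ∃ T : Π q, F × ℝ × ℝ →ₗ[ℝ] E q × ℝ × ℝ, ∀ᶠ q in 𝓝 p₀, Function.Surjective (T q) ∧
      ∀ w, IsSmoothTripleAt n F (fun p ↦ T p w) q ∧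
        ∀ X, tripleDeriv D ξ ζ (fun p ↦ T p w) q X = 0 := by
  classical
  obtain ⟨N, P, hN, hp, hbij, hP, hsm⟩ := h.exists_parallel_trivialization hG p₀
  let T : Π q, F × ℝ × ℝ →ₗ[ℝ] E q × ℝ × ℝ := fun q ↦
    -- The value 0 outside `N` is a default; only points near `p₀` matter.
    if hq : q ∈ N then (LinearEquiv.ofBijective (P q) (hbij q hq)).symm.toLinearMap else 0
  have hT : ∀ q ∈ N, ∀ w, P q (T q w) = w := by
    intro q hq w
    simp only [T, dif_pos hq]
    exact (LinearEquiv.ofBijective (P q) (hbij q hq)).apply_symm_apply w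
  refine ⟨T, ?_⟩
  filter_upwards [hN.mem_nhds hp] with q hq
  refine ⟨fun z ↦ ⟨P q z, (hbij q hq).1 (hT q hq _)⟩, fun w ↦ ?_⟩
  have hconst : (fun p ↦ P p (T p w)) =ᶠ[𝓝 q] fun _ ↦ w := by
    filter_upwards [hN.mem_nhds hq] with q' hq' using hT q' hq' w
  have hs : IsSmoothTripleAt n F (fun p ↦ T p w) q :=
    hsm q hq _ (contMDiffAt_const.congr_of_eventuallyEq hconst)
  refine ⟨hs, fun X ↦ (hbij q hq).1 ?_⟩
  rw [← (hP q hq _ hs).2 X, hconst.mvfderiv_eq, map_zero, mvfderiv_const]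
  rfl

/-- Composing `P` with a fixed linear map `g` keeps the intertwining property, and every linear map
on the fibre at `q` arises from exactly one `g`. This is the local input of the monodromy principle.
-/
theorem IsFrontalBundle.exists_local_intertwiner (h : IsFrontalBundle D ξ ζ)
    (hG : SatisfiesCurvatureIdentity D ξ ζ) (p₀ : M) :
    ∃ U, IsOpen U ∧ p₀ ∈ U ∧ ∃ Ψ : (F × ℝ × ℝ →ₗ[ℝ] LorentzSpace n) →
      Π p, E p × ℝ × ℝ →ₗ[ℝ] LorentzSpace n,
      (∀ q ∈ U, Function.Bijective fun g ↦ Ψ g q) ∧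
      ∀ g, ∀ q ∈ U, ∀ᶠ q' in 𝓝 q, IntertwinesAt F D ξ ζ (Ψ g) q' := by
  obtain ⟨N, P, hN, hp, hbij, hP, -⟩ := h.exists_parallel_trivialization hG p₀
  refine ⟨N, hN, hp, fun g q ↦ g ∘ₗ P q, fun q hq ↦ ?_, fun g q hq ↦ ?_⟩
  · exact (LinearEquiv.congrLeft (LorentzSpace n) ℝ
      (LinearEquiv.ofBijective (P q) (hbij q hq)).symm).bijective
  · filter_upwards [hN.mem_nhds hq] with q' hq' τ hτ
    obtain ⟨h1, h2⟩ := hP q' hq' τ hτ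
    let g' : F × ℝ × ℝ →L[ℝ] LorentzSpace n := LinearMap.toContinuousLinearMap g
    refine ⟨g'.contMDiff.contMDiffAt.comp q' h1, fun X ↦ ?_⟩
    have h3 := (g'.hasMFDerivAt.comp q'
      (h1.mdifferentiableAt (by simp)).hasMFDerivAt).mfderiv
    refine (congrArg (fun T : TangentSpace (𝓡 n) q' →L[ℝ] LorentzSpace n ↦ T X) h3).trans ?_
    exact congrArg g (h2 X)

/-- An intertwiner maps parallel triples to functions with zero derivative; a finite basis gives one
neighbourhood for all of them. -/
theorem IntertwinesAt.eventually_comp_eq {Φ : Π p, E p × ℝ × ℝ →ₗ[ℝ] LorentzSpace n} {p : M}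
    (hΦ : ∀ᶠ q in 𝓝 p, IntertwinesAt F D ξ ζ Φ q) {T : Π q, F × ℝ × ℝ →ₗ[ℝ] E q × ℝ × ℝ}
    (hT : ∀ᶠ q in 𝓝 p, Function.Surjective (T q) ∧
      ∀ w, IsSmoothTripleAt n F (fun p ↦ T p w) q ∧
        ∀ X, tripleDeriv D ξ ζ (fun p ↦ T p w) q X = 0) :
    ∀ᶠ q in 𝓝 p, Φ q ∘ₗ T q = Φ p ∘ₗ T p := by
  have h1 : ∀ w, ∀ᶠ q in 𝓝 p, Φ q (T q w) = Φ p (T p w) := by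
    intro w
    refine eventually_eq_of_mvfderiv_eq_zero (n := n) ?_
    filter_upwards [hΦ, hT] with q hq hq'
    obtain ⟨h1, h2⟩ := hq _ (hq'.2 w).1
    refine ⟨h1.mdifferentiableAt (by simp), fun X ↦ ?_⟩
    rw [h2, (hq'.2 w).2, map_zero]
  filter_upwards [eventually_all.2 fun k ↦ h1 (Module.finBasis ℝ (F × ℝ × ℝ) k)] with q hq
  exact (Module.finBasis ℝ (F × ℝ × ℝ)).ext hq

/-- Unique continuation: both maps are locally constant on parallel triples, and these span the
fibres. -/
theorem IsFrontalBundle.eventually_eq_of_intertwines (h : IsFrontalBundle D ξ ζ)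
    (hG : SatisfiesCurvatureIdentity D ξ ζ) {Φ Φ' : Π p, E p × ℝ × ℝ →ₗ[ℝ] LorentzSpace n} {p : M}
    (hΦ : ∀ᶠ q in 𝓝 p, IntertwinesAt F D ξ ζ Φ q) (hΦ' : ∀ᶠ q in 𝓝 p, IntertwinesAt F D ξ ζ Φ' q)
    (hp : Φ p = Φ' p) : ∀ᶠ q in 𝓝 p, Φ q = Φ' q := by
  obtain ⟨T, hT⟩ := h.exists_parallel_triples hG p
  filter_upwards [IntertwinesAt.eventually_comp_eq hΦ hT,
    IntertwinesAt.eventually_comp_eq hΦ' hT, hT] with q h1 h2 h3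
  rw [← LinearMap.cancel_right h3.1, h1, h2, hp]

/-- `Φ` is isometric at `p`. -/
def IsIsometricAt (Φ : Π p, E p × ℝ × ℝ →ₗ[ℝ] LorentzSpace n) (p : M) : Prop :=
  (lorentzBilin n).compl₁₂ (Φ p) (Φ p) = tripleBilin E p

/-- On parallel triples both `tripleForm` and the pulled-back Lorentzian product are locally
constant, so whether they coincide is locally constant as well. -/
theorem IsFrontalBundle.eventually_isIsometricAt_iff (h : IsFrontalBundle D ξ ζ)
    (hG : SatisfiesCurvatureIdentity D ξ ζ) {Φ : Π p, E p × ℝ × ℝ →ₗ[ℝ] LorentzSpace n} {p : M}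
    (hΦ : ∀ᶠ q in 𝓝 p, IntertwinesAt F D ξ ζ Φ q) :
    ∀ᶠ q in 𝓝 p, IsIsometricAt Φ q ↔ IsIsometricAt Φ p := by
  obtain ⟨T, hT⟩ := h.exists_parallel_triples hG p
  have h1 : ∀ w w', ∀ᶠ q in 𝓝 p, tripleForm (T q w) (T q w') = tripleForm (T p w) (T p w') := by
    intro w w'
    refine eventually_eq_of_mvfderiv_eq_zero (n := n) ?_
    filter_upwards [hT] with q hq
    obtain ⟨h1, h2⟩ := forall_and.1 (fun X ↦ h.mvfderiv_tripleForm (hq.2 w).1 (hq.2 w').1 X)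
    refine ⟨h1 0, fun X ↦ ?_⟩
    rw [h2, (hq.2 w).2, (hq.2 w').2]
    simp [tripleForm]
  let b := Module.finBasis ℝ (F × ℝ × ℝ)
  have key : ∀ q, Function.Surjective (T q) → (IsIsometricAt Φ q ↔
      (lorentzBilin n).compl₁₂ (Φ q ∘ₗ T q) (Φ q ∘ₗ T q) =
        (tripleBilin E q).compl₁₂ (T q) (T q)) := by
    intro q hq
    refine ⟨fun h ↦ ?_, fun h ↦ ?_⟩
    · rw [← h]; rfl
    · refine LinearMap.ext fun z ↦ LinearMap.ext fun z' ↦ ?_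
      obtain ⟨w, rfl⟩ := hq z
      obtain ⟨w', rfl⟩ := hq z'
      exact LinearMap.congr_fun₂ h w w'
  filter_upwards [IntertwinesAt.eventually_comp_eq hΦ hT, hT,
    eventually_all.2 fun k ↦ eventually_all.2 fun l ↦ h1 (b k) (b l)] with q h2 h3 h4
  rw [key q h3.1, key p hT.self_of_nhds.1, h2]
  have h5 : (tripleBilin E q).compl₁₂ (T q) (T q) = (tripleBilin E p).compl₁₂ (T p) (T p) :=
    b.ext fun k ↦ b.ext fun l ↦ h4 k l
  rw [h5]

/-- An isometric intertwiner exists globally on a simply connected base. -/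
theorem IsFrontalBundle.exists_isometric_intertwiner [SimplyConnectedSpace M]
    (h : IsFrontalBundle D ξ ζ)
    (hG : SatisfiesCurvatureIdentity D ξ ζ) (p₀ : M) (Φ₀ : E p₀ × ℝ × ℝ →ₗ[ℝ] LorentzSpace n)
    (hΦ₀ : ∀ a b, lorentz (Φ₀ a) (Φ₀ b) = tripleForm a b) :
    ∃ Φ : Π p, E p × ℝ × ℝ →ₗ[ℝ] LorentzSpace n, Φ p₀ = Φ₀ ∧
      (∀ q, IntertwinesAt F D ξ ζ Φ q) ∧
      ∀ p a b, lorentz (Φ p a) (Φ p b) = tripleForm a b := by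
  have : LocallyPathConnectedSpace M :=
    ChartedSpace.locallyPathConnectedSpace (EuclideanSpace ℝ (Fin n)) M
  obtain ⟨Φ, h0, hΦ⟩ := exists_global_solution
    (Y := fun p ↦ E p × ℝ × ℝ →ₗ[ℝ] LorentzSpace n)
    -- The condition is imposed near `p`, not only at `p`, since unique continuation needs it on a
    -- neighbourhood.
    (fun Φ p ↦ ∀ᶠ q in 𝓝 p, IntertwinesAt F D ξ ζ Φ q)
    (fun p₀ ↦ h.exists_local_intertwiner hG p₀)
    (fun Φ Φ' p hΦ hΦ' hp ↦ h.eventually_eq_of_intertwines hG hΦ hΦ' hp)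
    (fun Φ Φ' p hp hΦ ↦ by
      filter_upwards [hΦ, hp.eventually_nhds] with q hq hq' τ hτ
      obtain ⟨h1, h2⟩ := hq τ hτ
      have e : (fun p ↦ Φ p (τ p)) =ᶠ[𝓝 q] fun p ↦ Φ' p (τ p) := by
        filter_upwards [hq'] with r hr
        rw [hr]
      refine ⟨h1.congr_of_eventuallyEq e.symm, fun X ↦ ?_⟩
      rw [← e.mvfderiv_eq, h2, hq'.self_of_nhds]) p₀ Φ₀
  refine ⟨Φ, h0, fun q ↦ (hΦ q).self_of_nhds, fun p ↦ ?_⟩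
  have hloc : IsLocallyConstant (IsIsometricAt Φ) :=
    (IsLocallyConstant.iff_eventually_eq _).2 fun p ↦
      (h.eventually_isIsometricAt_iff hG (hΦ p)).mono fun q hq ↦ propext hq
  have h1 : IsIsometricAt Φ p₀ :=
    LinearMap.ext fun a ↦ LinearMap.ext fun b ↦ by subst h0; exact hΦ₀ a b
  have h2 : IsIsometricAt Φ p := by
    rw [hloc.apply_eq_of_preconnectedSpace p p₀]
    exact h1
  exact fun a b ↦ LinearMap.congr_fun₂ h2 a b

end ParallelSystem

/-! ### From frontal bundles to spacelike frontals -/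

section Realization

open Filter Topology

/-- An isometry from `V ⊕ ℝ ⊕ ℝ` onto `L^{n+2}`, where `V` is Euclidean of dimension `n`. -/
theorem exists_isometric_initial {n : ℕ} {V : Type*} [NormedAddCommGroup V] [InnerProductSpace ℝ V]
    [FiniteDimensional ℝ V] (hV : Module.finrank ℝ V = n) :
    ∃ Φ : V × ℝ × ℝ →ₗ[ℝ] LorentzSpace n,
      (∀ a b, lorentz (Φ a) (Φ b) = inner ℝ a.1 b.1 + a.2.1 * b.2.2 + a.2.2 * b.2.1) ∧
      0 < Φ (0, 1, 0) 0 := by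
  let e : V ≃ₗᵢ[ℝ] EuclideanSpace ℝ (Fin n) :=
    ((stdOrthonormalBasis ℝ V).reindex (finCongr hV)).repr
  let Φ : V × ℝ × ℝ →ₗ[ℝ] LorentzSpace n :=
    -- The two scalar directions go to the null vectors (1, 0, …, 0, 1) and (-1/2, 0, …, 0, 1/2),
    -- whose product is 1.
    { toFun := fun a ↦ Fin.cons (a.2.1 - a.2.2 / 2)
        (Fin.snoc (fun i ↦ e a.1 i) (a.2.1 + a.2.2 / 2) : Fin (n + 1) → ℝ)
      map_add' := fun a b ↦ by
        ext i
        refine Fin.cases ?_ (fun j ↦ ?_) i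
        · simp; ring
        · refine Fin.lastCases ?_ (fun k ↦ ?_) j
          · simp; ring
          · simp
      map_smul' := fun c a ↦ by
        ext i
        refine Fin.cases ?_ (fun j ↦ ?_) i
        · simp; ring
        · refine Fin.lastCases ?_ (fun k ↦ ?_) j
          · simp; ring
          · simp }
  have h0 : ∀ a, Φ a 0 = a.2.1 - a.2.2 / 2 := fun a ↦ rfl
  have hl : ∀ a, Φ a (Fin.last n).succ = a.2.1 + a.2.2 / 2 := fun a ↦ by simp [Φ]
  have hm : ∀ a i, Φ a (Fin.castSucc i).succ = e a.1 i := fun a i ↦ by simp [Φ]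
  refine ⟨Φ, fun a b ↦ ?_, by rw [h0]; norm_num⟩
  have hi : inner ℝ a.1 b.1 = ∑ i, e a.1 i * e b.1 i := by
    rw [← e.inner_map_map, PiLp.inner_apply]
    simp [mul_comm]
  rw [lorentz, Fin.sum_univ_castSucc]
  simp only [h0, hl, hm, hi]
  ring

/-- Adjoining `x` and `y` to ι gives an injective map between spaces of dimension n + 2, hence a
surjective one. Pairing with `y` and `x` reads off the coefficients of `x` and `y`, which vanish for
`z`. -/
theorem range_eq_of_isometric {n : ℕ} {V : Type*} [NormedAddCommGroup V] [InnerProductSpace ℝ V]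
    [FiniteDimensional ℝ V] (hV : Module.finrank ℝ V = n) {ι : V →ₗ[ℝ] LorentzSpace n}
    {x y : LorentzSpace n} (hι : ∀ v w, lorentz (ι v) (ι w) = inner ℝ v w)
    (hιx : ∀ v, lorentz (ι v) x = 0) (hιy : ∀ v, lorentz (ι v) y = 0) (hx : lorentz x x = 0)
    (hy : lorentz y y = 0) (hxy : lorentz x y = 1) :
    Set.range ι = {z | lorentz z x = 0 ∧ lorentz z y = 0} := by
  refine Set.Subset.antisymm (Set.range_subset_iff.2 fun v ↦ ⟨hιx v, hιy v⟩) ?_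
  rintro z ⟨hzx, hzy⟩
  let Φ : V × ℝ × ℝ →ₗ[ℝ] LorentzSpace n :=
    ι.coprod ((LinearMap.toSpanSingleton ℝ _ x).coprod (LinearMap.toSpanSingleton ℝ _ y))
  have hΦ : ∀ a, Φ a = ι a.1 + (a.2.1 • x + a.2.2 • y) := fun a ↦ rfl
  have hyx : lorentz y x = 1 := (lorentz_comm _ _).trans hxy
  have h1 : ∀ a, lorentz (Φ a) x = a.2.2 := fun a ↦ by
    rw [hΦ]; simp [lorentz_add_left, lorentz_smul_left, hιx, hx, hyx]
  have h2 : ∀ a, lorentz (Φ a) y = a.2.1 := fun a ↦ by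
    rw [hΦ]; simp [lorentz_add_left, lorentz_smul_left, hιy, hy, hxy]
  have hinj : Function.Injective Φ := by
    refine (injective_iff_map_eq_zero _).2 fun a ha ↦ ?_
    have h0 : ∀ w, lorentz (Φ a) w = 0 := fun w ↦ by
      rw [ha, ← lorentzBilin_apply, map_zero, LinearMap.zero_apply]
    have e₁ := h0 x
    have e₂ := h0 y
    rw [h1] at e₁
    rw [h2] at e₂
    have e₃ := h0 (ι a.1)
    rw [hΦ, e₁, e₂, zero_smul, zero_smul, add_zero, add_zero, hι, inner_self_eq_zero] at e₃
    exact Prod.ext e₃ (Prod.ext e₂ e₁)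
  have hsurj : Function.Surjective Φ :=
    (LinearMap.injective_iff_surjective_of_finrank_eq_finrank (by simp [hV])).1 hinj
  obtain ⟨a, rfl⟩ := hsurj z
  rw [h1] at hzx
  rw [h2] at hzy
  exact ⟨a.1, by rw [hΦ, hzx, hzy]; simp⟩

theorem pos_of_pos_of_ne_zero {M : Type*} [TopologicalSpace M] [PreconnectedSpace M] {f : M → ℝ}
    (hf : Continuous f) (h : ∀ p, f p ≠ 0) {p₀ : M} (h₀ : 0 < f p₀) (p : M) : 0 < f p := by
  by_contra! hp
  obtain ⟨q, hq⟩ := mem_range_of_exists_le_of_exists_ge hf ⟨p, hp⟩ ⟨p₀, h₀.le⟩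
  exact h q hq

variable {n : ℕ} {M : Type*} [TopologicalSpace M] [ChartedSpace (EuclideanSpace ℝ (Fin n)) M]
  [IsManifold (𝓡 n) ∞ M]
  {F : Type*} [NormedAddCommGroup F] [NormedSpace ℝ F]
  {E : M → Type*} [TopologicalSpace (TotalSpace F E)]
  [∀ p, NormedAddCommGroup (E p)] [∀ p, InnerProductSpace ℝ (E p)]
  [FiberBundle F E]
  [T2Space M] [FiniteDimensional ℝ F] [VectorBundle ℝ F E]
  [ContMDiffVectorBundle ∞ F E (𝓡 n)] [IsContMDiffRiemannianBundle (𝓡 n) ∞ F E]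
  {D : CovariantDerivative (𝓡 n) F E} {ξ ζ : Π p : M, TangentSpace (𝓡 n) p →L[ℝ] E p}

/-- The constant triples (0, 1, 0) and (0, 0, 1) have covariant derivatives (ξ, 0, 0) and (ζ, 0, 0),
so their images under the parallel isometry have differentials ξ and ζ. -/
theorem IsFrontalBundle.exists_realization [SimplyConnectedSpace M] (h : IsFrontalBundle D ξ ζ)
    (hG : SatisfiesCurvatureIdentity D ξ ζ) :
    ∃ x y : M → LorentzSpace n, IsSpacelikeFrontalWithDual x y ∧ IsRealizedBy D ξ ζ x y := by
  obtain ⟨p₀⟩ : Nonempty M := inferInstance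
  have hE : ∀ p : M, FiniteDimensional ℝ (E p) ∧ Module.finrank ℝ (E p) = n := by
    intro p
    let e := (trivializationAt F E p).continuousLinearEquivAt ℝ p
      (mem_baseSet_trivializationAt F E p)
    exact ⟨Module.Finite.equiv e.symm.toLinearEquiv,
      e.toLinearEquiv.finrank_eq.trans h.coherent_first.rank_eq⟩
  have := (hE p₀).1
  obtain ⟨Φ₀, hΦ₀, hpos⟩ := exists_isometric_initial (hE p₀).2
  obtain ⟨Φ, hΦp, hint, hiso⟩ := h.exists_isometric_intertwiner hG p₀ Φ₀ hΦ₀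
  let x : M → LorentzSpace n := fun p ↦ Φ p (0, 1, 0)
  let y : M → LorentzSpace n := fun p ↦ Φ p (0, 0, 1)
  let ι : Π p, E p →ₗ[ℝ] LorentzSpace n := fun p ↦ Φ p ∘ₗ LinearMap.inl ℝ (E p) (ℝ × ℝ)
  have hι : ∀ p v, ι p v = Φ p (v, 0, 0) := fun p v ↦ rfl
  have hsplit : ∀ p v a b, Φ p (v, a, b) = ι p v + a • x p + b • y p := by
    intro p v a b
    simp only [hι, x, y, ← map_smul, ← map_add]
    simp
  have h0 : IsSmoothSection n F (0 : Π p : M, E p) := contMDiff_zeroSection ℝ E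
  have hD0 : D (fun _ ↦ 0) = 0 := D.zero
  have hts : ∀ v : Π p, E p, IsSmoothSection n F v → ∀ a b : ℝ, ∀ q,
      IsSmoothTripleAt n F (fun p ↦ (v p, a, b)) q := fun v hv a b q ↦
    ⟨hv q, contMDiffAt_const, contMDiffAt_const⟩
  have hderiv : ∀ v : Π p, E p, IsSmoothSection n F v → ∀ p X,
      differential (fun q ↦ ι q (v q)) p X =
        Φ p (D v p X, -inner ℝ (v p) (ζ p X), -inner ℝ (v p) (ξ p X)) := by
    intro v hv p X
    refine ((hint p _ (hts v hv 0 0 p)).2 X).trans ?_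
    simp [tripleDeriv, mvfderiv_const]
  have hdx : ∀ p X, differential x p X = ι p (ξ p X) := by
    intro p X
    refine ((hint p _ (hts 0 h0 1 0 p)).2 X).trans ?_
    simp [tripleDeriv, mvfderiv_const, hD0, hι]
  have hdy : ∀ p X, differential y p X = ι p (ζ p X) := by
    intro p X
    refine ((hint p _ (hts 0 h0 0 1 p)).2 X).trans ?_
    simp [tripleDeriv, mvfderiv_const, hD0, hι]
  have hιι : ∀ p v w, lorentz (ι p v) (ι p w) = inner ℝ v w := fun p v w ↦ by
    rw [hι, hι, hiso]; simp [tripleForm]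
  have hιx : ∀ p v, lorentz (ι p v) (x p) = 0 := fun p v ↦ by
    rw [hι, hiso]; simp [tripleForm]
  have hιy : ∀ p v, lorentz (ι p v) (y p) = 0 := fun p v ↦ by
    rw [hι, hiso]; simp [tripleForm]
  have hxx : ∀ p, lorentz (x p) (x p) = 0 := fun p ↦ by rw [hiso]; simp [tripleForm]
  have hyy : ∀ p, lorentz (y p) (y p) = 0 := fun p ↦ by rw [hiso]; simp [tripleForm]
  have hxy : ∀ p, lorentz (x p) (y p) = 1 := fun p ↦ by rw [hiso]; simp [tripleForm]
  have hxs : ContMDiff (𝓡 n) 𝓘(ℝ, LorentzSpace n) ∞ x := fun p ↦ (hint p _ (hts 0 h0 1 0 p)).1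
  have hys : ContMDiff (𝓡 n) 𝓘(ℝ, LorentzSpace n) ∞ y := fun p ↦ (hint p _ (hts 0 h0 0 1 p)).1
  -- A zero of x⁰ would make the null vector `x` vanish, against ⟨x, y⟩ = 1; so x⁰ keeps the sign it
  -- has at `p₀`.
  have hx0 : ∀ p, 0 < x p 0 := by
    refine pos_of_pos_of_ne_zero ((continuous_apply 0).comp hxs.continuous) (fun p hp ↦ ?_)
      (p₀ := p₀) (by simpa [x, hΦp] using hpos)
    have h1 := hxy p
    rw [eq_zero_of_lorentz_self_eq_zero (hxx p) hp] at h1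
    simp [lorentz] at h1
  have hy0 : ∀ p, y p 0 < 0 := by
    intro p
    by_contra! hp
    have := lorentz_nonpos_of_null (hxx p) (hyy p) (mul_nonneg (hx0 p).le hp)
    linarith [hxy p]
  refine ⟨x, y, ⟨hxs, hys, fun p ↦ ⟨hxx p, hx0 p⟩, fun p ↦ ⟨hyy p, hy0 p⟩, hxy,
    fun p X ↦ by rw [hdx, hιy], fun p X ↦ by rw [hdy, hιx]⟩,
    ⟨ι, fun v hv p ↦ (hint p _ (hts v hv 0 0 p)).1, hιι, fun p ↦ ?_, fun p X ↦ (hdx p X).symm,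
      fun p X ↦ (hdy p X).symm, fun v hv p X ↦ ?_⟩,
    fun p X Y ↦ by rw [hdx, hdx, hιι]; rfl, fun p X Y ↦ by rw [hdx, hdy, hιι]; rfl,
    fun p X Y ↦ by rw [hdy, hdy, hιι]; rfl⟩
  · have := (hE p).1
    exact range_eq_of_isometric (hE p).2 (hιι p) (hιx p) (hιy p) (hxx p) (hyy p) (hxy p)
  -- The scalar components of the derivative are its coefficients along `x` and `y`, which the
  -- tangential part removes.
  · rw [hderiv v hv, tangentialPart, hiso, hiso, hsplit]
    simp [tripleForm]
    abel

end Realization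

/-! ### Smoothness of bundle homomorphisms and of Lorentzian products -/

section SmoothnessCriteria

open Filter Topology

variable {n : ℕ} {M : Type*} [TopologicalSpace M] [ChartedSpace (EuclideanSpace ℝ (Fin n)) M]

theorem contMDiffAt_clm_of_apply {F₁ F₂ : Type*} [NormedAddCommGroup F₁] [NormedSpace ℝ F₁]
    [FiniteDimensional ℝ F₁] [NormedAddCommGroup F₂] [NormedSpace ℝ F₂] {T : M → F₁ →L[ℝ] F₂}
    {p : M} (h : ∀ v, ContMDiffAt (𝓡 n) 𝓘(ℝ, F₂) ∞ (fun q ↦ T q v) p) :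
    ContMDiffAt (𝓡 n) 𝓘(ℝ, F₁ →L[ℝ] F₂) ∞ T p := by
  let b := Module.finBasis ℝ F₁
  let l (k) : F₁ →L[ℝ] ℝ := LinearMap.toContinuousLinearMap (b.coord k)
  let L (k) : F₂ →L[ℝ] F₁ →L[ℝ] F₂ := ContinuousLinearMap.smulRightL ℝ F₁ F₂ (l k)
  have hT : T = fun q ↦ ∑ k, L k (T q (b k)) := by
    funext q
    ext v
    have : T q v = T q (∑ k, b.coord k v • b k) := by
      congr 1
      exact (b.sum_repr v).symm
    rw [this, map_sum, sum_apply]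
    simp [L, l]
  rw [hT]
  exact contMDiffAt_finsetSum fun k _ ↦ (L k).contMDiff.contMDiffAt.comp p (h (b k))

theorem contDiff_lorentz : ContDiff ℝ ∞ fun z : LorentzSpace n × LorentzSpace n ↦
    lorentz z.1 z.2 := by
  unfold lorentz
  fun_prop

theorem ContMDiffAt.lorentz {f g : M → LorentzSpace n} {p : M}
    (hf : ContMDiffAt (𝓡 n) 𝓘(ℝ, LorentzSpace n) ∞ f p)
    (hg : ContMDiffAt (𝓡 n) 𝓘(ℝ, LorentzSpace n) ∞ g p) :
    ContMDiffAt (𝓡 n) 𝓘(ℝ, ℝ) ∞ (fun q ↦ lorentz (f q) (g q)) p :=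
  contDiff_lorentz.contMDiff.contMDiffAt.comp p (hf.prodMk_space hg)

variable [IsManifold (𝓡 n) ∞ M]

/-- A homomorphism of vector bundles is smooth if it maps smooth sections to smooth sections. -/
theorem contMDiff_hom_of_apply [T2Space M] {F₁ F₂ : Type*} [NormedAddCommGroup F₁] [NormedSpace ℝ F₁]
    [FiniteDimensional ℝ F₁] [NormedAddCommGroup F₂] [NormedSpace ℝ F₂]
    {E₁ : M → Type*} [TopologicalSpace (TotalSpace F₁ E₁)]
    [∀ p, AddCommGroup (E₁ p)] [∀ p, Module ℝ (E₁ p)] [∀ p, TopologicalSpace (E₁ p)]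
    [FiberBundle F₁ E₁] [VectorBundle ℝ F₁ E₁] [ContMDiffVectorBundle ∞ F₁ E₁ (𝓡 n)]
    {E₂ : M → Type*} [TopologicalSpace (TotalSpace F₂ E₂)]
    [∀ p, AddCommGroup (E₂ p)] [∀ p, Module ℝ (E₂ p)] [∀ p, TopologicalSpace (E₂ p)]
    [∀ p, IsTopologicalAddGroup (E₂ p)] [∀ p, ContinuousSMul ℝ (E₂ p)]
    [FiberBundle F₂ E₂] [VectorBundle ℝ F₂ E₂] [ContMDiffVectorBundle ∞ F₂ E₂ (𝓡 n)]
    {φ : Π p, E₁ p →L[ℝ] E₂ p}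
    (h : ∀ σ : Π p, E₁ p,
      ContMDiff (𝓡 n) ((𝓡 n).prod 𝓘(ℝ, F₁)) ∞ (fun p ↦ (⟨p, σ p⟩ : TotalSpace F₁ E₁)) →
      ContMDiff (𝓡 n) ((𝓡 n).prod 𝓘(ℝ, F₂)) ∞ (fun p ↦ (⟨p, φ p (σ p)⟩ : TotalSpace F₂ E₂))) :
    ContMDiff (𝓡 n) ((𝓡 n).prod 𝓘(ℝ, F₁ →L[ℝ] F₂)) ∞
      (fun p ↦ TotalSpace.mk' (F₁ →L[ℝ] F₂) (E := fun p ↦ E₁ p →L[ℝ] E₂ p) p (φ p)) := by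
  intro p
  refine (contMDiffAt_hom_bundle _).2 ⟨contMDiffAt_id, contMDiffAt_clm_of_apply fun v ↦ ?_⟩
  obtain ⟨N, S, hp, hN, hS⟩ := exists_smoothFrame (n := n) F₁ (E := E₁) p
  have hp₂ := mem_baseSet_trivializationAt F₂ E₂ p
  have h1 := ((trivializationAt F₂ E₂ p).contMDiffAt_section_iff hp₂).1 (h _ (hS.smooth v) p)
  refine h1.congr_of_eventuallyEq ?_
  filter_upwards [hS.isOpen.mem_nhds hp, (trivializationAt F₂ E₂ p).open_baseSet.mem_nhds hp₂]
    with q hq hq₂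
  -- On `N` the bump function has no effect, so the global sections `S v` are the constant sections
  -- of the trivialization.
  have h2 : (trivializationAt F₁ E₁ p).symm q v = S v q := by
    have e := hS.coord_frame q hq v
    rw [← (trivializationAt F₁ E₁ p).symmₗ_apply (R := ℝ) (hN hq), ← e]
    rw [hS.coord_frame q hq v]
    conv_lhs => rw [← e]
    exact (trivializationAt F₁ E₁ p).symmₗ_linearMapAt (hN hq) _
  simp only [ContinuousLinearMap.inCoordinates_eq (hN hq) hq₂]
  change (trivializationAt F₂ E₂ p ⟨q, φ q ((trivializationAt F₁ E₁ p).symm q v)⟩).2 = _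
  rw [h2]

theorem contMDiff_mvfderiv_apply {G : Type*} [NormedAddCommGroup G] [NormedSpace ℝ G] {f : M → G}
    (hf : ContMDiff (𝓡 n) 𝓘(ℝ, G) ∞ f) {X : Π p : M, TangentSpace (𝓡 n) p}
    (hX : IsSmoothVectorField X) :
    ContMDiff (𝓡 n) 𝓘(ℝ, G) ∞ (fun q ↦ mvfderiv (𝓡 n) f q (X q)) := by
  intro p
  set φ := extChartAt (𝓡 n) p with hφ
  have hp := mem_extChartAt_source (I := 𝓡 n) p
  have hs := (isOpen_extChartAt_target (I := 𝓡 n) p).mem_nhds (mem_extChartAt_target p)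
  have h1 : ContDiffAt ℝ ∞ (f ∘ φ.symm) (φ p) := by
    have := (contDiffOn_comp_extChartAt_symm (p₀ := p) (hf.contMDiffOn (s := Set.univ)))
    rw [Set.preimage_univ, Set.inter_univ] at this
    exact this.contDiffAt hs
  have h2 : ContDiffAt ℝ ∞ (fderiv ℝ (f ∘ φ.symm)) (φ p) := h1.fderiv_right le_rfl
  have h3 : ContMDiffAt (𝓡 n) 𝓘(ℝ, EuclideanSpace ℝ (Fin n)) ∞
      (fun q ↦ mvfderiv (𝓡 n) φ q (X q)) p := by
    have hb := mem_baseSet_trivializationAt (EuclideanSpace ℝ (Fin n))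
      (TangentSpace (𝓡 n) : M → Type _) p
    have h4 := ((trivializationAt (EuclideanSpace ℝ (Fin n))
      (TangentSpace (𝓡 n) : M → Type _) p).contMDiffAt_section_iff hb).1 (hX p)
    refine h4.congr_of_eventuallyEq ?_
    filter_upwards [eventually_mem_extChartAt_source hp] with q hq
    have h5 := TangentBundle.continuousLinearMapAt_trivializationAt (I := 𝓡 n) (x₀ := p) (x := q)
      (by simpa using hq)
    have h6 := congrFun ((trivializationAt (EuclideanSpace ℝ (Fin n))
      (TangentSpace (𝓡 n) : M → Type _) p).coe_linearMapAt_of_mem (R := ℝ) (b := q)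
        (by simpa [hφ] using hq)) (X q)
    exact (congrArg (fun T : TangentSpace (𝓡 n) q →L[ℝ] EuclideanSpace ℝ (Fin n) ↦ T (X q))
      h5).symm.trans h6
  refine ((h2.contMDiffAt.comp p (contMDiffAt_extChartAt' (by simp))).clm_apply
    h3).congr_of_eventuallyEq ?_
  filter_upwards [eventually_mem_extChartAt_source hp] with q hq
  exact mvfderiv_eq_fderiv_comp_symm ((hf q).mdifferentiableAt (by simp)) hq (X q)

theorem mvfderiv_lorentz {f g : M → LorentzSpace n} {p : M}
    (hf : MDifferentiableAt (𝓡 n) 𝓘(ℝ, LorentzSpace n) f p)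
    (hg : MDifferentiableAt (𝓡 n) 𝓘(ℝ, LorentzSpace n) g p) (X : TangentSpace (𝓡 n) p) :
    MDifferentiableAt (𝓡 n) 𝓘(ℝ, ℝ) (fun q ↦ lorentz (f q) (g q)) p ∧
    mvfderiv (𝓡 n) (fun q ↦ lorentz (f q) (g q)) p X =
      lorentz (mvfderiv (𝓡 n) f p X) (g p) + lorentz (f p) (mvfderiv (𝓡 n) g p X) := by
  let B : LorentzSpace n →L[ℝ] LorentzSpace n →L[ℝ] ℝ :=
    LinearMap.toContinuousLinearMap (LinearMap.toContinuousLinearMap.toLinearMap ∘ₗ lorentzBilin n)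
  have hB := (B.hasFDerivAt_of_bilinear (hasFDerivAt_fst (𝕜 := ℝ) (p := (f p, g p)))
    (hasFDerivAt_snd (𝕜 := ℝ) (p := (f p, g p)))).hasMFDerivAt
  have h1 := hB.comp p (hasMFDerivAt_prodMk_space hf.hasMFDerivAt hg.hasMFDerivAt)
  refine ⟨h1.mdifferentiableAt, ?_⟩
  refine (congrArg (fun T : TangentSpace (𝓡 n) p →L[ℝ] ℝ ↦ T X) h1.mfderiv).trans ?_
  exact add_comm _ _

end SmoothnessCriteria

/-! ### Isometric frames of {x, y}^⊥ at a point -/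

section ScreenIsometry

variable {n : ℕ}

/-- `ι` is an isometry of Euclidean space onto `{x, y}^⊥`, where `x`, `y` are null vectors with
`⟨x, y⟩ = 1`. -/
structure IsScreenIsometry (x y : LorentzSpace n)
    (ι : EuclideanSpace ℝ (Fin n) →ₗ[ℝ] LorentzSpace n) : Prop where
  null_fst : lorentz x x = 0
  null_snd : lorentz y y = 0
  pairing : lorentz x y = 1
  isometric : ∀ v w, lorentz (ι v) (ι w) = inner ℝ v w
  orthogonal_fst : ∀ v, lorentz (ι v) x = 0
  orthogonal_snd : ∀ v, lorentz (ι v) y = 0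

/-- The adjoint of a linear map from Euclidean space to `L^{n+2}`. -/
def lorentzAdjoint (ι : EuclideanSpace ℝ (Fin n) →ₗ[ℝ] LorentzSpace n) :
    LorentzSpace n →ₗ[ℝ] EuclideanSpace ℝ (Fin n) where
  toFun z := WithLp.toLp 2 fun k ↦ lorentz z (ι (EuclideanSpace.single k 1))
  map_add' z w := by ext k; simp [lorentz_add_left]
  map_smul' c z := by ext k; simp [lorentz_smul_left]

theorem inner_lorentzAdjoint (ι : EuclideanSpace ℝ (Fin n) →ₗ[ℝ] LorentzSpace n)
    (v : EuclideanSpace ℝ (Fin n)) (z : LorentzSpace n) :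
    inner ℝ v (lorentzAdjoint ι z) = lorentz z (ι v) := by
  have h1 : v = ∑ k, v k • EuclideanSpace.single k (1 : ℝ) := by
    ext i
    simp [Pi.single_apply]
  have h2 : lorentz z (ι v) = ∑ k, v k * lorentz z (ι (EuclideanSpace.single k 1)) := by
    conv_lhs => rw [h1, ← lorentzBilin_apply, map_sum, map_sum]
    simp
  rw [h2, PiLp.inner_apply]
  simp [lorentzAdjoint, mul_comm]

/-- The projection onto `{x, y}^⊥` as a linear map. -/
def tangentialPartₗ (x y : LorentzSpace n) : LorentzSpace n →ₗ[ℝ] LorentzSpace n :=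
  LinearMap.id - (LinearMap.toSpanSingleton ℝ _ x) ∘ₗ (lorentzBilin n).flip y -
    (LinearMap.toSpanSingleton ℝ _ y) ∘ₗ (lorentzBilin n).flip x

theorem tangentialPartₗ_apply (x y z : LorentzSpace n) :
    tangentialPartₗ x y z = tangentialPart x y z := rfl

namespace IsScreenIsometry

variable {x y : LorentzSpace n} {ι : EuclideanSpace ℝ (Fin n) →ₗ[ℝ] LorentzSpace n}

theorem adjoint_apply (h : IsScreenIsometry x y ι) (v : EuclideanSpace ℝ (Fin n)) :
    lorentzAdjoint ι (ι v) = v :=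
  ext_inner_left ℝ fun w ↦ by rw [inner_lorentzAdjoint, h.isometric, real_inner_comm]

theorem injective (h : IsScreenIsometry x y ι) : Function.Injective ι :=
  Function.LeftInverse.injective h.adjoint_apply

theorem tangentialPart_eq_self (h : IsScreenIsometry x y ι) (v : EuclideanSpace ℝ (Fin n)) :
    tangentialPart x y (ι v) = ι v := by
  simp [tangentialPart, h.orthogonal_fst, h.orthogonal_snd]

theorem range_eq (h : IsScreenIsometry x y ι) :
    Set.range ι = {z | lorentz z x = 0 ∧ lorentz z y = 0} :=
  range_eq_of_isometric (by simp) h.isometric h.orthogonal_fst h.orthogonal_snd h.null_fst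
    h.null_snd h.pairing

/-- The adjoint of an isometry onto {x, y}^⊥ is a left inverse that ignores the `x` and `y`
components, so the composite is the orthogonal projection. -/
theorem apply_adjoint (h : IsScreenIsometry x y ι) (z : LorentzSpace n) :
    ι (lorentzAdjoint ι z) = tangentialPart x y z := by
  have hyx : lorentz y x = 1 := (lorentz_comm _ _).trans h.pairing
  obtain ⟨v, hv⟩ : tangentialPart x y z ∈ Set.range ι := by
    rw [h.range_eq]
    constructor <;>
    simp [tangentialPart, lorentz_sub_left, lorentz_smul_left, h.null_fst, h.null_snd, h.pairing,
      hyx]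
  rw [← hv]
  congr 1
  refine ext_inner_left ℝ fun w ↦ ?_
  have h1 : lorentz x (ι w) = 0 := (lorentz_comm _ _).trans (h.orthogonal_fst w)
  have h2 : lorentz y (ι w) = 0 := (lorentz_comm _ _).trans (h.orthogonal_snd w)
  rw [inner_lorentzAdjoint, real_inner_comm, ← h.isometric, hv]
  simp [tangentialPart, lorentz_sub_left, lorentz_smul_left, h1, h2]

theorem lorentz_tangentialPart (h : IsScreenIsometry x y ι) (z : LorentzSpace n)
    (v : EuclideanSpace ℝ (Fin n)) : lorentz (tangentialPart x y z) (ι v) = lorentz z (ι v) := by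
  rw [← h.apply_adjoint, h.isometric, real_inner_comm, inner_lorentzAdjoint]

end IsScreenIsometry

/-- The null vector `(-1, 0, …, 0, ±1)`. -/
def lightPole (n : ℕ) (b : Bool) : LorentzSpace n :=
  Fin.cons (-1) (Fin.snoc 0 (cond b 1 (-1)) : Fin (n + 1) → ℝ)

/-- The inclusion `v ↦ (0, v, 0)`. -/
def equator (n : ℕ) : EuclideanSpace ℝ (Fin n) →ₗ[ℝ] LorentzSpace n where
  toFun v := Fin.cons 0 (Fin.snoc (fun i ↦ v i) 0 : Fin (n + 1) → ℝ)
  map_add' v w := by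
    ext i
    refine Fin.cases (by simp) (fun j ↦ ?_) i
    refine Fin.lastCases (by simp) (fun k ↦ by simp) j
  map_smul' c v := by
    ext i
    refine Fin.cases (by simp) (fun j ↦ ?_) i
    refine Fin.lastCases (by simp) (fun k ↦ by simp) j

theorem lorentz_lightPole (b : Bool) (z : LorentzSpace n) :
    lorentz (lightPole n b) z = z 0 + cond b 1 (-1) * z (Fin.last n).succ := by
  simp [lorentz, lightPole, Fin.sum_univ_castSucc]

theorem lorentz_lightPole_self (b : Bool) : lorentz (lightPole n b) (lightPole n b) = 0 := by
  rw [lorentz_lightPole]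
  cases b <;> simp [lightPole]

theorem lorentz_equator_lightPole (v : EuclideanSpace ℝ (Fin n)) (b : Bool) :
    lorentz (equator n v) (lightPole n b) = 0 := by
  rw [lorentz_comm, lorentz_lightPole]
  simp [equator]

theorem lorentz_equator (v w : EuclideanSpace ℝ (Fin n)) :
    lorentz (equator n v) (equator n w) = inner ℝ v w := by
  rw [PiLp.inner_apply]
  simp [lorentz, equator, Fin.sum_univ_castSucc, mul_comm]

/-- The two products are z⁰ ± z^{n+1}; if both vanished, so would z⁰. Hence the two frames cover all
base points. -/
theorem exists_lorentz_lightPole_ne_zero {x : LorentzSpace n} (hx : x ∈ upperLightcone n) :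
    ∃ b, lorentz (lightPole n b) x ≠ 0 := by
  by_contra! h
  have h1 := h true
  have h2 := h false
  rw [lorentz_lightPole] at h1 h2
  have := hx.2
  simp at h1 h2
  linarith

/-- An isometric frame of `{x, y}^⊥`, defined where `x` is not orthogonal to the pole. -/
def coneFrame (b : Bool) (x y : LorentzSpace n) :
    EuclideanSpace ℝ (Fin n) →ₗ[ℝ] LorentzSpace n :=
  (LinearMap.id - LinearMap.toSpanSingleton ℝ _ x ∘ₗ (lorentzBilin n).flip y) ∘ₗ
    (LinearMap.id - LinearMap.toSpanSingleton ℝ _ (lightPole n b) ∘ₗ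
      ((lorentz (lightPole n b) x)⁻¹ • (lorentzBilin n).flip x)) ∘ₗ equator n

theorem coneFrame_apply (b : Bool) (x y : LorentzSpace n) (v : EuclideanSpace ℝ (Fin n)) :
    coneFrame b x y v = (equator n v -
      ((lorentz (lightPole n b) x)⁻¹ * lorentz (equator n v) x) • lightPole n b) -
      lorentz (equator n v - ((lorentz (lightPole n b) x)⁻¹ * lorentz (equator n v) x) •
        lightPole n b) y • x := rfl

/-- Subtracting multiples of the pole makes the equator orthogonal to `x`; the pole is null and
orthogonal to the equator, so products are unchanged. Subtracting multiples of the null vector `x`,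
now orthogonal to everything in sight, achieves orthogonality to `y` at no cost. -/
theorem isScreenIsometry_coneFrame {b : Bool} {x y : LorentzSpace n} (hx : lorentz x x = 0)
    (hy : lorentz y y = 0) (hxy : lorentz x y = 1) (hb : lorentz (lightPole n b) x ≠ 0) :
    IsScreenIsometry x y (coneFrame b x y) := by
  set A : EuclideanSpace ℝ (Fin n) → LorentzSpace n := fun v ↦ equator n v -
      ((lorentz (lightPole n b) x)⁻¹ * lorentz (equator n v) x) • lightPole n b with hA
  have hf : ∀ v, coneFrame b x y v = A v - lorentz (A v) y • x := coneFrame_apply b x y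
  have hAx : ∀ v, lorentz (A v) x = 0 := fun v ↦ by
    simp only [hA, lorentz_sub_left, lorentz_smul_left]
    field_simp
    ring
  have hxA : ∀ v, lorentz x (A v) = 0 := fun v ↦ (lorentz_comm _ _).trans (hAx v)
  have hAA : ∀ v w, lorentz (A v) (A w) = inner ℝ v w := fun v w ↦ by
    simp only [hA, lorentz_sub_left, lorentz_smul_left, lorentz_sub_right, lorentz_smul_right,
      lorentz_equator, lorentz_equator_lightPole, lorentz_lightPole_self,
      lorentz_comm (lightPole n b) (equator n w)]
    ring
  refine ⟨hx, hy, hxy, fun v w ↦ ?_, fun v ↦ ?_, fun v ↦ ?_⟩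
  · simp [hf, lorentz_sub_left, lorentz_smul_left, lorentz_sub_right, lorentz_smul_right, hAx, hxA,
      hAA, hx]
  · simp [hf, lorentz_sub_left, lorentz_smul_left, hAx, hx]
  · simp [hf, lorentz_sub_left, lorentz_smul_left, hxy]

end ScreenIsometry

/-! ### The vector bundle {x, y}^⊥, its metric and its connection -/

section ScreenBundle

open Filter Topology

variable {n : ℕ} {M : Type*} [TopologicalSpace M] [ChartedSpace (EuclideanSpace ℝ (Fin n)) M]
  {x y : M → LorentzSpace n}

theorem contMDiffAt_coneFrame {b : Bool} {p : M}
    (hx : ContMDiffAt (𝓡 n) 𝓘(ℝ, LorentzSpace n) ∞ x p)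
    (hy : ContMDiffAt (𝓡 n) 𝓘(ℝ, LorentzSpace n) ∞ y p) (hb : lorentz (lightPole n b) (x p) ≠ 0)
    (v : EuclideanSpace ℝ (Fin n)) :
    ContMDiffAt (𝓡 n) 𝓘(ℝ, LorentzSpace n) ∞ (fun q ↦ coneFrame b (x q) (y q) v) p := by
  have h1 : ContMDiffAt (𝓡 n) 𝓘(ℝ, LorentzSpace n) ∞ (fun q ↦ equator n v -
      ((lorentz (lightPole n b) (x q))⁻¹ * lorentz (equator n v) (x q)) • lightPole n b) p :=
    contMDiffAt_const.sub ((((contMDiffAt_const.lorentz hx).inv₀ hb).mul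
      (contMDiffAt_const.lorentz hx)).smul contMDiffAt_const)
  exact h1.sub ((h1.lorentz hy).smul hx)

theorem lorentzAdjoint_eq_sum (ι : EuclideanSpace ℝ (Fin n) →ₗ[ℝ] LorentzSpace n)
    (z : LorentzSpace n) : lorentzAdjoint ι z =
      ∑ k, lorentz z (ι (EuclideanSpace.single k 1)) • EuclideanSpace.single k (1 : ℝ) := by
  ext i
  simp [lorentzAdjoint, Pi.single_apply]

theorem contMDiffAt_lorentzAdjoint {ι : M → EuclideanSpace ℝ (Fin n) →ₗ[ℝ] LorentzSpace n}
    {z : M → LorentzSpace n} {p : M}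
    (hι : ∀ v, ContMDiffAt (𝓡 n) 𝓘(ℝ, LorentzSpace n) ∞ (fun q ↦ ι q v) p)
    (hz : ContMDiffAt (𝓡 n) 𝓘(ℝ, LorentzSpace n) ∞ z p) :
    ContMDiffAt (𝓡 n) 𝓘(ℝ, EuclideanSpace ℝ (Fin n)) ∞ (fun q ↦ lorentzAdjoint (ι q) (z q)) p := by
  simp only [lorentzAdjoint_eq_sum]
  exact contMDiffAt_finsetSum fun k _ ↦ (hz.lorentz (hι _)).smul contMDiffAt_const

namespace IsSpacelikeFrontalWithDual

/-- The domain of the frame `coneFrame b` along a spacelike frontal. -/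
def frameDomain (x : M → LorentzSpace n) (b : Bool) : Set M :=
  {p | lorentz (lightPole n b) (x p) ≠ 0}

theorem isScreenIsometry (h : IsSpacelikeFrontalWithDual x y) {b : Bool} {p : M}
    (hp : p ∈ frameDomain x b) : IsScreenIsometry (x p) (y p) (coneFrame b (x p) (y p)) :=
  isScreenIsometry_coneFrame (h.fst_mem p).1 (h.snd_mem p).1 (h.pairing p) hp

theorem contMDiffAt_frame (h : IsSpacelikeFrontalWithDual x y) {b : Bool} {p : M}
    (hp : p ∈ frameDomain x b) (v : EuclideanSpace ℝ (Fin n)) :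
    ContMDiffAt (𝓡 n) 𝓘(ℝ, LorentzSpace n) ∞ (fun q ↦ coneFrame b (x q) (y q) v) p :=
  contMDiffAt_coneFrame (h.smooth_fst p) (h.smooth_snd p) hp v

theorem isOpen_frameDomain (h : IsSpacelikeFrontalWithDual x y) (b : Bool) :
    IsOpen (frameDomain x b) := by
  have : Continuous fun p ↦ lorentz (lightPole n b) (x p) :=
    contDiff_lorentz.continuous.comp ((continuous_const (y := lightPole n b)).prodMk h.smooth_fst.continuous)
  exact isOpen_ne_fun this continuous_const

/-- A pole whose frame is defined at `p`. -/
def frameIndex (h : IsSpacelikeFrontalWithDual x y) (p : M) : Bool :=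
  (exists_lorentz_lightPole_ne_zero (h.fst_mem p)).choose

theorem mem_frameDomain_frameIndex (h : IsSpacelikeFrontalWithDual x y) (p : M) :
    p ∈ frameDomain x (h.frameIndex p) :=
  (exists_lorentz_lightPole_ne_zero (h.fst_mem p)).choose_spec

/-- The transition functions between the isometric frames of `{x, y}^⊥`. -/
def frameChange (x y : M → LorentzSpace n) (b b' : Bool) (p : M) :
    EuclideanSpace ℝ (Fin n) →L[ℝ] EuclideanSpace ℝ (Fin n) :=
  LinearMap.toContinuousLinearMap
    (lorentzAdjoint (coneFrame b' (x p) (y p)) ∘ₗ coneFrame b (x p) (y p))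

theorem coneFrame_frameChange (h : IsSpacelikeFrontalWithDual x y) {b b' : Bool} {p : M}
    (hp : p ∈ frameDomain x b) (hp' : p ∈ frameDomain x b') (v : EuclideanSpace ℝ (Fin n)) :
    coneFrame b' (x p) (y p) (frameChange x y b b' p v) = coneFrame b (x p) (y p) v :=
  ((h.isScreenIsometry hp').apply_adjoint _).trans ((h.isScreenIsometry hp).tangentialPart_eq_self v)

theorem contMDiffAt_frameChange (h : IsSpacelikeFrontalWithDual x y) {b b' : Bool} {p : M}
    (hp : p ∈ frameDomain x b) (hp' : p ∈ frameDomain x b') :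
    ContMDiffAt (𝓡 n) 𝓘(ℝ, EuclideanSpace ℝ (Fin n) →L[ℝ] EuclideanSpace ℝ (Fin n)) ∞
      (frameChange x y b b') p :=
  contMDiffAt_clm_of_apply fun v ↦
    contMDiffAt_lorentzAdjoint (h.contMDiffAt_frame hp') (h.contMDiffAt_frame hp v)

/-- The bundle `{x, y}^⊥`, glued from trivial bundles along isometric frames. -/
def screenCore (h : IsSpacelikeFrontalWithDual x y) :
    VectorBundleCore ℝ M (EuclideanSpace ℝ (Fin n)) Bool where
  baseSet := frameDomain x
  isOpen_baseSet := h.isOpen_frameDomain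
  indexAt := h.frameIndex
  mem_baseSet_at := h.mem_frameDomain_frameIndex
  coordChange := frameChange x y
  coordChange_self b p hp v := (h.isScreenIsometry hp).adjoint_apply v
  continuousOn_coordChange b b' p hp :=
    (h.contMDiffAt_frameChange hp.1 hp.2).continuousAt.continuousWithinAt
  coordChange_comp b b' b'' p hp v := (h.isScreenIsometry hp.2).injective (by
    rw [h.coneFrame_frameChange hp.1.2 hp.2, h.coneFrame_frameChange hp.1.1 hp.1.2,
      h.coneFrame_frameChange hp.1.1 hp.2])

instance (h : IsSpacelikeFrontalWithDual x y) : h.screenCore.IsContMDiff (𝓡 n) ∞ where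
  contMDiffOn_coordChange _ _ _ hp := (h.contMDiffAt_frameChange hp.1 hp.2).contMDiffWithinAt

/-- The fibres of the bundle `{x, y}^⊥`, identified isometrically with Euclidean space. -/
def ScreenFiber (_ : IsSpacelikeFrontalWithDual x y) (_ : M) : Type := EuclideanSpace ℝ (Fin n)

variable (h : IsSpacelikeFrontalWithDual x y)

instance (p : M) : NormedAddCommGroup (h.ScreenFiber p) :=
  inferInstanceAs (NormedAddCommGroup (EuclideanSpace ℝ (Fin n)))

instance (p : M) : InnerProductSpace ℝ (h.ScreenFiber p) :=
  inferInstanceAs (InnerProductSpace ℝ (EuclideanSpace ℝ (Fin n)))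

instance : TopologicalSpace (TotalSpace (EuclideanSpace ℝ (Fin n)) h.ScreenFiber) :=
  h.screenCore.toTopologicalSpace

instance : FiberBundle (EuclideanSpace ℝ (Fin n)) h.ScreenFiber := h.screenCore.fiberBundle

instance : VectorBundle ℝ (EuclideanSpace ℝ (Fin n)) h.ScreenFiber := h.screenCore.vectorBundle

instance : ContMDiffVectorBundle ∞ (EuclideanSpace ℝ (Fin n)) h.ScreenFiber (𝓡 n) :=
  h.screenCore.instContMDiffVectorBundle (IB := 𝓡 n) (n := ∞)

/-- The inclusion of the bundle `{x, y}^⊥` into `M × L^{n+2}`. -/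
def inclusion (p : M) : h.ScreenFiber p →ₗ[ℝ] LorentzSpace n :=
  coneFrame (h.frameIndex p) (x p) (y p)

/-- The projection from `M × L^{n+2}` to the bundle `{x, y}^⊥`. -/
def projection (p : M) : LorentzSpace n →L[ℝ] h.ScreenFiber p :=
  LinearMap.toContinuousLinearMap (lorentzAdjoint (coneFrame (h.frameIndex p) (x p) (y p)))

theorem trivializationAt_apply (p q : M) (v : h.ScreenFiber q) :
    (trivializationAt (EuclideanSpace ℝ (Fin n)) h.ScreenFiber p ⟨q, v⟩).2 =
      lorentzAdjoint (coneFrame (h.frameIndex p) (x q) (y q)) (h.inclusion q v) := rfl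

theorem isScreenIsometry_inclusion (p : M) :
    IsScreenIsometry (x p) (y p) (h.inclusion p) :=
  h.isScreenIsometry (h.mem_frameDomain_frameIndex p)

theorem inclusion_eventuallyEq (σ : Π p, h.ScreenFiber p) (p : M) :
    (fun q ↦ h.inclusion q (σ q)) =ᶠ[𝓝 p] fun q ↦
      LinearMap.toContinuousLinearMap (coneFrame (h.frameIndex p) (x q) (y q))
        (trivializationAt (EuclideanSpace ℝ (Fin n)) h.ScreenFiber p ⟨q, σ q⟩).2 := by
  filter_upwards [(h.isOpen_frameDomain _).mem_nhds (h.mem_frameDomain_frameIndex p)] with q hq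
  rw [trivializationAt_apply]
  exact (((h.isScreenIsometry hq).apply_adjoint _).trans
    ((h.isScreenIsometry_inclusion q).tangentialPart_eq_self (σ q))).symm

/-- The frames and their adjoints depend smoothly on the point, so smoothness can be tested after
inclusion. All later smoothness claims thereby concern maps into L^{n+2}. -/
theorem contMDiffAt_section_iff (σ : Π p, h.ScreenFiber p) (p : M) :
    ContMDiffAt (𝓡 n) ((𝓡 n).prod 𝓘(ℝ, EuclideanSpace ℝ (Fin n))) ∞
      (fun q ↦ (⟨q, σ q⟩ : TotalSpace (EuclideanSpace ℝ (Fin n)) h.ScreenFiber)) p ↔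
    ContMDiffAt (𝓡 n) 𝓘(ℝ, LorentzSpace n) ∞ (fun q ↦ h.inclusion q (σ q)) p := by
  have hp := h.mem_frameDomain_frameIndex p
  rw [(trivializationAt (EuclideanSpace ℝ (Fin n)) h.ScreenFiber p).contMDiffAt_section_iff
    (mem_baseSet_trivializationAt _ _ p)]
  refine ⟨fun hσ ↦ ?_, fun hσ ↦ contMDiffAt_lorentzAdjoint (h.contMDiffAt_frame hp) hσ⟩
  exact ((contMDiffAt_clm_of_apply (h.contMDiffAt_frame hp)).clm_apply
    hσ).congr_of_eventuallyEq (h.inclusion_eventuallyEq σ p)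

/-- The axioms of a covariant derivative concern sections that are merely differentiable at a point,
so smoothness is not enough here. -/
theorem mdifferentiableAt_inclusion {σ : Π p, h.ScreenFiber p} {p : M}
    (hσ : MDifferentiableAt (𝓡 n) ((𝓡 n).prod 𝓘(ℝ, EuclideanSpace ℝ (Fin n)))
      (fun q ↦ (⟨q, σ q⟩ : TotalSpace (EuclideanSpace ℝ (Fin n)) h.ScreenFiber)) p) :
    MDifferentiableAt (𝓡 n) 𝓘(ℝ, LorentzSpace n) (fun q ↦ h.inclusion q (σ q)) p := by
  have hp := h.mem_frameDomain_frameIndex p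
  have h1 := ((trivializationAt (EuclideanSpace ℝ (Fin n))
    h.ScreenFiber p).mdifferentiableAt_section_iff (𝓡 n) σ
    (mem_baseSet_trivializationAt _ _ p)).1 hσ
  have h2 : MDifferentiableAt (𝓡 n) 𝓘(ℝ, EuclideanSpace ℝ (Fin n) →L[ℝ] LorentzSpace n)
      (fun q ↦ LinearMap.toContinuousLinearMap (coneFrame (h.frameIndex p) (x q) (y q))) p :=
    (contMDiffAt_clm_of_apply (h.contMDiffAt_frame hp)).mdifferentiableAt (by simp)
  exact (h2.clm_apply h1).congr_of_eventuallyEq (h.inclusion_eventuallyEq σ p)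

theorem projection_inclusion (p : M) (v : h.ScreenFiber p) :
    h.projection p (h.inclusion p v) = v :=
  (h.isScreenIsometry_inclusion p).adjoint_apply v

theorem inclusion_projection (p : M) (z : LorentzSpace n) :
    h.inclusion p (h.projection p z) = tangentialPart (x p) (y p) z :=
  (h.isScreenIsometry_inclusion p).apply_adjoint z

theorem lorentz_inclusion (p : M) (v w : h.ScreenFiber p) :
    lorentz (h.inclusion p v) (h.inclusion p w) = inner ℝ v w :=
  (h.isScreenIsometry_inclusion p).isometric v w

variable [IsManifold (𝓡 n) ∞ M] [T2Space M]

/-- Applying the criterion for homomorphisms twice leaves the product of two smooth sections, which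
is the Lorentzian product of their inclusions. -/
instance : IsContMDiffRiemannianBundle (𝓡 n) ∞ (EuclideanSpace ℝ (Fin n)) h.ScreenFiber := by
  refine ⟨fun p ↦ innerSL ℝ, ?_, fun p v w ↦ rfl⟩
  refine contMDiff_hom_of_apply (E₁ := h.ScreenFiber) (E₂ := fun p ↦ h.ScreenFiber p →L[ℝ] ℝ)
    fun σ hσ ↦ ?_
  refine contMDiff_hom_of_apply (E₁ := h.ScreenFiber) (E₂ := Bundle.Trivial M ℝ)
    (φ := fun p ↦ innerSL ℝ (σ p)) fun σ' hσ' ↦ ?_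
  intro p
  refine (Bundle.contMDiffAt_section (E := Bundle.Trivial M ℝ) _).2 ?_
  have h1 := ((h.contMDiffAt_section_iff σ p).1 (hσ p)).lorentz
    ((h.contMDiffAt_section_iff σ' p).1 (hσ' p))
  simp only [lorentz_inclusion] at h1
  exact h1

/-- The connection of the bundle `{x, y}^⊥`: the tangential part of the flat derivative. -/
def screenConnection : CovariantDerivative (𝓡 n) (EuclideanSpace ℝ (Fin n)) h.ScreenFiber where
  toFun σ p := (h.projection p).comp (mvfderiv (𝓡 n) (fun q ↦ h.inclusion q (σ q)) p)
  isCovariantDerivativeOnUniv :=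
    { add := fun {σ σ' p} hσ hσ' _ ↦ by
        have e := mvfderiv_add (h.mdifferentiableAt_inclusion hσ) (h.mdifferentiableAt_inclusion hσ')
        have e' : (fun q ↦ h.inclusion q ((σ + σ') q)) =
            (fun q ↦ h.inclusion q (σ q)) + fun q ↦ h.inclusion q (σ' q) := by
          funext q
          simp
        rw [e', e, ContinuousLinearMap.comp_add]
      leibniz := fun {σ g p} hσ hg _ ↦ by
        have e := mvfderiv_smul hg (h.mdifferentiableAt_inclusion hσ)
        have e' : (fun q ↦ h.inclusion q ((g • σ) q)) =
            g • (fun q ↦ h.inclusion q (σ q)) := by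
          funext q
          simp
        rw [e', e]
        ext X
        simp [projection_inclusion] }

end IsSpacelikeFrontalWithDual

end ScreenBundle

/-! ### The induced bundle is a frontal bundle satisfying (G2) -/

section InducedFrontalBundle

open Filter Topology

variable {n : ℕ} {M : Type*} [TopologicalSpace M] [ChartedSpace (EuclideanSpace ℝ (Fin n)) M]
  [IsManifold (𝓡 n) ∞ M] [T2Space M] {x y : M → LorentzSpace n}

theorem tangentialPart_eq_self {x y z : LorentzSpace n} (hx : lorentz z x = 0)
    (hy : lorentz z y = 0) : tangentialPart x y z = z := by
  simp [tangentialPart, hx, hy]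

theorem ContMDiffAt.tangentialPart {f g z : M → LorentzSpace n} {p : M}
    (hf : ContMDiffAt (𝓡 n) 𝓘(ℝ, LorentzSpace n) ∞ f p)
    (hg : ContMDiffAt (𝓡 n) 𝓘(ℝ, LorentzSpace n) ∞ g p)
    (hz : ContMDiffAt (𝓡 n) 𝓘(ℝ, LorentzSpace n) ∞ z p) :
    ContMDiffAt (𝓡 n) 𝓘(ℝ, LorentzSpace n) ∞ (fun q ↦ tangentialPart (f q) (g q) (z q)) p :=
  (hz.sub ((hz.lorentz hg).smul hf)).sub ((hz.lorentz hf).smul hg)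

theorem exists_smoothVectorField_eq {p : M} (X : TangentSpace (𝓡 n) p) :
    ∃ V : Π q : M, TangentSpace (𝓡 n) q, IsSmoothVectorField V ∧ V p = X := by
  obtain ⟨N, S, hp, -, hS⟩ := exists_smoothFrame (n := n) (EuclideanSpace ℝ (Fin n))
    (E := (TangentSpace (𝓡 n) : M → Type _)) p
  exact ⟨S _, hS.smooth _, hS.frame_coord p hp X⟩

namespace IsSpacelikeFrontalWithDual

variable (h : IsSpacelikeFrontalWithDual x y)

/-- Differentiate ⟨x, x⟩ = 0. Together with the duality condition this places dx in {x, y}^⊥. -/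
theorem lorentz_differential_fst_self (h : IsSpacelikeFrontalWithDual x y) (p : M)
    (X : TangentSpace (𝓡 n) p) : lorentz (differential x p X) (x p) = 0 := by
  have hx := (h.smooth_fst p).mdifferentiableAt (by simp : (∞ : ℕ∞ω) ≠ 0)
  have h1 := (mvfderiv_lorentz hx hx X).2
  have h2 : (fun q ↦ lorentz (x q) (x q)) = fun _ ↦ 0 := funext fun q ↦ (h.fst_mem q).1
  rw [h2, mvfderiv_const, lorentz_comm (x p)] at h1
  have h3 : (0 : ℝ) = 2 * lorentz (differential x p X) (x p) := by
    rw [two_mul]; exact h1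
  linarith

theorem lorentz_differential_snd_self (h : IsSpacelikeFrontalWithDual x y) (p : M)
    (X : TangentSpace (𝓡 n) p) : lorentz (differential y p X) (y p) = 0 := by
  have hy := (h.smooth_snd p).mdifferentiableAt (by simp : (∞ : ℕ∞ω) ≠ 0)
  have h1 := (mvfderiv_lorentz hy hy X).2
  have h2 : (fun q ↦ lorentz (y q) (y q)) = fun _ ↦ 0 := funext fun q ↦ (h.snd_mem q).1
  rw [h2, mvfderiv_const, lorentz_comm (y p)] at h1
  have h3 : (0 : ℝ) = 2 * lorentz (differential y p X) (y p) := by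
    rw [two_mul]; exact h1
  linarith

/-- The homomorphism `dx`. -/
def firstHom (p : M) : TangentSpace (𝓡 n) p →L[ℝ] h.ScreenFiber p :=
  (h.projection p).comp (differential x p)

/-- The homomorphism `dy`. -/
def secondHom (p : M) : TangentSpace (𝓡 n) p →L[ℝ] h.ScreenFiber p :=
  (h.projection p).comp (differential y p)

theorem inclusion_firstHom (p : M) (X : TangentSpace (𝓡 n) p) :
    h.inclusion p (h.firstHom p X) = differential x p X := by
  refine (h.inclusion_projection p _).trans ?_
  exact tangentialPart_eq_self (h.lorentz_differential_fst_self p X) (h.differential_fst p X)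

theorem inclusion_secondHom (p : M) (X : TangentSpace (𝓡 n) p) :
    h.inclusion p (h.secondHom p X) = differential y p X := by
  refine (h.inclusion_projection p _).trans ?_
  exact tangentialPart_eq_self (h.differential_snd p X) (h.lorentz_differential_snd_self p X)

theorem inclusion_screenConnection (σ : Π p, h.ScreenFiber p) (p : M) (X : TangentSpace (𝓡 n) p) :
    h.inclusion p (h.screenConnection σ p X) =
      tangentialPart (x p) (y p) (differential (fun q ↦ h.inclusion q (σ q)) p X) :=
  h.inclusion_projection p _

theorem inclusion_injective (p : M) : Function.Injective (h.inclusion p) :=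
  (h.isScreenIsometry_inclusion p).injective

theorem tangentialPart_inclusion (p : M) (v : h.ScreenFiber p) :
    tangentialPart (x p) (y p) (h.inclusion p v) = h.inclusion p v :=
  (h.isScreenIsometry_inclusion p).tangentialPart_eq_self v

theorem lorentz_tangentialPart_inclusion (p : M) (z : LorentzSpace n) (v : h.ScreenFiber p) :
    lorentz (tangentialPart (x p) (y p) z) (h.inclusion p v) = lorentz z (h.inclusion p v) :=
  (h.isScreenIsometry_inclusion p).lorentz_tangentialPart z v

theorem lorentz_differential_fst_inclusion (p : M) (X : TangentSpace (𝓡 n) p)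
    (v : h.ScreenFiber p) :
    lorentz (differential x p X) (h.inclusion p v) = inner ℝ (h.firstHom p X) v := by
  rw [← h.lorentz_inclusion, inclusion_firstHom]

theorem lorentz_differential_snd_inclusion (p : M) (X : TangentSpace (𝓡 n) p)
    (v : h.ScreenFiber p) :
    lorentz (differential y p X) (h.inclusion p v) = inner ℝ (h.secondHom p X) v := by
  rw [← h.lorentz_inclusion, inclusion_secondHom]

theorem isSmoothSection_iff (σ : Π p, h.ScreenFiber p) :
    IsSmoothSection n (EuclideanSpace ℝ (Fin n)) σ ↔
      ContMDiff (𝓡 n) 𝓘(ℝ, LorentzSpace n) ∞ (fun q ↦ h.inclusion q (σ q)) :=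
  forall_congr' fun p ↦ h.contMDiffAt_section_iff σ p

theorem isSmoothBundleHom_firstHom : IsSmoothBundleHom n (EuclideanSpace ℝ (Fin n)) h.firstHom := by
  refine contMDiff_hom_of_apply (E₁ := (TangentSpace (𝓡 n) : M → Type _)) fun X hX ↦ ?_
  refine (h.isSmoothSection_iff _).2 ?_
  simp only [inclusion_firstHom]
  exact contMDiff_mvfderiv_apply h.smooth_fst hX

theorem isSmoothBundleHom_secondHom :
    IsSmoothBundleHom n (EuclideanSpace ℝ (Fin n)) h.secondHom := by
  refine contMDiff_hom_of_apply (E₁ := (TangentSpace (𝓡 n) : M → Type _)) fun X hX ↦ ?_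
  refine (h.isSmoothSection_iff _).2 ?_
  simp only [inclusion_secondHom]
  exact contMDiff_mvfderiv_apply h.smooth_snd hX

theorem isSmoothSection_screenConnection {σ : Π p, h.ScreenFiber p}
    (hσ : IsSmoothSection n (EuclideanSpace ℝ (Fin n)) σ) {X : Π p : M, TangentSpace (𝓡 n) p}
    (hX : IsSmoothVectorField X) :
    IsSmoothSection n (EuclideanSpace ℝ (Fin n)) fun p ↦ h.screenConnection σ p (X p) := by
  refine (h.isSmoothSection_iff _).2 fun p ↦ ?_
  simp only [inclusion_screenConnection]
  exact (h.smooth_fst p).tangentialPart (h.smooth_snd p)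
    (contMDiff_mvfderiv_apply ((h.isSmoothSection_iff σ).1 hσ) hX p)

theorem contMDiffCovariantDerivative_screenConnection :
    CovariantDerivative.ContMDiffCovariantDerivative h.screenConnection ∞ where
  contMDiff := ⟨fun {σ} hσ ↦ (contMDiff_hom_of_apply (E₁ := (TangentSpace (𝓡 n) : M → Type _))
    (φ := h.screenConnection σ) fun _ hX ↦
      h.isSmoothSection_screenConnection (contMDiffOn_univ.1 hσ) hX).contMDiffOn⟩

/-- The flat derivative obeys the product rule, and projecting it does not change its product with
vectors of {x, y}^⊥. -/
theorem isMetricCompatible_screenConnection : h.screenConnection.IsMetricCompatible := by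
  refine h.screenConnection.isMetricCompatible_iff.2 fun {p X σ τ} _ hσ hτ ↦ ?_
  have h1 := (mvfderiv_lorentz (h.mdifferentiableAt_inclusion hσ)
    (h.mdifferentiableAt_inclusion hτ) (X p)).2
  simp only [lorentz_inclusion] at h1
  refine h1.trans ?_
  beta_reduce
  rw [← h.lorentz_inclusion, ← h.lorentz_inclusion, inclusion_screenConnection,
    inclusion_screenConnection, h.lorentz_tangentialPart_inclusion,
    lorentz_comm (h.inclusion p (σ p)) (tangentialPart _ _ _),
    h.lorentz_tangentialPart_inclusion, lorentz_comm (h.inclusion p (σ p))]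
  rfl

theorem mvfderiv_mvfderiv_eq {f : M → LorentzSpace n}
    (hf : ContMDiff (𝓡 n) 𝓘(ℝ, LorentzSpace n) ∞ f) {X Y : Π p : M, TangentSpace (𝓡 n) p}
    (hX : IsSmoothVectorField X) (hY : IsSmoothVectorField Y) (p : M) :
    differential f p (mlieBracket (𝓡 n) X Y p) =
      differential (fun q ↦ differential f q (Y q)) p (X p) -
        differential (fun q ↦ differential f q (X q)) p (Y p) :=
  (mvfderiv_mvfderiv_sub (hf p) (hX.mdifferentiable (by simp) p)
    (hY.mdifferentiable (by simp) p)).symm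

/-- The torsion equation is the tangential part of X(Yx) - Y(Xx) = [X, Y]x. -/
theorem isCoherentTangentBundle_firstHom :
    IsCoherentTangentBundle h.screenConnection h.firstHom where
  rank_eq := by simp
  smooth_connection := h.contMDiffCovariantDerivative_screenConnection
  metric_connection := h.isMetricCompatible_screenConnection
  smooth_hom := h.isSmoothBundleHom_firstHom
  torsion_free X Y hX hY p := by
    refine h.inclusion_injective p ?_
    rw [map_zero, map_sub, map_sub, inclusion_screenConnection, inclusion_screenConnection,
      ← h.tangentialPart_inclusion p (h.firstHom p _)]
    simp only [inclusion_firstHom, ← tangentialPartₗ_apply]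
    rw [← map_sub, ← map_sub, mvfderiv_mvfderiv_eq h.smooth_fst hX hY, sub_self, map_zero]

theorem isCoherentTangentBundle_secondHom :
    IsCoherentTangentBundle h.screenConnection h.secondHom where
  rank_eq := by simp
  smooth_connection := h.contMDiffCovariantDerivative_screenConnection
  metric_connection := h.isMetricCompatible_screenConnection
  smooth_hom := h.isSmoothBundleHom_secondHom
  torsion_free X Y hX hY p := by
    refine h.inclusion_injective p ?_
    rw [map_zero, map_sub, map_sub, inclusion_screenConnection, inclusion_screenConnection,
      ← h.tangentialPart_inclusion p (h.secondHom p _)]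
    simp only [inclusion_secondHom, ← tangentialPartₗ_apply]
    rw [← map_sub, ← map_sub, mvfderiv_mvfderiv_eq h.smooth_snd hX hY, sub_self, map_zero]

/-- Differentiating ⟨x, dy(Y)⟩ = 0 along X gives ⟨dx(X), dy(Y)⟩ = -⟨x, X(Yy)⟩; the difference after
exchanging X and Y is a multiple of ⟨x, dy([X, Y])⟩ = 0. -/
theorem lorentz_differential_comm (h : IsSpacelikeFrontalWithDual x y) (p : M)
    (X Y : TangentSpace (𝓡 n) p) :
    lorentz (differential x p X) (differential y p Y) =
      lorentz (differential x p Y) (differential y p X) := by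
  obtain ⟨X, hX, rfl⟩ := exists_smoothVectorField_eq X
  obtain ⟨Y, hY, rfl⟩ := exists_smoothVectorField_eq Y
  have key : ∀ {X Y : Π p : M, TangentSpace (𝓡 n) p}, IsSmoothVectorField X →
      IsSmoothVectorField Y → lorentz (differential x p (X p)) (differential y p (Y p)) =
        -lorentz (x p) (differential (fun q ↦ differential y q (Y q)) p (X p)) := by
    intro X Y hX hY
    have hdy := contMDiff_mvfderiv_apply h.smooth_snd hY
    have h1 := (mvfderiv_lorentz ((h.smooth_fst p).mdifferentiableAt (by simp : (∞ : ℕ∞ω) ≠ 0))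
      ((hdy p).mdifferentiableAt (by simp)) (X p)).2
    have h2 : (fun q ↦ lorentz (x q) (mvfderiv (𝓡 n) y q (Y q))) = fun _ ↦ 0 :=
      funext fun q ↦ (lorentz_comm _ _).trans (h.differential_snd q (Y q))
    rw [h2, mvfderiv_const] at h1
    exact eq_neg_of_add_eq_zero_left h1.symm
  have h3 := mvfderiv_mvfderiv_eq h.smooth_snd hX hY p
  have h4 := h.differential_snd p (mlieBracket (𝓡 n) X Y p)
  rw [h3, lorentz_comm, lorentz_sub_right] at h4
  rw [key hX hY, key hY hX]
  linarith

theorem isFrontalBundle : IsFrontalBundle h.screenConnection h.firstHom h.secondHom where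
  coherent_first := h.isCoherentTangentBundle_firstHom
  coherent_second := h.isCoherentTangentBundle_secondHom
  compatible p X Y := by
    simp only [← lorentz_inclusion, inclusion_firstHom, inclusion_secondHom]
    exact h.lorentz_differential_comm p X Y

/-- Differentiating ⟨s, x⟩ = ⟨s, y⟩ = 0 turns the tangential part of Ys into Ys + a x + b y with a =
⟨s, dy(Y)⟩ and b = ⟨s, dx(Y)⟩. In a second derivative the terms along `x` and `y` project to zero,
and a dx + b dy is what remains. -/
theorem inclusion_screenConnection_screenConnection {σ : Π p, h.ScreenFiber p}
    (hσ : IsSmoothSection n (EuclideanSpace ℝ (Fin n)) σ) (X : Π p : M, TangentSpace (𝓡 n) p)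
    {Y : Π p : M, TangentSpace (𝓡 n) p} (hY : IsSmoothVectorField Y) (p : M) :
    h.inclusion p (h.screenConnection (fun q ↦ h.screenConnection σ q (Y q)) p (X p)) =
      tangentialPart (x p) (y p) (differential
        (fun q ↦ differential (fun r ↦ h.inclusion r (σ r)) q (Y q)) p (X p)) +
      inner ℝ (σ p) (h.secondHom p (Y p)) • differential x p (X p) +
      inner ℝ (σ p) (h.firstHom p (Y p)) • differential y p (X p) := by
  set s : M → LorentzSpace n := fun q ↦ h.inclusion q (σ q) with hs
  have hsm : ContMDiff (𝓡 n) 𝓘(ℝ, LorentzSpace n) ∞ s := (h.isSmoothSection_iff σ).1 hσ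
  have hmd : ∀ {G : Type} [NormedAddCommGroup G] [NormedSpace ℝ G] {f : M → G},
      ContMDiff (𝓡 n) 𝓘(ℝ, G) ∞ f → MDifferentiableAt (𝓡 n) 𝓘(ℝ, G) f p := fun hf ↦
    (hf p).mdifferentiableAt (by simp)
  have hu : ContMDiff (𝓡 n) 𝓘(ℝ, LorentzSpace n) ∞ fun q ↦ mvfderiv (𝓡 n) s q (Y q) :=
    contMDiff_mvfderiv_apply hsm hY
  let a : M → ℝ := fun q ↦ lorentz (s q) (mvfderiv (𝓡 n) y q (Y q))
  let b : M → ℝ := fun q ↦ lorentz (s q) (mvfderiv (𝓡 n) x q (Y q))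
  have ha : ContMDiff (𝓡 n) 𝓘(ℝ, ℝ) ∞ a := fun q ↦
    (hsm q).lorentz (contMDiff_mvfderiv_apply h.smooth_snd hY q)
  have hb : ContMDiff (𝓡 n) 𝓘(ℝ, ℝ) ∞ b := fun q ↦
    (hsm q).lorentz (contMDiff_mvfderiv_apply h.smooth_fst hY q)
  have hg : (fun q ↦ h.inclusion q (h.screenConnection σ q (Y q))) =
      (fun q ↦ mvfderiv (𝓡 n) s q (Y q)) + a • x + b • y := by
    funext q
    have h1 : (fun q ↦ lorentz (s q) (x q)) = fun _ ↦ 0 :=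
      funext fun q ↦ (h.isScreenIsometry_inclusion q).orthogonal_fst (σ q)
    have h2 : (fun q ↦ lorentz (s q) (y q)) = fun _ ↦ 0 :=
      funext fun q ↦ (h.isScreenIsometry_inclusion q).orthogonal_snd (σ q)
    have hsq := (hsm q).mdifferentiableAt (by simp : (∞ : ℕ∞ω) ≠ 0)
    have e₁ := (mvfderiv_lorentz hsq ((h.smooth_fst q).mdifferentiableAt (by simp)) (Y q)).2
    have e₂ := (mvfderiv_lorentz hsq ((h.smooth_snd q).mdifferentiableAt (by simp)) (Y q)).2
    rw [h1, mvfderiv_const] at e₁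
    rw [h2, mvfderiv_const] at e₂
    have e₁' : lorentz (mvfderiv (𝓡 n) s q (Y q)) (x q) = -b q :=
      eq_neg_of_add_eq_zero_left e₁.symm
    have e₂' : lorentz (mvfderiv (𝓡 n) s q (Y q)) (y q) = -a q :=
      eq_neg_of_add_eq_zero_left e₂.symm
    rw [inclusion_screenConnection]
    change mvfderiv (𝓡 n) s q (Y q) - lorentz (mvfderiv (𝓡 n) s q (Y q)) (y q) • x q -
      lorentz (mvfderiv (𝓡 n) s q (Y q)) (x q) • y q =
        mvfderiv (𝓡 n) s q (Y q) + a q • x q + b q • y q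
    rw [e₁', e₂']
    module
  have hx := hmd h.smooth_fst
  have hy := hmd h.smooth_snd
  have d₁ := mvfderiv_smul (hmd ha) hx
  have d₂ := mvfderiv_smul (hmd hb) hy
  have d := mvfderiv_add ((hmd hu).add ((hmd ha).smul hx)) ((hmd hb).smul hy)
  have d' := mvfderiv_add (hmd hu) ((hmd ha).smul hx)
  have hd := congrArg (fun T : TangentSpace (𝓡 n) p →L[ℝ] LorentzSpace n ↦ T (X p))
    (d.trans (congrArg₂ (· + ·) (d'.trans (congrArg₂ (· + ·) rfl d₁)) d₂))
  have hA : inner ℝ (σ p) (h.secondHom p (Y p)) = a p := by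
    rw [← h.lorentz_inclusion, inclusion_secondHom]; rfl
  have hB : inner ℝ (σ p) (h.firstHom p (Y p)) = b p := by
    rw [← h.lorentz_inclusion, inclusion_firstHom]; rfl
  have hd' : differential (fun q ↦ h.inclusion q (h.screenConnection σ q (Y q))) p (X p) =
      differential (fun q ↦ differential s q (Y q)) p (X p) +
        (a p • differential x p (X p) + mvfderiv (𝓡 n) a p (X p) • x p) +
        (b p • differential y p (X p) + mvfderiv (𝓡 n) b p (X p) • y p) := by
    rw [hg]
    exact hd
  rw [inclusion_screenConnection, hd', hA, hB]
  have tx : tangentialPartₗ (x p) (y p) (x p) = 0 := by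
    simp [tangentialPartₗ_apply, tangentialPart, h.pairing, (h.fst_mem p).1]
  have ty : tangentialPartₗ (x p) (y p) (y p) = 0 := by
    simp [tangentialPartₗ_apply, tangentialPart, lorentz_comm (y p) (x p), h.pairing,
      (h.snd_mem p).1]
  have tdx : tangentialPartₗ (x p) (y p) (differential x p (X p)) = differential x p (X p) :=
    tangentialPart_eq_self (h.lorentz_differential_fst_self p _) (h.differential_fst p _)
  have tdy : tangentialPartₗ (x p) (y p) (differential y p (X p)) = differential y p (X p) :=
    tangentialPart_eq_self (h.differential_snd p _) (h.lorentz_differential_snd_self p _)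
  simp only [← tangentialPartₗ_apply, map_add, map_smul, tx, ty, tdx, tdy, smul_zero, add_zero]

/-- Gauss equation: after antisymmetrization the flat second derivatives cancel against the bracket
term, leaving only the products of dx and dy. -/
theorem satisfiesCurvatureIdentity :
    SatisfiesCurvatureIdentity h.screenConnection h.firstHom h.secondHom := by
  intro X Y v w hX hY hv hw p
  have hs := (h.isSmoothSection_iff v).1 hv
  have h1 : h.inclusion p (curvature h.screenConnection X Y v p) =
      (inner ℝ (v p) (h.secondHom p (Y p)) • differential x p (X p) +
        inner ℝ (v p) (h.firstHom p (Y p)) • differential y p (X p)) -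
      (inner ℝ (v p) (h.secondHom p (X p)) • differential x p (Y p) +
        inner ℝ (v p) (h.firstHom p (X p)) • differential y p (Y p)) := by
    rw [curvature, map_sub, map_sub, h.inclusion_screenConnection_screenConnection hv X hY,
      h.inclusion_screenConnection_screenConnection hv Y hX, inclusion_screenConnection,
      mvfderiv_mvfderiv_eq hs hX hY]
    simp only [← tangentialPartₗ_apply, map_sub]
    abel
  rw [← h.lorentz_inclusion, h1, Matrix.det_fin_two_of, Matrix.det_fin_two_of]
  simp only [lorentz_sub_left, lorentz_add_left, lorentz_smul_left,
    lorentz_differential_fst_inclusion, lorentz_differential_snd_inclusion, real_inner_comm (v p)]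
  ring

theorem isRealizedBy : IsRealizedBy h.screenConnection h.firstHom h.secondHom x y where
  exists_realization := ⟨h.inclusion,
    { smooth := fun v hv ↦ (h.isSmoothSection_iff v).1 hv
      isometric := h.lorentz_inclusion
      range_eq := fun p ↦ (h.isScreenIsometry_inclusion p).range_eq
      map_first := h.inclusion_firstHom
      map_second := h.inclusion_secondHom
      map_connection := fun v _ p X ↦ h.inclusion_screenConnection v p X }⟩
  firstForm_eq p X Y := by
    rw [firstForm, ← h.lorentz_inclusion, inclusion_firstHom, inclusion_firstHom]
  secondForm_eq p X Y := by
    rw [secondForm, ← h.lorentz_inclusion, inclusion_firstHom, inclusion_secondHom]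
  thirdForm_eq p X Y := by
    rw [thirdForm, ← h.lorentz_inclusion, inclusion_secondHom, inclusion_secondHom]

end IsSpacelikeFrontalWithDual

end InducedFrontalBundle

end

/-! ### The realization theorem and its converse -/

theorem mainTheorem4 {n : ℕ} (hn : 1 ≤ n)
    {M : Type*} [TopologicalSpace M] [T2Space M] [SecondCountableTopology M]
    [ChartedSpace (EuclideanSpace ℝ (Fin n)) M] [IsManifold (𝓡 n) ∞ M] [SimplyConnectedSpace M] :
    (∀ (F : Type*) [NormedAddCommGroup F] [NormedSpace ℝ F] [FiniteDimensional ℝ F]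
      (E : M → Type*) [TopologicalSpace (TotalSpace F E)]
      [∀ p, NormedAddCommGroup (E p)] [∀ p, InnerProductSpace ℝ (E p)]
      [FiberBundle F E] [VectorBundle ℝ F E] [ContMDiffVectorBundle ∞ F E (𝓡 n)]
      [IsContMDiffRiemannianBundle (𝓡 n) ∞ F E]
      (D : CovariantDerivative (𝓡 n) F E) (ξ ζ : Π p : M, TangentSpace (𝓡 n) p →L[ℝ] E p),
      IsFrontalBundle D ξ ζ → SatisfiesCurvatureIdentity D ξ ζ →
        ∃ x y : M → LorentzSpace n,
          IsSpacelikeFrontalWithDual x y ∧ IsRealizedBy D ξ ζ x y) ∧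
    (∀ x y : M → LorentzSpace n, IsSpacelikeFrontalWithDual x y →
      ∃ (E : M → Type) (_ : TopologicalSpace (TotalSpace (EuclideanSpace ℝ (Fin n)) E))
        (_ : ∀ p, NormedAddCommGroup (E p)) (_ : ∀ p, InnerProductSpace ℝ (E p))
        (_ : FiberBundle (EuclideanSpace ℝ (Fin n)) E)
        (_ : VectorBundle ℝ (EuclideanSpace ℝ (Fin n)) E)
        (_ : ContMDiffVectorBundle ∞ (EuclideanSpace ℝ (Fin n)) E (𝓡 n))
        (_ : IsContMDiffRiemannianBundle (𝓡 n) ∞ (EuclideanSpace ℝ (Fin n)) E)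
        (D : CovariantDerivative (𝓡 n) (EuclideanSpace ℝ (Fin n)) E)
        (ξ ζ : Π p : M, TangentSpace (𝓡 n) p →L[ℝ] E p),
        IsFrontalBundle D ξ ζ ∧ SatisfiesCurvatureIdentity D ξ ζ ∧
          IsRealizedBy D ξ ζ x y) := by
  refine ⟨fun F _ _ _ E _ _ _ _ _ _ _ D ξ ζ h hG ↦ h.exists_realization hG, fun x y h ↦ ?_⟩
  exact ⟨h.ScreenFiber, inferInstance, inferInstance, inferInstance, inferInstance, inferInstance,
    inferInstance, inferInstance, h.screenConnection, h.firstHom, h.secondHom, h.isFrontalBundle,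
    h.satisfiesCurvatureIdentity, h.isRealizedBy⟩
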